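/- Let $N\ge 2$ be an integer. Then there exist a standard Borel space $X$ with a $\sigma$-finite, non-atomic measure $\mu$, $\mu(X)=\infty$, and an invertible $\mu$-preserving transformation $T$ of $X$ of rank one with the properties (1)–(3) below. Here rank one means that there are measurable sets $E_j$ of finite measure and integers $h_j\ge 0$ such that for each $j$ the sets $E_j,TE_j,\dots,T^{h_j}E_j$ are pairwise disjoint, and every measurable set of finite measure is approximated in measure, arbitrarily well for all sufficiently large $j$, by unions of some of these sets. For integers $m,n$ let $T^m\otimes T^n$ be the unitary operator $F(x,y)\mapsto F(T^mx,T^ny)$ on the complex space $L^2(X\times X,\mu\otimes\mu)$. (1) For all integers $1\le m<n\le N$ the operator $T^m\otimes T^n$ has simple singular spectrum. (2) For every integer $m\ne 0$ the operator $T^m\otimes T^m$ has homogeneous singular spectrum of multiplicity $2$. (3) For every integer $n>N$ the transformation $T\times T^n$ of $(X\times X,\mu\otimes\mu)$ is dissipative, i.e. up to a null set $X\times X$ is the disjoint union of the sets $(T\times T^n)^iD$, $i\in\mathbb Z$, for some measurable $D$; and the operator $T\otimes T^n$ has Lebesgue spectrum of countably infinite multiplicity. Here, for a unitary operator $U$ on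 a Hilbert space $H$, the spectral measure of $f\in H$ is the finite Borel measure $\sigma_f$ on the unit circle with $\langle U^kf,f\rangle=\int z^k\,d\sigma_f(z)$ for all $k\in\mathbb Z$. The spectrum of $U$ is simple if some $f$ is cyclic, i.e. the linear span of $\{U^kf:k\in\mathbb Z\}$ is dense in $H$; it is singular if every $\sigma_f$ is singular with respect to Lebesgue measure. It is homogeneous of multiplicity $r$ if $H$ is the orthogonal sum of $r$ closed cyclic subspaces (closed spans of $\{U^ke_i:k\in\mathbb Z\}$) whose cyclic vectors $e_i$ have one and the same nonzero spectral measure; if $r$ is countably infinite and this measure is normalized Lebesgue measure, $U$ has Lebesgue spectrum of countably infinite multiplicity. -/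

import Mathlib

open MeasureTheory Set
open scoped ENNReal InnerProductSpace symmDiff

/-! ### Invertible measure-preserving transformations -/

/-- An automorphism of the measure space `(X, μ)`: an invertible, bi-measurable map of `X`
that preserves `μ`. -/
structure MeasureAut {X : Type*} [MeasurableSpace X] (μ : Measure X) where
  /-- the underlying measurable bijection -/
  toEquiv : X ≃ᵐ X
  /-- it preserves the measure -/
  preserves : MeasurePreserving toEquiv μ μ

namespace MeasureAut

variable {X : Type*} [MeasurableSpace X] {μ : Measure X}

theorem measurable_perm_zpow (T : X ≃ᵐ X) (m : ℤ) :
    Measurable ((T.toEquiv ^ m : Equiv.Perm X) : X → X) := by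
  have hpos : ∀ (S : X ≃ᵐ X) (n : ℕ), Measurable ((S.toEquiv ^ n : Equiv.Perm X) : X → X) := by
    intro S n
    rw [Equiv.Perm.coe_pow]
    exact S.measurable.iterate n
  cases m with
  | ofNat n => simpa using hpos T n
  | negSucc n =>
    rw [zpow_negSucc, ← inv_pow]
    exact hpos T.symm (n + 1)

theorem measurePreserving_perm_zpow (T : MeasureAut μ) (m : ℤ) :
    MeasurePreserving ((T.toEquiv.toEquiv ^ m : Equiv.Perm X) : X → X) μ μ := by
  have hpos : ∀ (S : X ≃ᵐ X) (_ : MeasurePreserving S μ μ) (n : ℕ),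
      MeasurePreserving ((S.toEquiv ^ n : Equiv.Perm X) : X → X) μ μ := by
    intro S hS n
    rw [Equiv.Perm.coe_pow]
    exact hS.iterate n
  cases m with
  | ofNat n => simpa using hpos T.toEquiv T.preserves n
  | negSucc n =>
    rw [zpow_negSucc, ← inv_pow]
    exact hpos T.toEquiv.symm (T.preserves.symm T.toEquiv) (n + 1)

/-- The integer power `T ^ m` of an automorphism. -/
def zpow (T : MeasureAut μ) (m : ℤ) : MeasureAut μ where
  toEquiv :=
    { toEquiv := T.toEquiv.toEquiv ^ m
      measurable_toFun := measurable_perm_zpow T.toEquiv m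
      measurable_invFun := by
        have h := measurable_perm_zpow T.toEquiv (-m)
        rw [zpow_neg] at h
        exact h }
  preserves := T.measurePreserving_perm_zpow m

/-- The product automorphism `S × T`, `(x, y) ↦ (S x, T y)`, of `(X × X, μ ⊗ μ)`. -/
def prod [SFinite μ] (S T : MeasureAut μ) : MeasureAut (μ.prod μ) where
  toEquiv := S.toEquiv.prodCongr T.toEquiv
  preserves := S.preserves.prod T.preserves

/-- The Koopman operator `f ↦ f ∘ T` of an automorphism, a unitary operator of the complex
Hilbert space `L²(X, μ)`. -/
noncomputable def koopman (T : MeasureAut μ) : Lp ℂ 2 μ ≃ₗᵢ[ℂ] Lp ℂ 2 μ where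
  toFun := Lp.compMeasurePreservingₗᵢ ℂ T.toEquiv T.preserves
  invFun := Lp.compMeasurePreservingₗᵢ ℂ T.toEquiv.symm (T.preserves.symm T.toEquiv)
  map_add' := map_add _
  map_smul' := map_smul _
  left_inv := by
    intro f
    change Lp.compMeasurePreserving _ _ (Lp.compMeasurePreserving _ _ f) = f
    rw [← Lp.compMeasurePreserving_comp_apply]
    simp only [MeasurableEquiv.self_comp_symm]
    exact Lp.compMeasurePreserving_id_apply f
  right_inv := by
    intro f
    change Lp.compMeasurePreserving _ _ (Lp.compMeasurePreserving _ _ f) = f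
    rw [← Lp.compMeasurePreserving_comp_apply]
    simp only [MeasurableEquiv.symm_comp_self]
    exact Lp.compMeasurePreserving_id_apply f
  norm_map' := (Lp.compMeasurePreservingₗᵢ ℂ T.toEquiv T.preserves).norm_map

theorem coeFn_koopman (T : MeasureAut μ) (f : Lp ℂ 2 μ) :
    (T.koopman f : X → ℂ) =ᵐ[μ] (f : X → ℂ) ∘ T.toEquiv :=
  Lp.coeFn_compMeasurePreserving f T.preserves

/-- `T` has rank one: there are towers `E j, T (E j), …, T ^ (h j) (E j)` of pairwise disjoint
measurable sets such that every measurable set of finite measure is, for all sufficiently large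
`j`, approximated arbitrarily well by unions of levels of the `j`-th tower. -/
def IsRankOne (T : MeasureAut μ) : Prop :=
  ∃ (E : ℕ → Set X) (h : ℕ → ℕ),
    (∀ j, MeasurableSet (E j) ∧ μ (E j) ≠ ∞) ∧
    (∀ j i i', i ≤ h j → i' ≤ h j → i ≠ i' →
      Disjoint ((T.toEquiv)^[i] '' E j) ((T.toEquiv)^[i'] '' E j)) ∧
    ∀ A : Set X, MeasurableSet A → μ A ≠ ∞ → ∀ ε : ℝ≥0∞, 0 < ε →
      ∃ J : ℕ, ∀ j ≥ J, ∃ s : Finset ℕ, (∀ i ∈ s, i ≤ h j) ∧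
        μ (A ∆ ⋃ i ∈ s, (T.toEquiv)^[i] '' E j) < ε

/-- `T` is dissipative: up to a null set, the space is the disjoint union of the images
`T ^ i D`, `i ∈ ℤ`, of a measurable set `D`. -/
def IsDissipative (T : MeasureAut μ) : Prop :=
  ∃ D : Set X, MeasurableSet D ∧
    (∀ i i' : ℤ, i ≠ i' → Disjoint ((T.zpow i).toEquiv '' D) ((T.zpow i').toEquiv '' D)) ∧
    μ (⋃ i : ℤ, (T.zpow i).toEquiv '' D)ᶜ = 0

end MeasureAut

/-! ### Spectral notions for a unitary operator -/

section Spectral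

variable {H : Type*} [NormedAddCommGroup H] [InnerProductSpace ℂ H]

/-- `σ` is the spectral measure of the vector `f`: the numbers `⟨U ^ k f, f⟩`, `k ∈ ℤ`, are the
Fourier coefficients of `σ`. The circle is `ℝ / ℤ`, with characters `fourier k x = exp (2 π i k x)`.
-/
def IsSpectralMeasure (U : H ≃ₗᵢ[ℂ] H) (f : H) (σ : Measure UnitAddCircle) : Prop :=
  ∀ k : ℤ, ⟪f, (U ^ k) f⟫_ℂ = ∫ x, fourier k x ∂σ

/-- Simple spectrum: there is a cyclic vector. -/
def HasSimpleSpectrum (U : H ≃ₗᵢ[ℂ] H) : Prop :=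
  ∃ f : H, (Submodule.span ℂ (range fun k : ℤ => (U ^ k) f)).topologicalClosure = ⊤

/-- Singular spectrum: the spectral measure of every vector is a finite measure that is singular
with respect to Lebesgue (Haar) measure on the circle. -/
def HasSingularSpectrum (U : H ≃ₗᵢ[ℂ] H) : Prop :=
  ∀ f : H, ∃ σ : Measure UnitAddCircle, IsFiniteMeasure σ ∧ IsSpectralMeasure U f σ ∧
    Measure.MutuallySingular σ AddCircle.haarAddCircle

/-- `H` is the orthogonal sum of cyclic subspaces of `U`, indexed by `ι`, whose cyclic vectors
all have the spectral measure `σ`; equivalently, `U` is unitarily equivalent to the sum of `ι`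
copies of multiplication by the independent variable in `L²(σ)`. -/
def HasHomogeneousSpectrumOfType (U : H ≃ₗᵢ[ℂ] H) (ι : Type*) (σ : Measure UnitAddCircle) :
    Prop :=
  ∃ e : ι → H,
    (∀ i, IsSpectralMeasure U (e i) σ) ∧
    (∀ i i', i ≠ i' → ∀ k : ℤ, ⟪e i, (U ^ k) (e i')⟫_ℂ = 0) ∧
    (Submodule.span ℂ (range fun p : ι × ℤ => (U ^ p.2) (e p.1))).topologicalClosure = ⊤

/-- Homogeneous spectrum of multiplicity `n`. -/
def HasHomogeneousSpectrum (U : H ≃ₗᵢ[ℂ] H) (n : ℕ) : Prop :=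
  ∃ σ : Measure UnitAddCircle, IsFiniteMeasure σ ∧ σ ≠ 0 ∧
    HasHomogeneousSpectrumOfType U (Fin n) σ

/-- Lebesgue spectrum of countably infinite multiplicity. -/
def HasCountableLebesgueSpectrum (U : H ≃ₗᵢ[ℂ] H) : Prop :=
  HasHomogeneousSpectrumOfType U ℕ AddCircle.haarAddCircle

end Spectral

/-! ### Cutting and stacking -/

/-! `T` is built by cutting and stacking. The `i`-th tower, with levels `-m i, …, m i`, is cut into
four columns, which are put into the next tower at the offsets `0`, `d₀`, `v`, `v + d₁`, with
spacers elsewhere. Here `d_r = a_r k + α_r` with `1 ≤ a_r ≤ N`, `α_r ∈ {0, 1}`, and `m i ≪ k ≪ v ≪ m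
(i + 1)`. At a time `n k` with `1 ≤ n ≤ N` only the two pairs of columns are seen: the first column
of pair `r` is carried to the second one exactly when `a_r = n`, and then with the delay `α_r`.
Writing `T` also for the Koopman operator, along the stages with a prescribed choice of `(a_r, α_r)`
the powers `T ^ (n k)` tend weakly to `x + y T⁻¹`, where `x` and `y` are a quarter of the number of
pairs with `(a_r, α_r) = (n, 0)` and `(n, 1)` (`corr_eq`, `corrLimit`). Every choice recurs
infinitely often (`exists_isRich`), so all these limits are available.

Singularity: some powers of the operator tend weakly to a non-zero scalar, which is incompatible
with an absolutely continuous part of a spectral measure, by the Riemann-Lebesgue lemma. If the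
scalar has modulus less than one, there are no eigenvectors either.

Simple spectrum: for `m < n` the choices `(m, 0), (n, 1)` and `(m, 1), (n, 0)` give multiples of `1
⊗ T⁻¹` and `T⁻¹ ⊗ 1` as weak limits of powers of `T ^ m ⊗ T ^ n`. So the cyclic subspace of the
indicator `F` of the product of the base levels is invariant under both coordinate shifts, and such
a subspace is everything (`eq_top_of_op_mem`).

Multiplicity two: as `m` divides `k` at high stages, the powers of `T ^ m ⊗ T ^ m` have multiples of
`T⁻¹ ⊗ T⁻¹` and `(1 + T⁻¹) ⊗ (1 + T⁻¹)` as limits. So the cyclic subspace of `F` is invariant under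
`T ⊗ T` and `T ⊗ 1 + 1 ⊗ T` and contains all symmetric functions. The unitary polar factor of `T ⊗ 1
- 1 ⊗ T` commutes with `T ^ m ⊗ T ^ m` and anticommutes with the exchange of coordinates. It carries
the symmetric functions onto the antisymmetric ones, which thus form a second cyclic subspace with
the same spectral measure.

Dissipativity: a return time of `T` to a level is close to a distance of columns at some stage, that
is, to some `a k` with `a ≤ N` or to `v`. For `n > N` the numbers `t` and `n t` cannot both be of
this kind at high stages, so products of levels have finitely many return times under `T × T ^ n`
(`finite_return`). This yields a wandering set whose images fill the space, and an orthonormal basis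
of its `L²` space generates the Lebesgue spectrum. -/

/-- The data of a symmetric cutting-and-stacking construction with four columns: the levels of the
`i`-th tower are numbered by `[-m i, m i]`, and the four copies of the `i`-th tower sit in the next
one with the offsets `P i a`. -/
structure StackData where
  m : ℕ → ℤ
  P : ℕ → Fin 4 → ℤ
  m_zero : m 0 = 0
  P_zero : ∀ i, P i 0 = 0
  P_nonneg : ∀ i a, 0 ≤ P i a
  m_succ : ∀ i a, m i + P i a + 1 ≤ m (i + 1)
  sep : ∀ i a b, a ≠ b → 2 * m i + 1 < |P i a - P i b|

namespace StackData

variable (S : StackData)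

theorem m_lt_succ (i : ℕ) : S.m i + 1 ≤ S.m (i + 1) := by
  have := S.m_succ i 0
  rw [S.P_zero] at this
  linarith

theorem le_m (i : ℕ) : (i : ℤ) ≤ S.m i := by
  induction i with
  | zero => simp [S.m_zero]
  | succ i ih => have := S.m_lt_succ i; push_cast; linarith

theorem m_nonneg (i : ℕ) : 0 ≤ S.m i := (Int.natCast_nonneg i).trans (S.le_m i)

theorem m_mono : Monotone S.m :=
  monotone_nat_of_le_succ fun i => by linarith [S.m_lt_succ i]

theorem eq_of_add_eq {i : ℕ} {f g : ℤ} {a b : Fin 4} (hf : |f| ≤ S.m i) (hg : |g| ≤ S.m i)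
    (h : f + S.P i a = g + S.P i b) : f = g ∧ a = b := by
  have hab : a = b := by
    by_contra hne
    have h1 := S.sep i a b hne
    have h2 : S.P i a - S.P i b = g - f := by linarith
    rw [h2] at h1
    have := abs_sub g f
    linarith
  subst hab
  exact ⟨by linarith, rfl⟩

theorem abs_add_P_le {i : ℕ} {f : ℤ} (hf : |f| ≤ S.m i) (a : Fin 4) :
    |f + S.P i a| ≤ S.m (i + 1) := by
  have h1 := abs_add_le f (S.P i a)
  rw [abs_of_nonneg (S.P_nonneg i a)] at h1
  linarith [S.m_succ i a]

/-- Codes of points: the digits record the chosen copies, the integer the initial position. -/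
abbrev Code := (ℕ → Fin 4) × ℤ

/-- The position of a point in the `i`-th tower. -/
def pos (i : ℕ) (x : Code) : ℤ := x.2 + ∑ l ∈ Finset.range i, S.P l (x.1 l)

/-- The codes of the points of the `i`-th tower. -/
def col : ℕ → Set Code
  | 0 => {x | x.2 = 0}
  | i + 1 => col i ∪ {x | (∀ l ≤ i, x.1 l = 0) ∧ |x.2| ≤ S.m (i + 1) ∧
      ∀ f a, |f| ≤ S.m i → x.2 ≠ f + S.P i a}

theorem pos_succ (i : ℕ) (x : Code) : S.pos (i + 1) x = S.pos i x + S.P i (x.1 i) := by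
  simp [pos, Finset.sum_range_succ, add_assoc]

theorem pos_of_digits_zero {i : ℕ} {x : Code} (h : ∀ l < i, x.1 l = 0) : S.pos i x = x.2 := by
  rw [pos, Finset.sum_eq_zero, add_zero]
  intro l hl
  rw [h l (Finset.mem_range.1 hl), S.P_zero]

theorem col_mono : Monotone S.col := monotone_nat_of_le_succ fun _ => subset_union_left

theorem abs_pos_le {i : ℕ} {x : Code} (hx : x ∈ S.col i) : |S.pos i x| ≤ S.m i := by
  induction i with
  | zero => simp [pos, show x.2 = 0 from hx, S.m_zero]
  | succ i ih =>
    rcases hx with hx | ⟨h1, h2, -⟩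
    · rw [pos_succ]
      exact S.abs_add_P_le (ih hx) _
    · rwa [S.pos_of_digits_zero fun l hl => h1 l (Nat.lt_succ_iff.1 hl)]

/-- Spacer codes are by definition off every copy of the lower tower, so the position alone reveals
whether a point was already there, and in which copy. -/
theorem col_down {i : ℕ} {x : Code} (hx : x ∈ S.col (i + 1)) {f : ℤ} {a : Fin 4}
    (hf : |f| ≤ S.m i) (h : S.pos (i + 1) x = f + S.P i a) :
    x ∈ S.col i ∧ S.pos i x = f ∧ x.1 i = a := by
  rcases hx with hx | ⟨h1, h2, h3⟩
  · rw [pos_succ] at h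
    exact ⟨hx, S.eq_of_add_eq (S.abs_pos_le hx) hf h⟩
  · rw [S.pos_of_digits_zero fun l hl => h1 l (Nat.lt_succ_iff.1 hl)] at h
    exact absurd h (h3 f a hf)

theorem pos_congr {i : ℕ} {x y : Code} (h : ∀ l < i, x.1 l = y.1 l) (ht : x.2 = y.2) :
    S.pos i x = S.pos i y := by
  rw [pos, pos, ht, Finset.sum_congr rfl fun l hl => by rw [h l (Finset.mem_range.1 hl)]]

theorem col_congr {i : ℕ} {x y : Code} (h : ∀ l < i, x.1 l = y.1 l) (ht : x.2 = y.2)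
    (hx : x ∈ S.col i) : y ∈ S.col i := by
  induction i with
  | zero => exact ht.symm.trans hx
  | succ i ih =>
    rcases hx with hx | ⟨h1, h2, h3⟩
    · exact Or.inl (ih (fun l hl => h l (by omega)) hx)
    · refine Or.inr ⟨fun l hl => ?_, ht ▸ h2, ht ▸ h3⟩
      rw [← h l (by omega), h1 l hl]

theorem exists_mem_col {i : ℕ} {g : ℤ} (hg : |g| ≤ S.m i) :
    ∃ x ∈ S.col i, S.pos i x = g := by
  induction i generalizing g with
  | zero =>
    refine ⟨(fun _ => 0, 0), rfl, ?_⟩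
    rw [S.m_zero] at hg
    simp [pos, abs_nonpos_iff.1 hg]
  | succ i ih =>
    by_cases h : ∃ f a, |f| ≤ S.m i ∧ g = f + S.P i a
    · obtain ⟨f, a, hf, rfl⟩ := h
      obtain ⟨x, hx, hxf⟩ := ih hf
      have h1 : ∀ l < i, x.1 l = (Function.update x.1 i a) l := fun l hl =>
        (Function.update_of_ne hl.ne _ _).symm
      refine ⟨(Function.update x.1 i a, x.2), Or.inl (S.col_congr (x := x) h1 rfl hx), ?_⟩
      rw [pos_succ, ← S.pos_congr (x := x) (y := (Function.update x.1 i a, x.2)) h1 rfl, hxf]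
      simp
    · push Not at h
      exact ⟨(fun _ => 0, g), Or.inr ⟨fun _ _ => rfl, hg, h⟩,
        S.pos_of_digits_zero fun _ _ => rfl⟩

/-- Codes are canonical because a spacer added at a stage carries zero digits below it. Levels are
therefore cylinder sets. -/
theorem code_eq_of_pos_eq {i : ℕ} {x y : Code} (hx : x ∈ S.col i) (hy : y ∈ S.col i)
    (h : S.pos i x = S.pos i y) : (∀ l < i, x.1 l = y.1 l) ∧ x.2 = y.2 := by
  induction i with
  | zero => exact ⟨by simp, hx.trans hy.symm⟩
  | succ i ih =>
    by_cases hxi : x ∈ S.col i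
    · obtain ⟨h1, h2, h3⟩ := S.col_down hy (S.abs_pos_le hxi) (h.symm.trans (S.pos_succ i x))
      obtain ⟨h4, h5⟩ := ih hxi h1 h2.symm
      refine ⟨fun l hl => ?_, h5⟩
      rcases Nat.lt_succ_iff_lt_or_eq.1 hl with hl | rfl
      · exact h4 l hl
      · exact h3.symm
    · by_cases hyi : y ∈ S.col i
      · exact absurd (S.col_down hx (S.abs_pos_le hyi) (h.trans (S.pos_succ i y))).1 hxi
      · rcases hx with hx | ⟨hx, -⟩
        · exact absurd hx hxi
        rcases hy with hy | ⟨hy, -⟩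
        · exact absurd hy hyi
        refine ⟨fun l hl => by rw [hx l (by omega), hy l (by omega)], ?_⟩
        rwa [S.pos_of_digits_zero fun l hl => hx l (Nat.lt_succ_iff.1 hl),
          S.pos_of_digits_zero fun l hl => hy l (Nat.lt_succ_iff.1 hl)] at h

/-- The phase space of the construction. -/
def Space : Set Code := ⋃ i, S.col i

/-- The `g`-th level of the `i`-th tower. -/
def level (i : ℕ) (g : ℤ) : Set S.Space := {x | x.1 ∈ S.col i ∧ S.pos i x.1 = g}

theorem eventually_mem_col (x : S.Space) : ∃ i₀, ∀ i ≥ i₀, x.1 ∈ S.col i := by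
  obtain ⟨i, hi⟩ := mem_iUnion.1 x.2
  exact ⟨i, fun j hj => S.col_mono hj hi⟩

/-- The `+ 1` in `m_succ` leaves at least one spacer level at both ends of each new tower, so every
point moves arbitrarily far away from the ends. Translations are thereby defined everywhere, without
an exceptional null set. -/
theorem eventually_abs_le (x : S.Space) (k : ℤ) :
    ∃ i₀, ∀ i ≥ i₀, x.1 ∈ S.col i ∧ |S.pos i x.1| + |k| ≤ S.m i := by
  obtain ⟨i₀, h0⟩ := S.eventually_mem_col x
  have key : ∀ n : ℕ, |S.pos (i₀ + n) x.1| + n ≤ S.m (i₀ + n) := by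
    intro n
    induction n with
    | zero => simpa using S.abs_pos_le (h0 i₀ le_rfl)
    | succ n ih =>
      rw [← add_assoc, pos_succ]
      have h1 := abs_add_le (S.pos (i₀ + n) x.1) (S.P (i₀ + n) (x.1.1 (i₀ + n)))
      rw [abs_of_nonneg (S.P_nonneg _ _)] at h1
      have := S.m_succ (i₀ + n) (x.1.1 (i₀ + n))
      push_cast
      linarith
  refine ⟨i₀ + k.natAbs, fun i hi => ⟨h0 i (by omega), ?_⟩⟩
  obtain ⟨n, rfl⟩ : ∃ n, i = i₀ + n := ⟨i - i₀, by omega⟩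
  have := key n
  have h2 : |k| ≤ n := by rw [Int.abs_eq_natAbs]; omega
  linarith

theorem eq_of_pos_eq {x y : S.Space} {i₀ : ℕ} (h : ∀ i ≥ i₀, S.pos i x.1 = S.pos i y.1) :
    x = y := by
  obtain ⟨i₁, h1⟩ := S.eventually_mem_col x
  obtain ⟨i₂, h2⟩ := S.eventually_mem_col y
  have key : ∀ n, ∀ l < i₀ + i₁ + i₂ + n, x.1.1 l = y.1.1 l := fun n =>
    (S.code_eq_of_pos_eq (h1 _ (by omega)) (h2 _ (by omega)) (h _ (by omega))).1
  refine Subtype.ext (Prod.ext (funext fun l => key (l + 1) l (by omega)) ?_)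
  exact (S.code_eq_of_pos_eq (h1 (i₀ + i₁ + i₂) (by omega)) (h2 _ (by omega)) (h _ (by omega))).2

/-- If the positions of `y` and `x` differ by `k` in high towers, then also in each tower
in which this makes sense. -/
theorem pos_add_of_pos_add {x y : Code} {k : ℤ} {i j : ℕ} (hij : i ≤ j)
    (hk : |S.pos i x + k| ≤ S.m i) (hy : y ∈ S.col j) (h : S.pos j y = S.pos j x + k) :
    y ∈ S.col i ∧ S.pos i y = S.pos i x + k := by
  induction j, hij using Nat.le_induction generalizing k with
  | base => exact ⟨hy, h⟩
  | succ j hij ih =>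
    have hkj : ∀ l, i ≤ l → |S.pos l x + k| ≤ S.m l := by
      intro l hl
      induction l, hl using Nat.le_induction with
      | base => exact hk
      | succ l hl ih =>
        have := S.abs_add_P_le ih (x.1 l)
        rw [pos_succ]
        convert this using 2
        ring
    obtain ⟨h1, h2, -⟩ := S.col_down (a := x.1 j) hy (hkj j hij) (by rw [h, pos_succ]; ring)
    exact ih hk h1 h2

/-- In a tower high enough to contain the shifted position, the first digits and the initial
position are replaced by those of the shifted level, and the later digits are kept. The difference
of positions then stays `k` in all higher towers. -/
theorem exists_translate (k : ℤ) (x : S.Space) : ∃ y : S.Space, ∀ i, x.1 ∈ S.col i →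
    |S.pos i x.1 + k| ≤ S.m i → y.1 ∈ S.col i ∧ S.pos i y.1 = S.pos i x.1 + k := by
  obtain ⟨i₀, h0⟩ := S.eventually_abs_le x k
  obtain ⟨hx0, hk0⟩ := h0 i₀ le_rfl
  obtain ⟨z, hz, hzk⟩ := S.exists_mem_col ((abs_add_le _ _).trans hk0)
  let y : Code := (fun l => if l < i₀ then z.1 l else x.1.1 l, z.2)
  have hy0 : y ∈ S.col i₀ := S.col_congr (x := z) (fun l hl => (if_pos hl).symm) rfl hz
  have hyp : ∀ i ≥ i₀, S.pos i y = S.pos i x.1 + k := by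
    intro i hi
    induction i, hi using Nat.le_induction with
    | base => rw [← hzk]; exact S.pos_congr (fun l hl => if_pos hl) rfl
    | succ i hi ih =>
      rw [pos_succ, pos_succ, ih, show y.1 i = x.1.1 i from if_neg (by omega)]
      ring
  refine ⟨⟨y, mem_iUnion.2 ⟨i₀, hy0⟩⟩, fun i hi hki => ?_⟩
  rcases le_total i₀ i with h | h
  · exact ⟨S.col_mono h hy0, hyp i h⟩
  · exact S.pos_add_of_pos_add h hki hy0 (hyp _ le_rfl)

/-- The translation by `k` along the towers. -/
noncomputable def translate (k : ℤ) (x : S.Space) : S.Space := (S.exists_translate k x).choose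

theorem translate_mem {k : ℤ} {x : S.Space} {i : ℕ} (hx : x.1 ∈ S.col i)
    (hk : |S.pos i x.1 + k| ≤ S.m i) :
    (S.translate k x).1 ∈ S.col i ∧ S.pos i (S.translate k x).1 = S.pos i x.1 + k :=
  (S.exists_translate k x).choose_spec i hx hk

theorem eventually_translate (k : ℤ) (x : S.Space) : ∃ i₀, ∀ i ≥ i₀, x.1 ∈ S.col i ∧
    (S.translate k x).1 ∈ S.col i ∧ S.pos i (S.translate k x).1 = S.pos i x.1 + k := by
  obtain ⟨i₀, h0⟩ := S.eventually_abs_le x k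
  exact ⟨i₀, fun i hi => ⟨(h0 i hi).1,
    S.translate_mem (h0 i hi).1 ((abs_add_le _ _).trans (h0 i hi).2)⟩⟩

theorem translate_add (k l : ℤ) (x : S.Space) :
    S.translate (k + l) x = S.translate k (S.translate l x) := by
  obtain ⟨i₀, h0⟩ := S.eventually_translate l x
  obtain ⟨i₁, h1⟩ := S.eventually_translate k (S.translate l x)
  obtain ⟨i₂, h2⟩ := S.eventually_translate (k + l) x
  refine S.eq_of_pos_eq (i₀ := i₀ + i₁ + i₂) fun i hi => ?_
  rw [(h2 i (by omega)).2.2, (h1 i (by omega)).2.2, (h0 i (by omega)).2.2]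
  ring

theorem translate_zero (x : S.Space) : S.translate 0 x = x := by
  obtain ⟨i₀, h0⟩ := S.eventually_translate 0 x
  exact S.eq_of_pos_eq (i₀ := i₀) fun i hi => by rw [(h0 i hi).2.2, add_zero]

/-- The translations as permutations of the phase space. -/
noncomputable def translateHom : Multiplicative ℤ →* Equiv.Perm S.Space where
  toFun k :=
    { toFun := S.translate k.toAdd
      invFun := S.translate (-k.toAdd)
      left_inv := fun x => by rw [← translate_add, neg_add_cancel, translate_zero]
      right_inv := fun x => by rw [← translate_add, add_neg_cancel, translate_zero] }
  map_one' := Equiv.ext S.translate_zero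
  map_mul' k l := Equiv.ext fun x => S.translate_add k.toAdd l.toAdd x

theorem translateHom_zpow (k : ℤ) (x : S.Space) :
    ((S.translateHom (Multiplicative.ofAdd 1)) ^ k : Equiv.Perm S.Space) x = S.translate k x := by
  rw [← map_zpow, ← ofAdd_zsmul]
  simp [translateHom]

/-! ### Levels -/

theorem level_eq_empty {i : ℕ} {g : ℤ} (hg : ¬ |g| ≤ S.m i) : S.level i g = ∅ :=
  eq_empty_of_forall_notMem fun _ hx => hg (hx.2 ▸ S.abs_pos_le hx.1)

theorem level_disjoint (i : ℕ) {g g' : ℤ} (h : g ≠ g') :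
    Disjoint (S.level i g) (S.level i g') :=
  Set.disjoint_left.2 fun _ hx hy => h (hx.2.symm.trans hy.2)

theorem preimage_translate_level {i : ℕ} {g k : ℤ} (hg : |g| ≤ S.m i) (hk : |g - k| ≤ S.m i) :
    S.translate k ⁻¹' S.level i g = S.level i (g - k) := by
  ext x
  constructor
  · intro hx
    have h1 := S.translate_mem (k := -k) (x := S.translate k x) hx.1
      (by rwa [hx.2, ← sub_eq_add_neg])
    rw [← translate_add, neg_add_cancel, translate_zero] at h1
    exact ⟨h1.1, by rw [h1.2, hx.2]; ring⟩
  · rintro ⟨h1, h2⟩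
    have h3 := S.translate_mem (k := k) h1 (by rwa [h2, sub_add_cancel])
    exact ⟨h3.1, by rw [h3.2, h2]; ring⟩

theorem level_eq_iUnion {i : ℕ} {g : ℤ} (hg : |g| ≤ S.m i) :
    S.level i g = ⋃ a, S.level (i + 1) (g + S.P i a) := by
  ext x
  simp only [mem_iUnion]
  constructor
  · rintro ⟨h1, h2⟩
    exact ⟨x.1.1 i, S.col_mono i.le_succ h1, by rw [pos_succ, h2]⟩
  · rintro ⟨a, h1, h2⟩
    exact ⟨(S.col_down h1 hg h2).1, (S.col_down h1 hg h2).2.1⟩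

theorem sublevel_disjoint {i : ℕ} (g : ℤ) {a b : Fin 4} (h : a ≠ b) :
    Disjoint (S.level (i + 1) (g + S.P i a)) (S.level (i + 1) (g + S.P i b)) := by
  refine S.level_disjoint _ fun hab => ?_
  have h1 := S.sep i a b h
  rw [add_left_cancel hab, sub_self, abs_zero] at h1
  linarith [S.m_nonneg i]

theorem measurable_pos (i : ℕ) : Measurable (S.pos i) := by
  unfold pos
  have : ∀ l, Measurable fun x : Code => S.P l (x.1 l) := fun l =>
    (measurable_of_countable (S.P l)).comp ((measurable_pi_apply l).comp measurable_fst)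
  fun_prop

theorem measurableSet_col (i : ℕ) : MeasurableSet (S.col i) := by
  induction i with
  | zero => exact measurable_snd (measurableSet_singleton 0)
  | succ i ih =>
    refine ih.union (MeasurableSet.inter ?_ ?_)
    · have h : {x : Code | ∀ l ≤ i, x.1 l = 0} = ⋂ l, ⋂ (_ : l ≤ i), {x | x.1 l = 0} := by
        ext x; simp
      change MeasurableSet {x : Code | ∀ l ≤ i, x.1 l = 0}
      rw [h]
      exact MeasurableSet.iInter fun l => MeasurableSet.iInter fun _ =>
        ((measurable_pi_apply l).comp measurable_fst) (measurableSet_singleton 0)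
    · exact measurable_snd (MeasurableSet.of_discrete
        (s := {t : ℤ | |t| ≤ S.m (i + 1) ∧ ∀ f a, |f| ≤ S.m i → t ≠ f + S.P i a}))

theorem measurableSet_space : MeasurableSet S.Space :=
  MeasurableSet.iUnion S.measurableSet_col

theorem measurableSet_level (i : ℕ) (g : ℤ) : MeasurableSet (S.level i g) :=
  measurable_subtype_coe ((S.measurableSet_col i).inter
    (S.measurable_pos i (measurableSet_singleton g)))

instance : StandardBorelSpace S.Space := S.measurableSet_space.standardBorel

end StackData

/-! ### The levels as generators of the Borel sets -/

namespace StackData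

variable (S : StackData)

/-- The family of all levels of all towers. -/
def levels : Set (Set S.Space) := range fun p : ℕ × ℤ => S.level p.1 p.2

theorem level_mem_levels (i : ℕ) (g : ℤ) : S.level i g ∈ S.levels := ⟨(i, g), rfl⟩

theorem countable_levels : S.levels.Countable := countable_range _

/-- The countably many levels separate points, and in a standard Borel space a countable separating
family of Borel sets generates the whole σ-algebra. -/
theorem measurableSpace_eq_generateFrom :
    (inferInstance : MeasurableSpace S.Space) = MeasurableSpace.generateFrom S.levels := by
  have hle : MeasurableSpace.generateFrom S.levels ≤ (inferInstance : MeasurableSpace S.Space) :=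
    MeasurableSpace.generateFrom_le fun s ⟨p, hp⟩ => hp ▸ S.measurableSet_level p.1 p.2
  have hsep : @MeasurableSpace.CountablySeparated S.Space
      (MeasurableSpace.generateFrom S.levels) := by
    refine @MeasurableSpace.CountablySeparated.mk _ (_) ⟨S.levels, S.countable_levels,
      fun s hs => MeasurableSpace.measurableSet_generateFrom hs, fun x _ y _ h => ?_⟩
    obtain ⟨i₀, h0⟩ := S.eventually_mem_col x
    exact S.eq_of_pos_eq (i₀ := i₀) fun i hi =>
      (((h _ (S.level_mem_levels i (S.pos i x.1))).1 ⟨h0 i hi, rfl⟩).2).symm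
  ext s
  exact @Measurable.measurableSet_preimage_iff_of_surjective S.Space S.Space _ _
    (MeasurableSpace.generateFrom S.levels) hsep id (measurable_id'' hle) Function.surjective_id s

theorem level_subset {i j : ℕ} (hij : i ≤ j) {g h : ℤ} {x : S.Space} (hx : x ∈ S.level i g)
    (hx' : x ∈ S.level j h) : S.level j h ⊆ S.level i g := by
  intro y hy
  have := S.pos_add_of_pos_add (k := 0) hij (by simpa using S.abs_pos_le hx.1) hy.1
    (by rw [hy.2, hx'.2, add_zero])
  exact ⟨this.1, by rw [this.2, hx.2, add_zero]⟩

theorem isPiSystem_levels : IsPiSystem S.levels := by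
  rintro _ ⟨⟨i, g⟩, rfl⟩ _ ⟨⟨j, h⟩, rfl⟩ ⟨x, hx, hx'⟩
  rcases le_total i j with hij | hij
  · dsimp only at hx hx' ⊢
    rw [inter_eq_right.2 (S.level_subset hij hx hx')]
    exact S.level_mem_levels _ _
  · dsimp only at hx hx' ⊢
    rw [inter_eq_left.2 (S.level_subset hij hx' hx)]
    exact S.level_mem_levels _ _

theorem sUnion_levels : ⋃₀ S.levels = univ := by
  refine eq_univ_of_forall fun x => ?_
  obtain ⟨i₀, h0⟩ := S.eventually_mem_col x
  exact mem_sUnion.2 ⟨_, S.level_mem_levels i₀ (S.pos i₀ x.1), h0 _ le_rfl, rfl⟩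

/-! ### The invariant measure -/

/-- The product of the uniform measures on the digits and the counting measure on positions. -/
noncomputable def codeMeasure : Measure Code :=
  (Measure.infinitePi fun _ : ℕ => (PMF.uniformOfFintype (Fin 4)).toMeasure).prod Measure.count

/-- The measure of the construction. -/
noncomputable def measure : Measure S.Space := codeMeasure.comap Subtype.val

theorem measure_level {i : ℕ} {g : ℤ} (hg : |g| ≤ S.m i) :
    S.measure (S.level i g) = (4⁻¹ : ℝ≥0∞) ^ i := by
  obtain ⟨y, hy, hyg⟩ := S.exists_mem_col hg
  have himg : Subtype.val '' S.level i g
      = (Set.pi (Finset.range i) fun l => {y.1 l}) ×ˢ ({y.2} : Set ℤ) := by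
    ext x
    simp only [Set.mem_image, mem_prod, Set.mem_pi, mem_singleton_iff, Finset.coe_range, mem_Iio]
    constructor
    · rintro ⟨x, hx, rfl⟩
      exact S.code_eq_of_pos_eq hx.1 hy (hx.2.trans hyg.symm)
    · rintro ⟨h1, h2⟩
      have hx : x ∈ S.col i := S.col_congr (fun l hl => (h1 l hl).symm) h2.symm hy
      exact ⟨⟨x, mem_iUnion.2 ⟨i, hx⟩⟩, ⟨hx, (S.pos_congr h1 h2).trans hyg⟩, rfl⟩
  rw [measure, (MeasurableEmbedding.subtype_coe S.measurableSet_space).comap_apply, himg,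
    codeMeasure, Measure.prod_prod, Measure.infinitePi_pi _ fun _ _ => measurableSet_singleton _,
    Measure.count_singleton, mul_one]
  simp

theorem measure_level_ne_top (i : ℕ) (g : ℤ) : S.measure (S.level i g) ≠ ∞ := by
  by_cases hg : |g| ≤ S.m i
  · rw [S.measure_level hg]
    exact ENNReal.pow_ne_top (by simp)
  · simp [S.level_eq_empty hg]

theorem measure_levels_ne_top {s : Set S.Space} (hs : s ∈ S.levels) : S.measure s ≠ ∞ := by
  obtain ⟨p, rfl⟩ := hs
  exact S.measure_level_ne_top _ _

instance : SigmaFinite S.measure := by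
  exact Measure.sigmaFinite_of_countable S.countable_levels
    (fun s hs => (S.measure_levels_ne_top hs).lt_top) S.sUnion_levels

instance : NullSingletonClass S.measure := by
  refine ⟨fun x => ?_⟩
  obtain ⟨i₀, h0⟩ := S.eventually_mem_col x
  have hle : ∀ i ≥ i₀, S.measure {x} ≤ (4⁻¹ : ℝ≥0∞) ^ i := fun i hi => by
    rw [← S.measure_level (S.abs_pos_le (h0 i hi))]
    exact measure_mono (singleton_subset_iff.2 ⟨h0 i hi, rfl⟩)
  have hlim := ENNReal.tendsto_pow_atTop_nhds_zero_of_lt_one (r := 4⁻¹)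
    (by rw [ENNReal.inv_lt_one]; norm_num)
  exact le_antisymm (ge_of_tendsto hlim (Filter.eventually_atTop.2 ⟨i₀, hle⟩)) zero_le

/-- Here `n` bounds how far the shifted level may stick out of the tower. Passing to the four
sublevels lowers this excess by one, by the spacer margin in `m_succ`; without excess the preimage
is a level of the same tower. -/
theorem preimage_translate_level_aux (k : ℤ) (n : ℕ) : ∀ {i : ℕ} {g : ℤ}, |g| ≤ S.m i →
    |g| + |k| ≤ S.m i + n → MeasurableSet (S.translate k ⁻¹' S.level i g) ∧
      S.measure (S.translate k ⁻¹' S.level i g) = S.measure (S.level i g) := by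
  induction n with
  | zero =>
    intro i g hg hk
    have h : |g - k| ≤ S.m i := (abs_sub g k).trans (by simpa using hk)
    rw [S.preimage_translate_level hg h, S.measure_level hg, S.measure_level h]
    exact ⟨S.measurableSet_level _ _, rfl⟩
  | succ n ih =>
    intro i g hg hk
    have key : ∀ a, |g + S.P i a| + |k| ≤ S.m (i + 1) + n := fun a => by
      have h1 := abs_add_le g (S.P i a)
      rw [abs_of_nonneg (S.P_nonneg i a)] at h1
      have := S.m_succ i a
      push_cast at hk
      linarith
    have h2 := fun a => ih (S.abs_add_P_le hg a) (key a)
    have hd : Pairwise (Function.onFun Disjoint fun a => S.level (i + 1) (g + S.P i a)) :=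
      fun a b hab => S.sublevel_disjoint g hab
    rw [S.level_eq_iUnion hg, preimage_iUnion]
    refine ⟨MeasurableSet.iUnion fun a => (h2 a).1, ?_⟩
    rw [measure_iUnion (fun a b hab => (hd hab).preimage _) fun a => (h2 a).1,
      measure_iUnion hd fun a => S.measurableSet_level _ _]
    exact tsum_congr fun a => (h2 a).2

theorem preimage_translate_level_spec (k : ℤ) (i : ℕ) (g : ℤ) :
    MeasurableSet (S.translate k ⁻¹' S.level i g) ∧
      S.measure (S.translate k ⁻¹' S.level i g) = S.measure (S.level i g) := by
  by_cases hg : |g| ≤ S.m i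
  · refine S.preimage_translate_level_aux k k.natAbs hg ?_
    rw [Int.abs_eq_natAbs k]
    linarith
  · simp [S.level_eq_empty hg]

theorem measurePreserving_translate (k : ℤ) :
    MeasurePreserving (S.translate k) S.measure S.measure := by
  have hm : Measurable (S.translate k) := by
    have h : @Measurable _ _ _ (MeasurableSpace.generateFrom S.levels) (S.translate k) := by
      refine measurable_generateFrom ?_
      rintro _ ⟨p, rfl⟩
      exact (S.preimage_translate_level_spec k _ _).1
    rwa [← S.measurableSpace_eq_generateFrom] at h
  have hmap : ∀ s ∈ S.levels, S.measure.map (S.translate k) s = S.measure s := by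
    rintro _ ⟨p, rfl⟩
    rw [Measure.map_apply hm (S.measurableSet_level _ _)]
    exact (S.preimage_translate_level_spec k _ _).2
  refine ⟨hm, Measure.ext_of_generateFrom_of_cover_subset S.measurableSpace_eq_generateFrom
    S.isPiSystem_levels Subset.rfl S.countable_levels S.sUnion_levels (fun s hs => ?_) hmap⟩
  rw [hmap s hs]
  exact S.measure_levels_ne_top hs

/-- The transformation of the construction. -/
noncomputable def aut : MeasureAut S.measure where
  toEquiv :=
    { toEquiv := S.translateHom (Multiplicative.ofAdd 1)
      measurable_toFun := (S.measurePreserving_translate 1).measurable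
      measurable_invFun := (S.measurePreserving_translate (-1)).measurable }
  preserves := S.measurePreserving_translate 1

theorem aut_zpow_apply (k : ℤ) (x : S.Space) : (S.aut.zpow k).toEquiv x = S.translate k x :=
  S.translateHom_zpow k x

theorem aut_iterate_apply (n : ℕ) (x : S.Space) : (S.aut.toEquiv)^[n] x = S.translate n x := by
  induction n with
  | zero => simp [S.translate_zero]
  | succ n ih =>
    rw [Function.iterate_succ_apply', ih, Nat.cast_succ, add_comm, S.translate_add]
    rfl

theorem image_aut_iterate_level {i : ℕ} {g : ℤ} {n : ℕ} (hg : |g| ≤ S.m i)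
    (hn : |g + n| ≤ S.m i) : (S.aut.toEquiv)^[n] '' S.level i g = S.level i (g + n) := by
  ext y
  constructor
  · rintro ⟨x, hx, rfl⟩
    rw [aut_iterate_apply]
    have := S.translate_mem (k := n) hx.1 (by rwa [hx.2])
    exact ⟨this.1, by rw [this.2, hx.2]⟩
  · rintro hy
    refine ⟨S.translate (-n) y, ?_, ?_⟩
    · have := S.translate_mem (k := -n) hy.1 (by rw [hy.2]; simpa using hg)
      exact ⟨this.1, by rw [this.2, hy.2]; ring⟩
    · rw [aut_iterate_apply, ← S.translate_add]
      simp [S.translate_zero]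

/-! ### Rank one -/

/-- The union of the levels of the `i`-th tower with positions in `G`. -/
def levelSet (i : ℕ) (G : Set ℤ) : Set S.Space := {x | x.1 ∈ S.col i ∧ S.pos i x.1 ∈ G}

theorem measurableSet_levelSet (i : ℕ) (G : Set ℤ) : MeasurableSet (S.levelSet i G) :=
  measurable_subtype_coe ((S.measurableSet_col i).inter
    (S.measurable_pos i (MeasurableSet.of_discrete (s := G))))

theorem levelSet_eq_biUnion (i : ℕ) (G : Set ℤ) :
    S.levelSet i G = ⋃ g ∈ {g | g ∈ G ∧ |g| ≤ S.m i}, S.level i g := by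
  ext x
  simp only [levelSet, level, mem_iUnion, mem_ofPred_eq, exists_prop]
  constructor
  · rintro ⟨h1, h2⟩
    exact ⟨_, ⟨h2, S.abs_pos_le h1⟩, h1, rfl⟩
  · rintro ⟨g, ⟨h1, h2⟩, h3, rfl⟩
    exact ⟨h3, h1⟩

theorem measure_levelSet_ne_top (i : ℕ) (G : Set ℤ) : S.measure (S.levelSet i G) ≠ ∞ := by
  have hfin : {g | g ∈ G ∧ |g| ≤ S.m i}.Finite :=
    (finite_Icc (-S.m i) (S.m i)).subset fun g hg => abs_le.1 hg.2
  rw [levelSet_eq_biUnion]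
  exact (measure_biUnion_lt_top hfin fun g _ => (S.measure_level_ne_top i g).lt_top).ne

theorem levelSet_succ (i : ℕ) (G : Set ℤ) : S.levelSet i G
    = S.levelSet (i + 1) {h | ∃ f a, f ∈ G ∧ |f| ≤ S.m i ∧ h = f + S.P i a} := by
  ext x
  constructor
  · rintro ⟨h1, h2⟩
    exact ⟨S.col_mono i.le_succ h1, _, _, h2, S.abs_pos_le h1, S.pos_succ i x.1⟩
  · rintro ⟨h1, f, a, hf, hfm, h⟩
    obtain ⟨h2, h3, -⟩ := S.col_down h1 hfm h
    exact ⟨h2, h3.symm ▸ hf⟩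

theorem exists_levelSet_eq {i j : ℕ} (hij : i ≤ j) (G : Set ℤ) :
    ∃ G', S.levelSet i G = S.levelSet j G' := by
  induction j, hij using Nat.le_induction with
  | base => exact ⟨G, rfl⟩
  | succ j _ ih =>
    obtain ⟨G', h⟩ := ih
    exact ⟨_, h.trans (S.levelSet_succ j G')⟩

/-- The sets that are unions of levels of one tower, or complements of such sets. -/
def levelAlgebra : Set (Set S.Space) :=
  {s | ∃ i G, s = S.levelSet i G ∨ s = (S.levelSet i G)ᶜ}

theorem isSetAlgebra_levelAlgebra : IsSetAlgebra S.levelAlgebra where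
  empty_mem := ⟨0, ∅, Or.inl (by ext; simp [levelSet])⟩
  compl_mem := by
    rintro s ⟨i, G, rfl | rfl⟩
    · exact ⟨i, G, Or.inr rfl⟩
    · exact ⟨i, G, Or.inl (compl_compl _)⟩
  union_mem := by
    rintro s t ⟨i, G, hs⟩ ⟨j, G', ht⟩
    obtain ⟨A, hA⟩ := S.exists_levelSet_eq (le_max_left i j) G
    obtain ⟨B, hB⟩ := S.exists_levelSet_eq (le_max_right i j) G'
    rw [hA] at hs
    rw [hB] at ht
    generalize max i j = n at *
    rcases hs with rfl | rfl <;> rcases ht with rfl | rfl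
    · exact ⟨n, A ∪ B, Or.inl (by ext; simp [levelSet]; tauto)⟩
    · exact ⟨n, B \ A, Or.inr (by ext; simp [levelSet]; tauto)⟩
    · exact ⟨n, A \ B, Or.inr (by ext; simp [levelSet]; tauto)⟩
    · exact ⟨n, A ∩ B, Or.inr (by ext; simp [levelSet]; tauto)⟩

theorem measureDense_levelAlgebra : S.measure.MeasureDense S.levelAlgebra := by
  have hsub : S.levels ⊆ S.levelAlgebra := by
    rintro _ ⟨p, rfl⟩
    exact ⟨p.1, {p.2}, Or.inl rfl⟩
  refine Measure.MeasureDense.of_generateFrom_isSetAlgebra_sigmaFinite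
    S.isSetAlgebra_levelAlgebra
    { set := fun n => S.levelSet n univ
      set_mem := fun n => ⟨n, univ, Or.inl rfl⟩
      finite := fun n => (S.measure_levelSet_ne_top n univ).lt_top
      spanning := eq_univ_of_forall fun x => ?_ } (le_antisymm ?_ ?_)
  · obtain ⟨i₀, h0⟩ := S.eventually_mem_col x
    exact mem_iUnion.2 ⟨i₀, h0 i₀ le_rfl, trivial⟩
  · exact S.measurableSpace_eq_generateFrom.le.trans (MeasurableSpace.generateFrom_mono hsub)
  · refine MeasurableSpace.generateFrom_le ?_
    rintro _ ⟨i, G, rfl | rfl⟩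
    · exact S.measurableSet_levelSet i G
    · exact (S.measurableSet_levelSet i G).compl

theorem aut_isRankOne (htop : S.measure univ = ∞) : S.aut.IsRankOne := by
  have hlev : ∀ j n, n ≤ (2 * S.m j).toNat →
      (S.aut.toEquiv)^[n] '' S.level j (-S.m j) = S.level j (-S.m j + n) := by
    intro j n hn
    have := S.m_nonneg j
    refine S.image_aut_iterate_level ?_ ?_
    · rw [abs_neg, abs_of_nonneg this]
    · rw [abs_le]; constructor <;> omega
  refine ⟨fun j => S.level j (-S.m j), fun j => (2 * S.m j).toNat,
    fun j => ⟨S.measurableSet_level _ _, S.measure_level_ne_top _ _⟩, ?_, ?_⟩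
  · intro j i i' hi hi' hne
    dsimp only at hi hi' ⊢
    rw [hlev j i hi, hlev j i' hi']
    exact S.level_disjoint j (by omega)
  · intro A hA hAfin ε hε
    obtain ⟨δ, hδ, hδε⟩ : ∃ δ : ℝ, 0 < δ ∧ ENNReal.ofReal δ ≤ ε := by
      refine ⟨(min ε 1).toReal, ENNReal.toReal_pos (by simp [hε.ne']) (by simp), ?_⟩
      rw [ENNReal.ofReal_toReal (by simp)]
      exact min_le_left _ _
    obtain ⟨t, ⟨i₀, G, ht⟩, htfin, hlt⟩ :=
      S.measureDense_levelAlgebra.fin_meas_approx hA hAfin δ hδ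
    -- The other elements of the algebra are complements of sets of finite measure, hence have
    -- infinite measure.
    have ht : t = S.levelSet i₀ G := by
      refine ht.resolve_right fun h => ?_
      have := measure_union_lt_top htfin.lt_top (S.measure_levelSet_ne_top i₀ G).lt_top
      rw [h, compl_union_self, htop] at this
      exact lt_irrefl _ this
    refine ⟨i₀, fun j hj => ?_⟩
    obtain ⟨G', hG'⟩ := S.exists_levelSet_eq hj G
    classical
    refine ⟨(Finset.range ((2 * S.m j).toNat + 1)).filter fun n => -S.m j + n ∈ G',
      fun i hi => ?_, ?_⟩
    · exact Nat.lt_succ_iff.1 (Finset.mem_range.1 (Finset.mem_filter.1 hi).1)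
    · convert hlt.trans_le hδε using 3
      rw [ht, hG', S.levelSet_eq_biUnion]
      ext x
      simp only [Finset.mem_filter, Finset.mem_range, mem_iUnion, exists_prop, mem_ofPred_eq]
      constructor
      · rintro ⟨n, ⟨hn, hnG⟩, hx⟩
        rw [hlev j n (by omega)] at hx
        exact ⟨_, ⟨hnG, hx.2 ▸ S.abs_pos_le hx.1⟩, hx⟩
      · rintro ⟨g, ⟨hg, hgm⟩, hx⟩
        have hcast : -S.m j + ((g + S.m j).toNat : ℤ) = g := by
          have := abs_le.1 hgm
          omega
        have := abs_le.1 hgm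
        refine ⟨(g + S.m j).toNat, ⟨by omega, by rwa [hcast]⟩, ?_⟩
        rwa [hlev j _ (by omega), hcast]

/-- The heights grow at least eightfold per stage, while the measure of a level only drops by the
factor four. -/
theorem measure_univ_eq_top (hgrowth : ∀ i, 8 * S.m i ≤ S.m (i + 1)) :
    S.measure univ = ∞ := by
  have hm : ∀ i, (8 : ℤ) ^ i ≤ S.m (i + 1) := by
    intro i
    induction i with
    | zero => simpa using S.le_m 1
    | succ i ih => rw [pow_succ]; linarith [hgrowth (i + 1)]
  have hle : ∀ i : ℕ, ((2 : ℝ≥0∞) ^ i) * 4⁻¹ ≤ S.measure univ := by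
    intro i
    have h1 : S.measure (⋃ n ∈ Finset.range (8 ^ i), S.level (i + 1) (n : ℤ))
        = ∑ n ∈ Finset.range (8 ^ i), (4⁻¹ : ℝ≥0∞) ^ (i + 1) := by
      rw [measure_biUnion_finset]
      · refine Finset.sum_congr rfl fun n hn => S.measure_level ?_
        rw [abs_of_nonneg (by positivity)]
        have h2 := hm i
        have h3 : (n : ℤ) < 8 ^ i := by exact_mod_cast Finset.mem_range.1 hn
        linarith
      · intro a _ b _ hab
        exact S.level_disjoint _ (by exact_mod_cast hab)
      · intro n _
        exact S.measurableSet_level _ _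
    refine le_trans ?_ (measure_mono (subset_univ
      (⋃ n ∈ Finset.range (8 ^ i), S.level (i + 1) (n : ℤ))))
    rw [h1, Finset.sum_const, Finset.card_range, nsmul_eq_mul, pow_succ, ← mul_assoc]
    gcongr
    push_cast
    rw [show (8 : ℝ≥0∞) = 2 * 4 by norm_num, mul_pow, mul_assoc, ← mul_pow,
      ENNReal.mul_inv_cancel (by norm_num) (by norm_num), one_pow, mul_one]
  have hlim : Filter.Tendsto (fun i : ℕ => ((2 : ℝ≥0∞) ^ i) * 4⁻¹) Filter.atTop (nhds ∞) := by
    have := ENNReal.Tendsto.mul_const (b := 4⁻¹)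
      (ENNReal.tendsto_pow_atTop_nhds_top_iff.2 (by norm_num : (1 : ℝ≥0∞) < 2)) (by simp)
    rwa [ENNReal.top_mul (by simp)] at this
  exact top_le_iff.1 (le_of_tendsto' hlim hle)

end StackData

namespace MeasureAut

variable {Y : Type*} [MeasurableSpace Y] {ν : Measure Y}

/-! ### Powers of Koopman operators -/

theorem koopman_koopman {R S T : MeasureAut ν} (h : ∀ x, R.toEquiv x = S.toEquiv (T.toEquiv x))
    (f : Lp ℂ 2 ν) : T.koopman (S.koopman f) = R.koopman f := by
  refine Lp.ext ?_
  filter_upwards [T.coeFn_koopman (S.koopman f), R.coeFn_koopman f,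
    T.preserves.quasiMeasurePreserving.ae (S.coeFn_koopman f)] with x h1 h2 h3
  rw [h1, h2, Function.comp_apply, h3, Function.comp_apply, Function.comp_apply, h]

theorem koopman_eq_self {T : MeasureAut ν} (h : ∀ x, T.toEquiv x = x) (f : Lp ℂ 2 ν) :
    T.koopman f = f := by
  refine Lp.ext ?_
  filter_upwards [T.coeFn_koopman f] with x h1
  rw [h1, Function.comp_apply, h]

theorem koopman_congr {S T : MeasureAut ν} (h : ∀ x, S.toEquiv x = T.toEquiv x) :
    S.koopman = T.koopman := by
  refine LinearIsometryEquiv.ext fun f => Lp.ext ?_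
  filter_upwards [S.coeFn_koopman f, T.coeFn_koopman f] with x h1 h2
  rw [h1, h2, Function.comp_apply, Function.comp_apply, h]

theorem zpow_add_apply (T : MeasureAut ν) (k l : ℤ) (x : Y) :
    (T.zpow (k + l)).toEquiv x = (T.zpow k).toEquiv ((T.zpow l).toEquiv x) := by
  change (T.toEquiv.toEquiv ^ (k + l)) x = _
  rw [zpow_add]
  rfl

theorem zpow_zero_apply (T : MeasureAut ν) (x : Y) : (T.zpow 0).toEquiv x = x := rfl

theorem zpow_neg_apply_apply (T : MeasureAut ν) (k : ℤ) (x : Y) :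
    (T.zpow (-k)).toEquiv ((T.zpow k).toEquiv x) = x := by
  rw [← zpow_add_apply, neg_add_cancel, zpow_zero_apply]

theorem zpow_apply_neg_apply (T : MeasureAut ν) (k : ℤ) (x : Y) :
    (T.zpow k).toEquiv ((T.zpow (-k)).toEquiv x) = x := by
  rw [← zpow_add_apply, add_neg_cancel, zpow_zero_apply]

theorem zpow_one_apply (T : MeasureAut ν) (x : Y) : (T.zpow 1).toEquiv x = T.toEquiv x := by
  change (T.toEquiv.toEquiv ^ (1 : ℤ)) x = _
  rw [zpow_one]
  rfl

theorem koopman_zpow_add (T : MeasureAut ν) (k l : ℤ) :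
    (T.zpow (k + l)).koopman = (T.zpow k).koopman * (T.zpow l).koopman :=
  LinearIsometryEquiv.ext fun f =>
    (koopman_koopman (fun x => by rw [add_comm, zpow_add_apply]) f).symm

/-- The powers of an automorphism give a homomorphism to the unitary group. -/
noncomputable def koopmanHom (T : MeasureAut ν) :
    Multiplicative ℤ →* (Lp ℂ 2 ν ≃ₗᵢ[ℂ] Lp ℂ 2 ν) where
  toFun k := (T.zpow k.toAdd).koopman
  map_one' := LinearIsometryEquiv.ext fun f => koopman_eq_self T.zpow_zero_apply f
  map_mul' k l := T.koopman_zpow_add k.toAdd l.toAdd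

theorem koopman_zpow (T : MeasureAut ν) (k : ℤ) : T.koopman ^ k = (T.zpow k).koopman := by
  have h1 : T.koopman = T.koopmanHom (Multiplicative.ofAdd 1) :=
    koopman_congr fun x => (T.zpow_one_apply x).symm
  rw [h1, ← map_zpow, ← ofAdd_zsmul]
  simp [koopmanHom]

theorem image_zpow_eq_preimage (T : MeasureAut ν) (k : ℤ) (s : Set Y) :
    (T.zpow k).toEquiv '' s = (T.zpow (-k)).toEquiv ⁻¹' s := by
  ext x
  constructor
  · rintro ⟨y, hy, rfl⟩
    rwa [mem_preimage, zpow_neg_apply_apply]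
  · intro hx
    exact ⟨_, hx, T.zpow_apply_neg_apply k x⟩

/-! ### Wandering sets -/

/-- If countably many measurable sets cover the space and each of them is visited only finitely
often by each orbit, then there is a measurable set that meets every orbit exactly once. -/
theorem exists_wandering (T : MeasureAut ν) (R : ℕ → Set Y) (hR : ∀ i, MeasurableSet (R i))
    (hcover : ⋃ i, R i = univ)
    (hfin : ∀ i, {k : ℤ | ∃ x ∈ R i, (T.zpow k).toEquiv x ∈ R i}.Finite) :
    ∃ D : Set Y, MeasurableSet D ∧
      (∀ i i' : ℤ, i ≠ i' → Disjoint ((T.zpow i).toEquiv '' D) ((T.zpow i').toEquiv '' D)) ∧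
      ⋃ i : ℤ, (T.zpow i).toEquiv '' D = univ := by
  -- From each orbit `D` selects the last visit to the first `R i` that the orbit meets at all.
  let D : Set Y := ⋃ i, (R i ∩ ((⋂ i' : ℕ, ⋂ (_ : i' < i), ⋂ k : ℤ,
    (T.zpow k).toEquiv ⁻¹' (R i')ᶜ) ∩ ⋂ k : ℤ, ⋂ (_ : 0 < k), (T.zpow k).toEquiv ⁻¹' (R i)ᶜ))
  have hD : ∀ x, x ∈ D ↔ ∃ i, x ∈ R i ∧ (∀ i' < i, ∀ k : ℤ, (T.zpow k).toEquiv x ∉ R i') ∧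
      ∀ k : ℤ, 0 < k → (T.zpow k).toEquiv x ∉ R i := by
    intro x
    simp [D]
  have hone : ∀ x ∈ D, ∀ c : ℤ, 0 < c → (T.zpow c).toEquiv x ∉ D := by
    intro x hx c hc hy
    obtain ⟨i, hxi, h1, h2⟩ := (hD x).1 hx
    obtain ⟨j, hyj, h3, h4⟩ := (hD _).1 hy
    rcases lt_trichotomy i j with h | rfl | h
    · exact h3 i h (-c) (by rwa [zpow_neg_apply_apply])
    · exact h2 c hc hyj
    · exact h1 j h c hyj
  refine ⟨D, MeasurableSet.iUnion fun i => (hR i).inter (MeasurableSet.inter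
    (MeasurableSet.iInter fun i' => MeasurableSet.iInter fun _ => MeasurableSet.iInter fun k =>
      (T.zpow k).toEquiv.measurable (hR i').compl)
    (MeasurableSet.iInter fun k => MeasurableSet.iInter fun _ =>
      (T.zpow k).toEquiv.measurable (hR i).compl)), ?_, ?_⟩
  · intro a b hab
    rw [Set.disjoint_left]
    rintro _ ⟨x, hx, rfl⟩ ⟨y, hy, hxy⟩
    rcases lt_or_gt_of_ne hab with h | h
    · refine hone y hy (b - a) (by omega) ?_
      rw [sub_eq_neg_add, zpow_add_apply, hxy, zpow_neg_apply_apply]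
      exact hx
    · refine hone x hx (a - b) (by omega) ?_
      rw [sub_eq_neg_add, zpow_add_apply, ← hxy, zpow_neg_apply_apply]
      exact hy
  · refine eq_univ_of_forall fun z => ?_
    have hex : ∃ i, ∃ k : ℤ, (T.zpow k).toEquiv z ∈ R i := by
      obtain ⟨i, hi⟩ := mem_iUnion.1 (hcover.symm ▸ mem_univ z)
      exact ⟨i, 0, hi⟩
    classical
    let i := Nat.find hex
    obtain ⟨k₀, hk₀⟩ : ∃ k : ℤ, (T.zpow k).toEquiv z ∈ R i := Nat.find_spec hex
    have hmin : ∀ i' < i, ∀ k : ℤ, (T.zpow k).toEquiv z ∉ R i' := fun i' hi' k hk =>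
      Nat.find_min hex hi' ⟨k, hk⟩
    have hvis : {k : ℤ | (T.zpow k).toEquiv z ∈ R i}.Finite := by
      refine ((hfin i).image fun k => k + k₀).subset fun k hk => ⟨k - k₀, ⟨_, hk₀, ?_⟩, by simp⟩
      rw [← zpow_add_apply, sub_add_cancel]
      exact hk
    obtain ⟨K, hK, hmax⟩ := hvis.exists_maximal ⟨k₀, hk₀⟩
    refine mem_iUnion.2 ⟨-K, (T.zpow K).toEquiv z, (hD _).2 ⟨i, hK, fun i' hi' k hk => ?_,
      fun k hk hki => ?_⟩, T.zpow_neg_apply_apply K z⟩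
    · rw [← zpow_add_apply] at hk
      exact hmin i' hi' _ hk
    · rw [← zpow_add_apply] at hki
      have := hmax hki (by omega)
      omega

/-! ### Lebesgue spectrum of dissipative transformations -/

/-- The square integrable functions that vanish outside a set. -/
noncomputable def supportedOn (ν : Measure Y) (A : Set Y) : Submodule ℂ (Lp ℂ 2 ν) :=
  (LpToLpRestrictCLM Y ℂ ℂ ν 2 Aᶜ).ker

theorem mem_supportedOn {A : Set Y} (hA : MeasurableSet A) {f : Lp ℂ 2 ν} :
    f ∈ supportedOn ν A ↔ ∀ᵐ x ∂ν, x ∉ A → f x = 0 := by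
  rw [supportedOn, LinearMap.mem_ker, ContinuousLinearMap.coe_coe, Lp.eq_zero_iff_ae_eq_zero]
  change _ ↔ ∀ᵐ x ∂ν, x ∈ Aᶜ → f x = 0
  rw [← ae_restrict_iff' hA.compl]
  constructor
  · intro h
    filter_upwards [h, LpToLpRestrictCLM_coeFn ℂ Aᶜ f] with x h1 h2
    rw [← h2, h1]
    rfl
  · intro h
    filter_upwards [h, LpToLpRestrictCLM_coeFn ℂ Aᶜ f] with x h1 h2
    rw [h2, h1]
    rfl

theorem isClosed_supportedOn (A : Set Y) : IsClosed (supportedOn ν A : Set (Lp ℂ 2 ν)) :=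
  (LpToLpRestrictCLM Y ℂ ℂ ν 2 Aᶜ).isClosed_ker

theorem inner_eq_zero_of_ae {f g : Lp ℂ 2 ν} (h : ∀ᵐ x ∂ν, f x = 0 ∨ g x = 0) :
    ⟪f, g⟫_ℂ = 0 := by
  rw [L2.inner_def]
  refine integral_eq_zero_of_ae ?_
  filter_upwards [h] with x hx
  rcases hx with hx | hx <;> simp [hx]

theorem ae_eq_zero_of_orthogonal_supportedOn {A : Set Y} (hA : MeasurableSet A) {f : Lp ℂ 2 ν}
    (hf : ∀ g ∈ supportedOn ν A, ⟪g, f⟫_ℂ = 0) : ∀ᵐ x ∂ν, x ∈ A → f x = 0 := by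
  have hmem : MemLp (A.indicator f) 2 ν := (Lp.memLp f).indicator hA
  let g : Lp ℂ 2 ν := hmem.toLp _
  have hg : g ∈ supportedOn ν A := by
    rw [mem_supportedOn hA]
    filter_upwards [hmem.coeFn_toLp] with x hx hxA
    rw [hx, indicator_of_notMem hxA]
  have h0 : ⟪g, g⟫_ℂ = 0 := by
    have h1 : ⟪g, f - g⟫_ℂ = 0 := by
      refine inner_eq_zero_of_ae ?_
      filter_upwards [hmem.coeFn_toLp, Lp.coeFn_sub f g] with x hx hx'
      rw [hx', Pi.sub_apply, hx]
      by_cases hxA : x ∈ A <;> simp [hxA]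
    rw [inner_sub_right, hf g hg, zero_sub, neg_eq_zero] at h1
    exact h1
  filter_upwards [hmem.coeFn_toLp, (Lp.eq_zero_iff_ae_eq_zero).1 (inner_self_eq_zero.1 h0)]
    with x hx hx' hxA
  rw [hx, indicator_of_mem hxA] at hx'
  exact hx'

theorem supportedOn_mono {A B : Set Y} (hA : MeasurableSet A) (hB : MeasurableSet B)
    (h : A ⊆ B) : supportedOn ν A ≤ supportedOn ν B := fun f hf => by
  rw [mem_supportedOn hB]
  filter_upwards [(mem_supportedOn hA).1 hf] with x hx hxB
  exact hx fun hxA => hxB (h hxA)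

theorem exists_ne_zero_mem_supportedOn [SigmaFinite ν] {A : Set Y} (hA : MeasurableSet A)
    (h0 : ν A ≠ 0) : ∃ f ∈ supportedOn ν A, f ≠ 0 := by
  obtain ⟨B, hB, hBA, hB0, hBtop⟩ : ∃ B, MeasurableSet B ∧ B ⊆ A ∧ ν B ≠ 0 ∧ ν B ≠ ∞ := by
    obtain ⟨B, hB, hBA, hB0, hBtop⟩ := Measure.exists_subset_measure_lt_top hA
      (pos_iff_ne_zero.2 h0)
    exact ⟨B, hB, hBA, hB0.ne', hBtop.ne⟩
  refine ⟨indicatorConstLp 2 hB hBtop (1 : ℂ), ?_, ?_⟩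
  · rw [mem_supportedOn hA]
    filter_upwards [indicatorConstLp_coeFn (p := 2) (hs := hB) (hμs := hBtop) (c := (1 : ℂ))]
      with x hx hxA
    rw [hx, indicator_of_notMem fun h => hxA (hBA h)]
  · intro h
    have := congrArg norm h
    rw [norm_indicatorConstLp (by norm_num) (by norm_num)] at this
    simp only [norm_one, one_mul, norm_zero] at this
    rw [Real.rpow_eq_zero measureReal_nonneg (by norm_num)] at this
    exact (measureReal_ne_zero_iff hBtop).2 hB0 this

/-- A set of positive measure for a measure without atoms splits into two such sets. -/
theorem exists_split [StandardBorelSpace Y] [NullSingletonClass ν] {A : Set Y}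
    (h0 : ν A ≠ 0) : ∃ B, MeasurableSet B ∧ ν (A ∩ B) ≠ 0 ∧ ν (A \ B) ≠ 0 := by
  by_contra! hcon
  obtain ⟨s, hsc, hsm, hsep⟩ :=
    (MeasurableSpace.CountablySeparated.countably_separated (α := Y)).1
  -- If `A` does not split, each `B` has a null part of `A` on one side. Discarding these null parts
  -- for a countable separating family leaves at most one point of `A`.
  let N : Set Y → Set Y := fun B => by
    classical exact if ν (A ∩ B) = 0 then A ∩ B else A \ B
  have hN : ∀ B ∈ s, ν (N B) = 0 := by
    intro B hB
    by_cases h : ν (A ∩ B) = 0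
    · simp [N, h]
    · simp [N, h, hcon B (hsm B hB) h]
  have hU : ν (⋃ B ∈ s, N B) = 0 := (measure_biUnion_null_iff hsc).2 hN
  have hss : (A \ ⋃ B ∈ s, N B).Subsingleton := by
    intro x hx y hy
    refine hsep x trivial y trivial fun B hB => ?_
    have hxB : x ∉ N B := fun h => hx.2 (mem_biUnion hB h)
    have hyB : y ∉ N B := fun h => hy.2 (mem_biUnion hB h)
    have hxA := hx.1
    have hyA := hy.1
    by_cases h : ν (A ∩ B) = 0
    · simp only [N, h, if_true] at hxB hyB
      exact ⟨fun h' => absurd ⟨hxA, h'⟩ hxB, fun h' => absurd ⟨hyA, h'⟩ hyB⟩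
    · simp only [N, h, if_false] at hxB hyB
      exact ⟨fun _ => by_contra fun h' => hyB ⟨hyA, h'⟩, fun _ => by_contra fun h' => hxB ⟨hxA, h'⟩⟩
  have hA : ν A ≤ ν (A \ ⋃ B ∈ s, N B) + ν (⋃ B ∈ s, N B) :=
    (measure_mono (by intro x hx; by_cases h : x ∈ ⋃ B ∈ s, N B <;> simp_all)).trans
      (measure_union_le _ _)
  rw [hU, hss.measure_zero, add_zero] at hA
  exact h0 (le_antisymm hA zero_le)

/-- Splitting `A` into two parts of positive measure makes the dimension strictly smaller, so a
finite dimension would allow an infinite descent. -/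
theorem not_finiteDimensional_supportedOn [StandardBorelSpace Y] [NullSingletonClass ν]
    [SigmaFinite ν] {A : Set Y} (hA : MeasurableSet A) (h0 : ν A ≠ 0) :
    ¬ FiniteDimensional ℂ (supportedOn ν A) := by
  intro hfd
  induction hn : Module.finrank ℂ (supportedOn ν A) using Nat.strong_induction_on
    generalizing A with
  | _ n ih =>
    obtain ⟨B, hB, h1, h2⟩ := exists_split h0
    have hle := supportedOn_mono (ν := ν) (hA.inter hB) hA inter_subset_left
    have hlt : supportedOn ν (A ∩ B) < supportedOn ν A := by
      refine lt_of_le_of_ne hle fun heq => ?_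
      obtain ⟨f, hf, hf0⟩ := exists_ne_zero_mem_supportedOn (hA.diff hB) h2
      have hf' : f ∈ supportedOn ν (A ∩ B) :=
        heq ▸ supportedOn_mono (hA.diff hB) hA sdiff_subset hf
      refine hf0 ((Lp.eq_zero_iff_ae_eq_zero).2 ?_)
      filter_upwards [(mem_supportedOn (hA.diff hB)).1 hf, (mem_supportedOn (hA.inter hB)).1 hf']
        with x hx hx'
      by_cases hxB : x ∈ B
      · exact hx fun h => h.2 hxB
      · exact hx' fun h => hxB h.2
    have : FiniteDimensional ℂ (supportedOn ν (A ∩ B)) := Submodule.finiteDimensional_of_le hle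
    exact ih _ (hn ▸ Submodule.finrank_lt_finrank_of_lt hlt) (hA.inter hB) h1 this rfl

/-- Orthonormal vectors have mutual distance `√2`, so the balls of radius `1 / 2` around them are
disjoint, and separability makes the basis countable. -/
theorem exists_denumerable_hilbertBasis {E : Type*} [NormedAddCommGroup E]
    [InnerProductSpace ℂ E] [CompleteSpace E] [SecondCountableTopology E]
    (h : ¬ FiniteDimensional ℂ E) : Nonempty (HilbertBasis ℕ ℂ E) := by
  obtain ⟨w, b, hb⟩ := exists_hilbertBasis ℂ E
  have hw : w.Countable := by
    have hdisj : Pairwise (Function.onFun Disjoint fun i : w =>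
        Metric.ball (b i) (1 / 2)) := by
      intro i j hij
      refine Metric.ball_disjoint_ball ?_
      have h1 : ‖b i - b j‖ ^ 2 = 2 := by
        rw [@norm_sub_sq ℂ, b.orthonormal.inner_eq_zero hij, b.orthonormal.norm_eq_one,
          b.orthonormal.norm_eq_one]
        norm_num
      rw [dist_eq_norm]
      nlinarith [norm_nonneg (b i - b j)]
    exact (Pairwise.countable_of_isOpen_disjoint (ι := w) hdisj (fun _ => Metric.isOpen_ball)
      fun _ => Metric.nonempty_ball.2 (by norm_num)).to_set
  have hinf : Infinite w := by
    rw [← not_finite_iff_infinite]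
    intro hfin
    have := Fintype.ofFinite w
    exact h (Module.Finite.of_basis b.toOrthonormalBasis.toBasis)
  have := hw.to_subtype
  obtain ⟨e⟩ := nonempty_equiv_of_countable (α := w) (β := ℕ)
  refine ⟨HilbertBasis.mk (v := b ∘ e.symm) (b.orthonormal.comp _ e.symm.injective) ?_⟩
  rw [range_comp, e.symm.range_eq_univ, image_univ, b.dense_span]

theorem integral_fourier_haar (k : ℤ) :
    ∫ x : UnitAddCircle, fourier k x ∂AddCircle.haarAddCircle = if k = 0 then 1 else 0 := by
  have h := orthonormal_iff_ite.1 (@orthonormal_fourier 1 _) 0 k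
  rw [L2.inner_def] at h
  simp only [eq_comm (a := (0 : ℤ))] at h
  rw [← h]
  refine integral_congr_ae ?_
  filter_upwards [@coeFn_fourierLp 1 _ 2 _ 0, @coeFn_fourierLp 1 _ 2 _ k] with x h1 h2
  rw [h1, h2]
  simp

theorem coeFn_koopman_zpow (T : MeasureAut ν) (k : ℤ) (f : Lp ℂ 2 ν) :
    ((T.koopman ^ k) f : Y → ℂ) =ᵐ[ν] (f : Y → ℂ) ∘ (T.zpow k).toEquiv := by
  rw [koopman_zpow]
  exact coeFn_koopman _ f

/-- The orthogonality of the translates of a function on a wandering set. -/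
theorem inner_koopman_zpow_of_wandering (T : MeasureAut ν) {D : Set Y} (hD : MeasurableSet D)
    (hdisj : ∀ i i' : ℤ, i ≠ i' →
      Disjoint ((T.zpow i).toEquiv '' D) ((T.zpow i').toEquiv '' D))
    {f g : Lp ℂ 2 ν} (hf : f ∈ supportedOn ν D) (hg : g ∈ supportedOn ν D) {k : ℤ} (hk : k ≠ 0) :
    ⟪f, (T.koopman ^ k) g⟫_ℂ = 0 := by
  refine inner_eq_zero_of_ae ?_
  filter_upwards [(mem_supportedOn hD).1 hf, T.coeFn_koopman_zpow k g,
    (T.zpow k).preserves.quasiMeasurePreserving.ae ((mem_supportedOn hD).1 hg)] with x h1 h2 h3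
  rw [h2, Function.comp_apply]
  by_cases hx : x ∈ D
  · refine Or.inr (h3 fun hx' => ?_)
    exact Set.disjoint_left.1 (hdisj k 0 hk) ⟨x, hx, rfl⟩ ⟨_, hx', rfl⟩
  · exact Or.inl (h1 hx)

/-- The cyclic vectors are an orthonormal basis of the functions supported on `D`. All their
translates are orthonormal, so each spectral measure is Haar measure. A vector orthogonal to all of
them vanishes on every image of `D`. -/
theorem hasCountableLebesgueSpectrum_of_wandering [StandardBorelSpace Y] [NullSingletonClass ν]
    [SigmaFinite ν] (T : MeasureAut ν) (hν : ν univ ≠ 0) {D : Set Y} (hD : MeasurableSet D)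
    (hdisj : ∀ i i' : ℤ, i ≠ i' →
      Disjoint ((T.zpow i).toEquiv '' D) ((T.zpow i').toEquiv '' D))
    (hcover : ⋃ i : ℤ, (T.zpow i).toEquiv '' D = univ) :
    HasCountableLebesgueSpectrum T.koopman := by
  have hD0 : ν D ≠ 0 := by
    intro h
    refine hν ?_
    rw [← hcover, measure_iUnion_null_iff]
    intro i
    rw [image_zpow_eq_preimage, (T.zpow (-i)).preserves.measure_preimage hD.nullMeasurableSet, h]
  have : CompleteSpace (supportedOn ν D) := (isClosed_supportedOn D).completeSpace_coe
  have : Fact ((2 : ℝ≥0∞) ≠ ∞) := ⟨by norm_num⟩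
  have : SecondCountableTopology (Lp ℂ 2 ν) := inferInstance
  have : SecondCountableTopology (supportedOn ν D) :=
    inferInstanceAs (SecondCountableTopology ((supportedOn ν D : Set (Lp ℂ 2 ν)) : Type _))
  obtain ⟨b⟩ := exists_denumerable_hilbertBasis (not_finiteDimensional_supportedOn hD hD0)
  refine ⟨fun i => (b i : Lp ℂ 2 ν), fun i k => ?_, fun i i' hii k => ?_, ?_⟩
  · rw [integral_fourier_haar]
    split_ifs with hk
    · rw [hk, zpow_zero]
      exact (inner_self_eq_norm_sq_to_K (𝕜 := ℂ) (b i)).trans (by simp [b.orthonormal.norm_eq_one])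
    · exact T.inner_koopman_zpow_of_wandering hD hdisj (b i).2 (b i).2 hk
  · by_cases hk : k = 0
    · rw [hk, zpow_zero]
      exact b.orthonormal.inner_eq_zero hii
    · exact T.inner_koopman_zpow_of_wandering hD hdisj (b i).2 (b i').2 hk
  · rw [Submodule.topologicalClosure_eq_top_iff, Submodule.eq_bot_iff]
    intro G hG
    have h1 : ∀ k : ℤ, ∀ᵐ x ∂ν, x ∈ (T.zpow k).toEquiv '' D → G x = 0 := by
      intro k
      have h2 : ∀ g ∈ supportedOn ν D, ⟪g, (T.koopman ^ k) G⟫_ℂ = 0 := by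
        intro g hg
        have h3 : (⟨g, hg⟩ : supportedOn ν D) ∈
            (Submodule.span ℂ (range b)).topologicalClosure := by
          rw [b.dense_span]
          trivial
        have hcl : IsClosed {u : supportedOn ν D | ⟪(u : Lp ℂ 2 ν), (T.koopman ^ k) G⟫_ℂ = 0} :=
          isClosed_eq (by fun_prop) continuous_const
        refine hcl.closure_subset_iff.2 ?_ h3
        intro u hu
        induction hu using Submodule.span_induction with
        | mem u hu =>
          obtain ⟨i, rfl⟩ := hu
          have h4 := (Submodule.mem_orthogonal _ _).1 hG _
            (Submodule.subset_span ⟨(i, -k), rfl⟩)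
          dsimp only at h4
          rw [← LinearIsometryEquiv.inner_map_map (T.koopman ^ k)] at h4
          rw [zpow_neg, show (T.koopman ^ k) ((T.koopman ^ k)⁻¹ (b i : Lp ℂ 2 ν)) = b i from
            (T.koopman ^ k).apply_symm_apply _] at h4
          exact h4
        | zero => simp
        | add u v _ _ hu hv =>
          change ⟪(u : Lp ℂ 2 ν) + v, _⟫_ℂ = 0
          rw [inner_add_left, show ⟪(u : Lp ℂ 2 ν), _⟫_ℂ = 0 from hu,
            show ⟪(v : Lp ℂ 2 ν), _⟫_ℂ = 0 from hv, add_zero]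
        | smul c u _ hu =>
          change ⟪c • (u : Lp ℂ 2 ν), _⟫_ℂ = 0
          rw [inner_smul_left, show ⟪(u : Lp ℂ 2 ν), _⟫_ℂ = 0 from hu, mul_zero]
      have h5 := ae_eq_zero_of_orthogonal_supportedOn hD h2
      filter_upwards [(T.zpow (-k)).preserves.quasiMeasurePreserving.ae h5,
        (T.zpow (-k)).preserves.quasiMeasurePreserving.ae (T.coeFn_koopman_zpow k G)]
        with x hx hx' hxD
      rw [hx', Function.comp_apply, zpow_apply_neg_apply, ← mem_preimage,
        ← image_zpow_eq_preimage] at hx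
      exact hx hxD
    refine (Lp.eq_zero_iff_ae_eq_zero).2 ?_
    filter_upwards [ae_all_iff.2 h1] with x hx
    obtain ⟨k, hk⟩ := mem_iUnion.1 (hcover.symm ▸ mem_univ x)
    exact hx k hk

end MeasureAut

/-! ### Existence of spectral measures -/

section SpectralMeasure

open CompactlySupported

variable {H : Type*} [NormedAddCommGroup H] [InnerProductSpace ℂ H] [CompleteSpace H]

/-- A star homomorphism from the continuous functions on the circle to the bounded operators
assigns to each vector a finite measure. -/
theorem exists_measure_of_starAlgHom (Φ : C(UnitAddCircle, ℂ) →⋆ₐ[ℂ] (H →L[ℂ] H)) (f : H) :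
    ∃ σ : Measure UnitAddCircle, IsFiniteMeasure σ ∧
      ∀ g : C(UnitAddCircle, ℂ), ⟪f, Φ g f⟫_ℂ = ∫ x, g x ∂σ := by
  let re : C(UnitAddCircle, ℝ) → C(UnitAddCircle, ℂ) := fun g => ⟨fun x => (g x : ℂ), by fun_prop⟩
  have hreal : ∀ g : C(UnitAddCircle, ℝ), ((⟪f, Φ (re g) f⟫_ℂ).re : ℂ) = ⟪f, Φ (re g) f⟫_ℂ := by
    intro g
    have hstar : star (re g) = re g := by ext x; simp [re]
    have hself : (Φ (re g)).adjoint = Φ (re g) := by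
      rw [← ContinuousLinearMap.star_eq_adjoint, ← map_star, hstar]
    rw [← Complex.conj_eq_iff_re, inner_conj_symm, ← ContinuousLinearMap.adjoint_inner_right, hself]
  have hpos : ∀ g : C(UnitAddCircle, ℝ), (∀ x, 0 ≤ g x) → 0 ≤ (⟪f, Φ (re g) f⟫_ℂ).re := by
    intro g hg
    -- Since `re g = star (re s) * re s`, the inner product is `‖Φ (re s) f‖ ^ 2`.
    let s : C(UnitAddCircle, ℝ) := ⟨fun x => Real.sqrt (g x), by fun_prop⟩
    have hs : re g = star (re s) * re s := by
      ext x
      simp only [re, s, ContinuousMap.coe_mk, ContinuousMap.mul_apply, ContinuousMap.star_apply,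
        RCLike.star_def, Complex.conj_ofReal]
      rw [← Complex.ofReal_mul, Real.mul_self_sqrt (hg x)]
    rw [hs, map_mul, map_star, ContinuousLinearMap.star_eq_adjoint,
      mul_apply_eq_comp, ContinuousLinearMap.adjoint_inner_right]
    exact inner_self_nonneg (𝕜 := ℂ)
  have hadd : ∀ g h, re (g + h) = re g + re h := fun g h => by ext x; simp [re]
  have hsmul : ∀ (c : ℝ) g, re (c • g) = (c : ℂ) • re g := fun c g => by ext x; simp [re]
  let Λ₀ : C_c(UnitAddCircle, ℝ) →ₗ[ℝ] ℝ :=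
    { toFun := fun g => (⟪f, Φ (re g.toContinuousMap) f⟫_ℂ).re
      map_add' := fun g h => by
        rw [← Complex.add_re, ← inner_add_right, ← add_apply, ← map_add, ← hadd]
        rfl
      map_smul' := fun c g => by
        rw [RingHom.id_apply, smul_eq_mul, ← Complex.re_ofReal_mul, ← inner_smul_right,
          ← smul_apply, ← map_smul, ← hsmul]
        rfl }
  let Λ : C_c(UnitAddCircle, ℝ) →ₚ[ℝ] ℝ :=
    PositiveLinearMap.mk₀ Λ₀ fun g hg => hpos g.toContinuousMap fun x => hg x
  have hΛ : ∀ g : C(UnitAddCircle, ℝ),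
      ⟪f, Φ (re g) f⟫_ℂ = ∫ x, (g x : ℂ) ∂(RealRMK.rieszMeasure Λ) := by
    intro g
    rw [← hreal, integral_complex_ofReal]
    congr 1
    exact (RealRMK.integral_rieszMeasure Λ
      ⟨g, HasCompactSupport.of_compactSpace _⟩).symm
  refine ⟨RealRMK.rieszMeasure Λ, inferInstance, fun g => ?_⟩
  let g₁ : C(UnitAddCircle, ℝ) := ⟨fun x => (g x).re, by fun_prop⟩
  let g₂ : C(UnitAddCircle, ℝ) := ⟨fun x => (g x).im, by fun_prop⟩
  have hg : g = re g₁ + Complex.I • re g₂ := by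
    ext x
    simp [re, g₁, g₂, mul_comm Complex.I]
  have hint : ∀ h : C(UnitAddCircle, ℂ), Integrable h (RealRMK.rieszMeasure Λ) := fun h =>
    (map_continuous h).integrable_of_hasCompactSupport (HasCompactSupport.of_compactSpace _)
  calc ⟪f, Φ g f⟫_ℂ = ⟪f, Φ (re g₁) f⟫_ℂ + Complex.I * ⟪f, Φ (re g₂) f⟫_ℂ := by
        conv_lhs => rw [hg, map_add, map_smul, add_apply, smul_apply, inner_add_right,
          inner_smul_right]
    _ = ∫ x, g x ∂(RealRMK.rieszMeasure Λ) := by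
        rw [hΛ, hΛ, ← integral_const_mul]
        refine (integral_add (hint (re g₁)) ((hint (re g₂)).const_mul _)).symm.trans ?_
        refine integral_congr_ae (Filter.Eventually.of_forall fun x => ?_)
        exact (congrArg (fun h : C(UnitAddCircle, ℂ) => h x) hg).symm

/-- The functional calculus of the unitary operator, pulled back to the circle, is a star
homomorphism; Riesz-Markov turns its diagonal matrix coefficient at `f` into a measure. -/
theorem exists_isSpectralMeasure (U : H ≃ₗᵢ[ℂ] H) (f : H) :
    ∃ σ : Measure UnitAddCircle, IsFiniteMeasure σ ∧ IsSpectralMeasure U f σ := by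
  let u : unitary (H →L[ℂ] H) := Unitary.linearIsometryEquiv.symm U
  have hu : Unitary.linearIsometryEquiv u = U := MulEquiv.apply_symm_apply _ _
  have hnormal : IsStarNormal (u : H →L[ℂ] H) := inferInstance
  let Ψ := cfcHom (R := ℂ) hnormal
  have hcirc : ∀ z : spectrum ℂ (u : H →L[ℂ] H), (z : ℂ) ∈ Submonoid.unitSphere ℂ := fun z =>
    Unitary.spectrum_subset_circle u z.2
  let c : spectrum ℂ (u : H →L[ℂ] H) → Circle := fun z => ⟨z, hcirc z⟩
  have hc : Continuous c := Continuous.subtype_mk continuous_subtype_val _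
  let θ : C(spectrum ℂ (u : H →L[ℂ] H), UnitAddCircle) :=
    ⟨fun z => (AddCircle.homeomorphCircle (one_ne_zero (α := ℝ))).symm (c z),
      (Homeomorph.continuous _).comp hc⟩
  let Φ : C(UnitAddCircle, ℂ) →⋆ₐ[ℂ] (H →L[ℂ] H) :=
    Ψ.comp (ContinuousMap.compStarAlgHom' ℂ ℂ θ)
  obtain ⟨σ, hσ, hint⟩ := exists_measure_of_starAlgHom Φ f
  have h1 : Φ (fourier 1) = u := by
    change Ψ ((fourier 1 : C(UnitAddCircle, ℂ)).comp θ) = u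
    have : (fourier 1 : C(UnitAddCircle, ℂ)).comp θ
        = (ContinuousMap.id ℂ).restrict (spectrum ℂ (u : H →L[ℂ] H)) := by
      ext z
      simp only [ContinuousMap.comp_apply, fourier_one, θ, ContinuousMap.coe_mk]
      rw [← AddCircle.homeomorphCircle_apply one_ne_zero, Homeomorph.apply_symm_apply]
      rfl
    rw [this]
    exact cfcHom_id hnormal
  let F₁ : Multiplicative ℤ →* (H →L[ℂ] H) :=
    { toFun := fun k => Φ (fourier k.toAdd)
      map_one' := by
        rw [← map_one Φ]
        congr 1
        ext x
        simp
      map_mul' := fun k l => by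
        rw [← map_mul]
        congr 1
        ext x
        simp }
  let F₂ : Multiplicative ℤ →* (H →L[ℂ] H) :=
    (unitary (H →L[ℂ] H)).subtype.comp (zpowersHom _ u)
  -- Homomorphisms from `ℤ` that agree at the generator coincide, which covers all Fourier
  -- coefficients at once.
  have hF : F₁ = F₂ := MonoidHom.ext_mint (by simpa [F₁, F₂, zpowersHom_apply] using h1)
  refine ⟨σ, hσ, fun k => ?_⟩
  rw [← hint (fourier k)]
  have h2 : Φ (fourier k) = ((u ^ k : unitary (H →L[ℂ] H)) : H →L[ℂ] H) :=
    DFunLike.congr_fun hF (Multiplicative.ofAdd k)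
  rw [h2, ← hu, ← map_zpow]
  rfl

end SpectralMeasure

/-! ### A criterion for singularity -/

section Singular

open Filter Topology

theorem norm_fourier_apply (k : ℤ) (x : UnitAddCircle) : ‖fourier k x‖ = 1 := by
  rw [fourier_apply, Circle.norm_coe]

/-- A three-epsilon argument with Lipschitz constants uniform in `i`. It lets limit relations be
checked on dense subspaces. -/
theorem isClosed_setOf_tendsto_of_lipschitz {ι E : Type*} [SeminormedAddCommGroup E] {l : Filter ι}
    {A : ι → E → ℂ} {B : E → ℂ} {C : ℝ} (hA : ∀ i x y, ‖A i x - A i y‖ ≤ C * ‖x - y‖)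
    (hB : ∀ x y, ‖B x - B y‖ ≤ C * ‖x - y‖) :
    IsClosed {x | Tendsto (fun i => A i x) l (𝓝 (B x))} := by
  refine isClosed_of_closure_subset fun x hx => ?_
  change Tendsto (fun i => A i x) l (𝓝 (B x))
  rw [Metric.tendsto_nhds]
  intro ε hε
  obtain ⟨y, hy, hxy⟩ := Metric.mem_closure_iff.1 hx (ε / (3 * (|C| + 1))) (by positivity)
  have hsmall : C * ‖x - y‖ < ε / 3 := by
    rw [dist_eq_norm, lt_div_iff₀ (by positivity)] at hxy
    nlinarith [le_abs_self C, norm_nonneg (x - y)]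
  filter_upwards [(Metric.tendsto_nhds.1 hy) (ε / 3) (by positivity)] with i hi
  rw [dist_eq_norm] at hi ⊢
  have h1 := hA i x y
  have h2 := hB y x
  rw [norm_sub_rev y x] at h2
  calc ‖A i x - B x‖ = ‖(A i x - A i y) + (A i y - B y) + (B y - B x)‖ := by congr 1; ring
    _ ≤ ‖A i x - A i y‖ + ‖A i y - B y‖ + ‖B y - B x‖ := norm_add₃_le
    _ < ε := by linarith

/-- If the Fourier coefficients of a finite measure satisfy a limit relation along shifts, then so
do the integrals of all integrable functions. -/
theorem tendsto_integral_fourier_mul {ι : Type*} {l : Filter ι} {σ : Measure UnitAddCircle}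
    [IsFiniteMeasure σ] {κ : ι → ℤ} {c : ℂ}
    (h : ∀ n : ℤ, Tendsto (fun i => ∫ x, fourier (κ i + n) x ∂σ) l (𝓝 (c * ∫ x, fourier n x ∂σ)))
    (φ : UnitAddCircle → ℂ) (hφ : Integrable φ σ) :
    Tendsto (fun i => ∫ x, fourier (κ i) x * φ x ∂σ) l (𝓝 (c * ∫ x, φ x ∂σ)) := by
  have hmul : ∀ (k : ℤ) {ψ : UnitAddCircle → ℂ}, Integrable ψ σ →
      Integrable (fun x => fourier k x * ψ x) σ := fun k ψ hψ =>
    hψ.bdd_mul (map_continuous _).aestronglyMeasurable (c := 1)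
      (Eventually.of_forall fun x => (norm_fourier_apply k x).le)
  have hbound : ∀ ψ : UnitAddCircle → ℂ, Integrable ψ σ → ∀ k : ℤ,
      ‖∫ x, fourier k x * ψ x ∂σ‖ ≤ ∫ x, ‖ψ x‖ ∂σ := fun ψ hψ k =>
    (norm_integral_le_integral_norm _).trans_eq
      (by simp only [norm_mul, norm_fourier_apply, one_mul])
  let C := max 1 ‖c‖
  -- The relation holds for characters. It spreads to continuous functions by density of
  -- trigonometric polynomials, and then to `L¹(σ)` by density of continuous functions.
  have hL1 : IsClosed {ψ : Lp ℂ 1 σ | Tendsto (fun i => ∫ x, fourier (κ i) x * ψ x ∂σ) l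
      (𝓝 (c * ∫ x, ψ x ∂σ))} := by
    have hsub : ∀ (k : ℤ) (x y : Lp ℂ 1 σ), ∫ t, fourier k t * x t ∂σ - ∫ t, fourier k t * y t ∂σ
        = ∫ t, fourier k t * (x - y) t ∂σ := by
      intro k x y
      rw [← integral_sub (hmul k (L1.integrable_coeFn x)) (hmul k (L1.integrable_coeFn y))]
      refine integral_congr_ae ?_
      filter_upwards [Lp.coeFn_sub x y] with t ht
      rw [ht, Pi.sub_apply, mul_sub]
    have hle : ∀ (k : ℤ) (x y : Lp ℂ 1 σ),
        ‖∫ t, fourier k t * x t ∂σ - ∫ t, fourier k t * y t ∂σ‖ ≤ ‖x - y‖ := by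
      intro k x y
      rw [hsub, L1.norm_eq_integral_norm]
      exact hbound _ (L1.integrable_coeFn _) k
    refine isClosed_setOf_tendsto_of_lipschitz (C := C) (fun i x y => ?_) fun x y => ?_
    · exact (hle _ x y).trans (le_mul_of_one_le_left (norm_nonneg _) (le_max_left _ _))
    · rw [← mul_sub, norm_mul]
      refine mul_le_mul (le_max_right _ _) ?_ (norm_nonneg _) (by positivity)
      simpa using hle 0 x y
  have hcont : ∀ g : C(UnitAddCircle, ℂ), Tendsto (fun i => ∫ x, fourier (κ i) x * g x ∂σ) l
      (𝓝 (c * ∫ x, g x ∂σ)) := by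
    have hint : ∀ g : C(UnitAddCircle, ℂ), Integrable g σ := fun g =>
      (map_continuous g).integrable_of_hasCompactSupport (HasCompactSupport.of_compactSpace _)
    have hcl : IsClosed {g : C(UnitAddCircle, ℂ) | Tendsto
        (fun i => ∫ x, fourier (κ i) x * g x ∂σ) l (𝓝 (c * ∫ x, g x ∂σ))} := by
      have hle : ∀ (k : ℤ) (x y : C(UnitAddCircle, ℂ)),
          ‖∫ t, fourier k t * x t ∂σ - ∫ t, fourier k t * y t ∂σ‖ ≤ σ.real univ * ‖x - y‖ := by
        intro k x y
        rw [← integral_sub (hmul k (hint x)) (hmul k (hint y)), mul_comm]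
        refine norm_integral_le_of_norm_le_const (Eventually.of_forall fun t => ?_)
        rw [← mul_sub, norm_mul, norm_fourier_apply, one_mul]
        simpa using (x - y).norm_coe_le_norm t
      refine isClosed_setOf_tendsto_of_lipschitz (C := C * σ.real univ) (fun i x y => ?_)
        fun x y => ?_
      · rw [mul_assoc]
        exact (hle _ x y).trans (le_mul_of_one_le_left (by positivity) (le_max_left _ _))
      · rw [← mul_sub, norm_mul, mul_assoc]
        refine mul_le_mul (le_max_right _ _) ?_ (norm_nonneg _) (by positivity)
        simpa using hle 0 x y
    intro g
    have hg : g ∈ (Submodule.span ℂ (range (@fourier 1))).topologicalClosure := by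
      rw [span_fourier_closure_eq_top]
      trivial
    refine hcl.closure_subset_iff.2 (fun g hg => ?_) hg
    induction hg using Submodule.span_induction with
    | mem g hg =>
      obtain ⟨n, rfl⟩ := hg
      simpa only [mem_ofPred_eq, fourier_add] using h n
    | zero => simpa using tendsto_const_nhds
    | add f g _ _ hf hg =>
      have : Tendsto _ l _ := Tendsto.add (f := fun i => ∫ x, fourier (κ i) x * f x ∂σ)
        (g := fun i => ∫ x, fourier (κ i) x * g x ∂σ) hf hg
      rw [← mul_add, ← integral_add (hint f) (hint g)] at this
      refine this.congr fun i => ?_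
      rw [← integral_add (hmul _ (hint f)) (hmul _ (hint g))]
      simp [mul_add]
    | smul a g _ hg =>
      have : Tendsto _ l _ := Tendsto.const_mul (f := fun i => ∫ x, fourier (κ i) x * g x ∂σ) a hg
      rw [mul_left_comm, ← integral_const_mul] at this
      refine this.congr fun i => ?_
      rw [← integral_const_mul]
      simp [mul_left_comm]
  have hall : ∀ ψ : Lp ℂ 1 σ, Tendsto (fun i => ∫ x, fourier (κ i) x * ψ x ∂σ) l
      (𝓝 (c * ∫ x, ψ x ∂σ)) := by
    intro ψ
    refine hL1.closure_subset_iff.2 ?_ (ContinuousMap.toLp_denseRange ℂ σ ℂ (by norm_num) ψ)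
    rintro _ ⟨g, rfl⟩
    have hae := ContinuousMap.coeFn_toLp (p := 1) (𝕜 := ℂ) σ g
    rw [mem_ofPred_eq, integral_congr_ae hae]
    refine (hcont g).congr fun i => integral_congr_ae ?_
    filter_upwards [hae] with x hx
    rw [hx]
  have hae := hφ.coeFn_toL1
  have := hall (hφ.toL1 φ)
  rw [integral_congr_ae hae] at this
  refine this.congr fun i => integral_congr_ae ?_
  filter_upwards [hae] with x hx
  rw [hx]

/-- The Riemann-Lebesgue lemma for `L²`: Fourier coefficients are square summable. -/
theorem tendsto_integral_fourier_mul_of_memLp {ψ : UnitAddCircle → ℂ}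
    (hψ : MemLp ψ 2 AddCircle.haarAddCircle) :
    Tendsto (fun k : ℤ => ∫ x, fourier k x * ψ x ∂AddCircle.haarAddCircle) cofinite (𝓝 0) := by
  have h1 := (hasSum_sq_fourierCoeff (hψ.toLp ψ)).summable.tendsto_cofinite_zero
  have h2 : Tendsto (fun k : ℤ => ‖fourierCoeff (hψ.toLp ψ) (-k)‖ ^ 2) cofinite (𝓝 0) :=
    h1.comp neg_injective.tendsto_cofinite
  rw [tendsto_zero_iff_norm_tendsto_zero]
  have h3 := (Real.continuous_sqrt.tendsto 0).comp h2
  rw [Real.sqrt_zero] at h3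
  refine h3.congr fun k => ?_
  rw [Function.comp_apply, Real.sqrt_sq (norm_nonneg _), fourierCoeff_congr_ae hψ.coeFn_toLp]
  simp [fourierCoeff]

/-- A finite measure whose Fourier coefficients do not decay along a sequence of shifts, in the
strong sense that they tend to a fixed multiple of the original ones, is singular. -/
theorem mutuallySingular_of_tendsto {ι : Type*} {l : Filter ι} [l.NeBot]
    {σ : Measure UnitAddCircle} [IsFiniteMeasure σ] {κ : ι → ℤ} (hκ : Tendsto κ l cofinite) {c : ℂ}
    (hc : c ≠ 0)
    (h : ∀ n : ℤ, Tendsto (fun i => ∫ x, fourier (κ i + n) x ∂σ) l (𝓝 (c * ∫ x, fourier n x ∂σ))) :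
    Measure.MutuallySingular σ AddCircle.haarAddCircle := by
  set lam : Measure UnitAddCircle := AddCircle.haarAddCircle
  let w := σ.rnDeriv lam
  have hw : Measurable w := Measure.measurable_rnDeriv σ lam
  obtain ⟨N, hN, hsN, hlN⟩ := Measure.mutuallySingular_singularPart σ lam
  -- On `B M` the measure has a density bounded by `M`, which is in `L²`. The integrals of `fourier
  -- (κ i)` over `B M` thus tend to zero by Riemann-Lebesgue and to `c * σ (B M)` by the hypothesis.
  -- The complement of the union of the `B M` is Haar-null.
  let B : ℕ → Set UnitAddCircle := fun M => N ∩ {x | w x ≤ M}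
  have hB : ∀ M, MeasurableSet (B M) := fun M =>
    hN.inter (measurableSet_le hw measurable_const)
  have hzero : ∀ M, σ (B M) = 0 := by
    intro M
    have hrestrict : σ.restrict (B M) = (lam.withDensity w).restrict (B M) := by
      conv_lhs => rw [Measure.haveLebesgueDecomposition_add σ lam]
      rw [Measure.restrict_add, Measure.restrict_eq_zero.2
        (measure_mono_null inter_subset_left hsN), zero_add]
    have hmem : MemLp ((B M).indicator fun x => ((w x).toReal : ℂ)) 2 lam := by
      refine MemLp.of_bound ((Complex.measurable_ofReal.comp
        hw.ennreal_toReal).indicator (hB M)).aestronglyMeasurable M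
        (Eventually.of_forall fun x => ?_)
      by_cases hx : x ∈ B M
      · rw [indicator_of_mem hx, Complex.norm_real, Real.norm_of_nonneg ENNReal.toReal_nonneg]
        exact ENNReal.toReal_le_of_le_ofReal (by positivity) (by simpa using hx.2)
      · simp [indicator_of_notMem hx]
    have h1 := (tendsto_integral_fourier_mul_of_memLp hmem).comp hκ
    have h2 := tendsto_integral_fourier_mul h ((B M).indicator 1)
      ((integrable_const (1 : ℂ)).indicator (hB M))
    have h3 : c * ∫ x, (B M).indicator (1 : UnitAddCircle → ℂ) x ∂σ = 0 := by
      refine tendsto_nhds_unique h2 (h1.congr fun i => ?_)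
      have h4 : ∀ x, fourier (κ i) x * (B M).indicator (1 : UnitAddCircle → ℂ) x
          = (B M).indicator (fun x => fourier (κ i) x) x := fun x => by
        by_cases hx : x ∈ B M <;> simp [hx]
      have h5 : ∀ x, fourier (κ i) x * (B M).indicator (fun x => ((w x).toReal : ℂ)) x
          = (B M).indicator (fun x => (w x).toReal • fourier (κ i) x) x := fun x => by
        by_cases hx : x ∈ B M <;> simp [hx, mul_comm]
      simp only [Function.comp_apply, h4, h5]
      rw [integral_indicator (hB M), integral_indicator (hB M), hrestrict,
        setIntegral_withDensity_eq_setIntegral_toReal_smul hw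
          (ae_restrict_of_ae (Measure.rnDeriv_lt_top σ lam)) _ (hB M)]
    have h6 := (mul_eq_zero.1 h3).resolve_left hc
    rw [integral_indicator (hB M)] at h6
    simpa [measureReal_def, ENNReal.toReal_eq_zero_iff] using h6
  refine ⟨⋃ M, B M, MeasurableSet.iUnion hB, measure_iUnion_null hzero, ?_⟩
  have hle : lam (⋃ M, B M)ᶜ ≤ lam Nᶜ + lam {x | ¬ w x < ∞} := by
    refine (measure_mono fun x hx => ?_).trans (measure_union_le _ _)
    by_contra hcon
    simp only [mem_union, mem_compl_iff, mem_ofPred_eq, not_or, not_not] at hcon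
    obtain ⟨M, hM⟩ := ENNReal.exists_nat_gt hcon.2.ne
    exact hx (mem_iUnion.2 ⟨M, hcon.1, hM.le⟩)
  rw [hlN, zero_add, ae_iff.1 (Measure.rnDeriv_lt_top σ lam)] at hle
  exact le_antisymm hle zero_le

/-- A unitary operator with powers converging weakly to a non-zero scalar has singular spectrum. -/
theorem hasSingularSpectrum_of_tendsto {H : Type*} [NormedAddCommGroup H] [InnerProductSpace ℂ H]
    [CompleteSpace H] {U : H ≃ₗᵢ[ℂ] H} {ι : Type*} {l : Filter ι} [l.NeBot] {κ : ι → ℤ}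
    (hκ : Tendsto κ l cofinite) {c : ℂ} (hc : c ≠ 0)
    (h : ∀ x y : H, Tendsto (fun i => ⟪x, (U ^ κ i) y⟫_ℂ) l (𝓝 (c * ⟪x, y⟫_ℂ))) :
    HasSingularSpectrum U := by
  intro f
  obtain ⟨σ, hσ, hspec⟩ := exists_isSpectralMeasure U f
  refine ⟨σ, hσ, hspec, mutuallySingular_of_tendsto hκ hc fun n => ?_⟩
  rw [← hspec n]
  refine (h f ((U ^ n) f)).congr fun i => ?_
  rw [← hspec, zpow_add]
  rfl

end Singular

/-! ### Hilbert space lemmas -/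

section Hilbert

open Filter Topology

variable {H : Type*} [NormedAddCommGroup H] [InnerProductSpace ℂ H]

theorem unitary_zpow_add_apply (U : H ≃ₗᵢ[ℂ] H) (k l : ℤ) (x : H) :
    (U ^ (k + l)) x = (U ^ k) ((U ^ l) x) := by
  rw [zpow_add]
  rfl

theorem dense_range_of_adjoint_injective [CompleteSpace H] {A : H →L[ℂ] H}
    (h : ∀ x, A.adjoint x = 0 → x = 0) : DenseRange A := by
  have h1 : A.range.topologicalClosure = ⊤ := by
    rw [Submodule.topologicalClosure_eq_top_iff, ContinuousLinearMap.orthogonal_range,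
      Submodule.eq_bot_iff]
    exact h
  have h2 := congrArg (fun M : Submodule ℂ H => (M : Set H)) h1
  exact dense_iff_closure_eq.2 h2

/-- The unitary factor in the polar decomposition of an operator `A` that is injective and has
dense range; it commutes or anticommutes with what commutes or anticommutes with `A` and commutes
with `A* A`. -/
theorem exists_polar_unitary [CompleteSpace H] {A : H →L[ℂ] H} (h1 : ∀ x, A x = 0 → x = 0)
    (h2 : ∀ x, A.adjoint x = 0 → x = 0) :
    ∃ W : H ≃ₗᵢ[ℂ] H, ∀ (R : H →L[ℂ] H) (ε : ℂ), R * A = ε • (A * R) →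
      Commute (star A * A) R → ∀ x, R (W x) = ε • W (R x) := by
  let B : H →L[ℂ] H := CFC.abs A
  have hBB : B * B = star A * A := CFC.abs_mul_abs A
  have hBsa : B.adjoint = B := (CFC.abs_nonneg A).isSelfAdjoint
  have hnorm : ∀ x, ‖A x‖ = ‖B x‖ := by
    intro x
    have h3 : ⟪B x, B x⟫_ℂ = ⟪A x, A x⟫_ℂ := by
      rw [← ContinuousLinearMap.adjoint_inner_right, hBsa,
        ← ContinuousLinearMap.adjoint_inner_right A, ← ContinuousLinearMap.star_eq_adjoint,
        ← mul_apply_eq_comp, ← mul_apply_eq_comp, hBB]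
    rw [inner_self_eq_norm_sq_to_K, inner_self_eq_norm_sq_to_K] at h3
    have h4 : ‖B x‖ ^ 2 = ‖A x‖ ^ 2 := by exact_mod_cast h3
    exact ((sq_eq_sq₀ (norm_nonneg _) (norm_nonneg _)).1 h4).symm
  have hBd : DenseRange B := dense_range_of_adjoint_injective fun x hx => h1 x (by
    rw [hBsa] at hx
    rw [← norm_eq_zero, hnorm, hx, norm_zero])
  have hAd : DenseRange A := dense_range_of_adjoint_injective h2
  -- Since `‖A x‖ = ‖B x‖` and `B` has dense range, `B x ↦ A x` extends to an isometry. It is onto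
  -- because `A` has dense range.
  let W₀ : H →L[ℂ] H := A.toLinearMap.extendOfNorm B.toLinearMap
  have hWB : ∀ x, W₀ (B x) = A x := fun x =>
    LinearMap.extendOfNorm_eq (f := A.toLinearMap) (e := B.toLinearMap) hBd
      ⟨1, fun x => by simp [hnorm]⟩ x
  have hWnorm : ∀ x, ‖W₀ x‖ = ‖x‖ := by
    intro x
    refine hBd.induction_on (p := fun x => ‖W₀ x‖ = ‖x‖) x
      (isClosed_eq (by fun_prop) (by fun_prop)) fun y => ?_
    rw [hWB, hnorm]
  let W₁ : H →ₗᵢ[ℂ] H := ⟨W₀.toLinearMap, hWnorm⟩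
  have hsurj : Function.Surjective W₁ := by
    rw [← range_eq_univ, ← W₁.isometry.isClosedEmbedding.isClosed_range.closure_eq,
      ← dense_iff_closure_eq]
    refine hAd.mono ?_
    rintro _ ⟨x, rfl⟩
    exact ⟨B x, hWB x⟩
  refine ⟨LinearIsometryEquiv.ofSurjective W₁ hsurj, fun R ε hRA hR x => ?_⟩
  change R (W₀ x) = ε • W₀ (R x)
  -- `B` is a continuous function of `A* A`, so it commutes with `R`, while `A` may only do so up to
  -- `ε`.
  have hRB : Commute B R := hR.cfcₙ_nnreal _
  refine hBd.induction_on (p := fun x => R (W₀ x) = ε • W₀ (R x)) x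
    (isClosed_eq (by fun_prop) (by fun_prop)) fun y => ?_
  rw [hWB, ← mul_apply_eq_comp R B, ← hRB.eq, mul_apply_eq_comp, hWB, ← mul_apply_eq_comp R A, hRA]
  rfl

/-- A closed subspace is closed under weak limits. -/
theorem mem_of_tendsto_inner [CompleteSpace H] {M : Submodule ℂ H} (hM : IsClosed (M : Set H))
    {ι : Type*} {l : Filter ι} [l.NeBot] {u : ι → H} (hu : ∀ i, u i ∈ M) {z : H}
    (h : ∀ x, Tendsto (fun i => ⟪x, u i⟫_ℂ) l (𝓝 ⟪x, z⟫_ℂ)) : z ∈ M := by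
  have : CompleteSpace M := hM.completeSpace_coe
  rw [← M.orthogonal_orthogonal, Submodule.mem_orthogonal]
  intro x hx
  refine tendsto_nhds_unique (h x) (tendsto_const_nhds.congr fun i => ?_)
  exact ((Submodule.mem_orthogonal' _ _).1 hx _ (hu i)).symm

/-- A polynomial over `ℂ` is a product of linear factors, and each factor `V - a` is injective. -/
theorem aeval_injective_of_no_eigenvector {V : H →ₗ[ℂ] H}
    (hV : ∀ (a : ℂ) (x : H), V x = a • x → x = 0) (p : Polynomial ℂ) (hp : p ≠ 0) (x : H)
    (hx : Polynomial.aeval V p x = 0) : x = 0 := by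
  induction hn : p.natDegree generalizing p with
  | zero =>
    rw [Polynomial.eq_C_of_natDegree_eq_zero hn] at hx hp
    rw [Polynomial.aeval_C] at hx
    have hc : p.coeff 0 ≠ 0 := by simpa using hp
    exact (smul_eq_zero.1 (by simpa [Module.algebraMap_end_apply] using hx)).resolve_left hc
  | succ n ih =>
    obtain ⟨a, ha⟩ := IsAlgClosed.exists_root p (by
      rw [Polynomial.degree_eq_natDegree hp, hn]
      exact_mod_cast n.succ_ne_zero)
    obtain ⟨q, rfl⟩ := Polynomial.dvd_iff_isRoot.2 ha
    have hq : q ≠ 0 := right_ne_zero_of_mul hp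
    rw [Polynomial.natDegree_mul (left_ne_zero_of_mul hp) hq, Polynomial.natDegree_X_sub_C] at hn
    rw [map_mul, Module.End.mul_apply, map_sub, Polynomial.aeval_X, Polynomial.aeval_C,
      LinearMap.sub_apply, Module.algebraMap_end_apply, sub_eq_zero] at hx
    exact ih q hq (hV a _ hx) (by omega)

/-- If an injective operator leaves a closed subspace and its complement invariant, then a vector
whose image lies in the subspace lies in the subspace. -/
theorem mem_of_apply_mem [CompleteSpace H] {M : Submodule ℂ H} (hM : IsClosed (M : Set H))
    {A : H →ₗ[ℂ] H} (hA : ∀ x, A x = 0 → x = 0) (h1 : ∀ x ∈ M, A x ∈ M)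
    (h2 : ∀ x ∈ Mᗮ, A x ∈ Mᗮ) {e : H} (he : A e ∈ M) : e ∈ M := by
  have : CompleteSpace M := hM.completeSpace_coe
  -- The orthogonal component `z` of `e` has its image in both `M` and `Mᗮ`.
  obtain ⟨y, hy, z, hz, rfl⟩ := M.exists_add_mem_mem_orthogonal e
  have h3 : A z ∈ M := by
    have := M.sub_mem he (h1 y hy)
    rwa [map_add, add_sub_cancel_left] at this
  have h4 : z = 0 := hA z (inner_self_eq_zero.1
    ((Submodule.mem_orthogonal _ _).1 (h2 z hz) _ h3) : A z = 0)
  rwa [h4, add_zero]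

/-- A unitary operator with powers converging weakly to a scalar of modulus less than one has no
eigenvectors. -/
theorem no_eigenvector_of_tendsto {U : H ≃ₗᵢ[ℂ] H} {ι : Type*} {l : Filter ι} [l.NeBot]
    {κ : ι → ℤ} {c : ℂ} (hc : ‖c‖ < 1)
    (h : ∀ x y : H, Tendsto (fun i => ⟪x, (U ^ κ i) y⟫_ℂ) l (𝓝 (c * ⟪x, y⟫_ℂ))) (a : ℂ) (x : H)
    (hx : U x = a • x) : x = 0 := by
  by_contra hx0
  have ha : ‖a‖ = 1 := by
    have h1 := congrArg norm hx
    rw [LinearIsometryEquiv.norm_map, norm_smul] at h1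
    have := norm_ne_zero_iff.2 hx0
    field_simp at h1
    exact h1.symm
  have ha0 : a ≠ 0 := fun h => by simp [h] at ha
  have hpow : ∀ k : ℤ, (U ^ k) x = a ^ k • x := by
    intro k
    induction k using Int.induction_on with
    | zero => simp
    | succ n ih =>
      rw [unitary_zpow_add_apply, zpow_one, hx, map_smul, ih, smul_smul, zpow_add₀ ha0, zpow_one,
        mul_comm]
    | pred n ih =>
      have h1 : (U ^ (-1 : ℤ)) x = a⁻¹ • x := by
        rw [zpow_neg_one]
        change U.symm x = _
        rw [LinearIsometryEquiv.symm_apply_eq, map_smul, hx, smul_smul, inv_mul_cancel₀ ha0,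
          one_smul]
      rw [sub_eq_add_neg, unitary_zpow_add_apply, h1, map_smul, ih, smul_smul, zpow_add₀ ha0,
        zpow_neg_one, mul_comm]
  -- On an eigenvector `|⟪x, U ^ κ x⟫|` is constantly `‖x‖ ^ 2`, but the limit is `‖c‖ ‖x‖ ^ 2`.
  have hlim := (h x x).norm
  simp only [hpow, inner_smul_right, norm_mul, norm_zpow, ha, one_zpow, one_mul] at hlim
  have h1 := tendsto_nhds_unique hlim tendsto_const_nhds
  have h2 : ‖⟪x, x⟫_ℂ‖ ≠ 0 := norm_ne_zero_iff.2 (inner_self_ne_zero.2 hx0)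
  rw [mul_eq_right₀ h2] at h1
  linarith

/-- The closed cyclic subspace of a vector. -/
noncomputable def cyclicSubspace (U : H ≃ₗᵢ[ℂ] H) (f : H) : Submodule ℂ H :=
  (Submodule.span ℂ (range fun k : ℤ => (U ^ k) f)).topologicalClosure

theorem isClosed_cyclicSubspace (U : H ≃ₗᵢ[ℂ] H) (f : H) :
    IsClosed (cyclicSubspace U f : Set H) := Submodule.isClosed_topologicalClosure _

theorem zpow_mem_cyclicSubspace (U : H ≃ₗᵢ[ℂ] H) (f : H) (k : ℤ) :
    (U ^ k) f ∈ cyclicSubspace U f :=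
  Submodule.le_topologicalClosure _ (Submodule.subset_span ⟨k, rfl⟩)

theorem self_mem_cyclicSubspace (U : H ≃ₗᵢ[ℂ] H) (f : H) : f ∈ cyclicSubspace U f :=
  zpow_mem_cyclicSubspace U f 0

/-- A continuous linear map sends a closed span into a closed subspace if it does so for the
generators. -/
theorem map_mem_of_mem_closure_span {s : Set H} {M : Submodule ℂ H} (hM : IsClosed (M : Set H))
    (A : H →L[ℂ] H) (h : ∀ x ∈ s, A x ∈ M) {x : H}
    (hx : x ∈ (Submodule.span ℂ s).topologicalClosure) : A x ∈ M := by
  have h1 : Submodule.span ℂ s ≤ M.comap A.toLinearMap := Submodule.span_le.2 h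
  exact (Submodule.topologicalClosure_minimal _ h1 (hM.preimage A.continuous)) hx

theorem zpow_apply_mem_cyclicSubspace (U : H ≃ₗᵢ[ℂ] H) (f : H) (k : ℤ) {x : H}
    (hx : x ∈ cyclicSubspace U f) : (U ^ k) x ∈ cyclicSubspace U f := by
  refine map_mem_of_mem_closure_span (isClosed_cyclicSubspace U f)
    ((U ^ k).toContinuousLinearEquiv : H →L[ℂ] H) ?_ hx
  rintro _ ⟨l, rfl⟩
  change (U ^ k) ((U ^ l) f) ∈ _
  rw [← unitary_zpow_add_apply]
  exact zpow_mem_cyclicSubspace U f _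

end Hilbert

/-! ### The unitary representation of `ℤ × ℤ` on the square -/

namespace MeasureAut

variable {X : Type*} [MeasurableSpace X] {μ : Measure X} [SigmaFinite μ] (T : MeasureAut μ)

/-- The unitary operator `F(x, y) ↦ F(T ^ a x, T ^ b y)`. -/
noncomputable def squareOp (a b : ℤ) : Lp ℂ 2 (μ.prod μ) ≃ₗᵢ[ℂ] Lp ℂ 2 (μ.prod μ) :=
  ((T.zpow a).prod (T.zpow b)).koopman

theorem squareOp_add (a b c d : ℤ) (f : Lp ℂ 2 (μ.prod μ)) :
    T.squareOp (a + c) (b + d) f = T.squareOp a b (T.squareOp c d f) := by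
  refine (koopman_koopman (fun x => ?_) f).symm
  refine Prod.ext ?_ ?_
  · exact (congrArg (fun k => (T.zpow k).toEquiv x.1) (add_comm a c)).trans
      (T.zpow_add_apply c a x.1)
  · exact (congrArg (fun k => (T.zpow k).toEquiv x.2) (add_comm b d)).trans
      (T.zpow_add_apply d b x.2)

theorem squareOp_zero (f : Lp ℂ 2 (μ.prod μ)) : T.squareOp 0 0 f = f :=
  koopman_eq_self (fun _ => rfl) f

/-- The representation along a line. -/
noncomputable def squareHom (a b : ℤ) :
    Multiplicative ℤ →* (Lp ℂ 2 (μ.prod μ) ≃ₗᵢ[ℂ] Lp ℂ 2 (μ.prod μ)) where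
  toFun k := T.squareOp (k.toAdd * a) (k.toAdd * b)
  map_one' := LinearIsometryEquiv.ext fun f => by
    simpa using T.squareOp_zero f
  map_mul' k l := LinearIsometryEquiv.ext fun f => by
    rw [toAdd_mul, add_mul, add_mul, squareOp_add]
    rfl

theorem squareOp_zpow (a b k : ℤ) : T.squareOp a b ^ k = T.squareOp (k * a) (k * b) := by
  have h1 : T.squareOp a b = T.squareHom a b (Multiplicative.ofAdd 1) := by
    simp [squareHom]
  rw [h1, ← map_zpow, ← ofAdd_zsmul]
  simp [squareHom]

theorem squareOp_neg_apply_apply (a b : ℤ) (f : Lp ℂ 2 (μ.prod μ)) :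
    T.squareOp (-a) (-b) (T.squareOp a b f) = f := by
  rw [← squareOp_add, neg_add_cancel, neg_add_cancel, squareOp_zero]

theorem inner_squareOp_left (a b : ℤ) (f g : Lp ℂ 2 (μ.prod μ)) :
    ⟪T.squareOp a b f, g⟫_ℂ = ⟪f, T.squareOp (-a) (-b) g⟫_ℂ := by
  rw [← LinearIsometryEquiv.inner_map_map (T.squareOp (-a) (-b)), squareOp_neg_apply_apply]

/-- The exchange of coordinates. -/
def swap (μ : Measure X) [SigmaFinite μ] : MeasureAut (μ.prod μ) where
  toEquiv := MeasurableEquiv.prodComm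
  preserves := Measure.measurePreserving_swap

theorem swap_swap (f : Lp ℂ 2 (μ.prod μ)) : (swap μ).koopman ((swap μ).koopman f) = f :=
  (koopman_koopman (R := (swap μ).zpow 0) (fun _ => rfl) f).trans
    (koopman_eq_self (fun _ => rfl) f)

theorem swap_squareOp (a b : ℤ) (f : Lp ℂ 2 (μ.prod μ)) :
    (swap μ).koopman (T.squareOp a b f) = T.squareOp b a ((swap μ).koopman f) := by
  let R : MeasureAut (μ.prod μ) :=
    { toEquiv := (swap μ).toEquiv.trans ((T.zpow a).prod (T.zpow b)).toEquiv
      preserves := ((T.zpow a).prod (T.zpow b)).preserves.comp (swap μ).preserves }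
  exact (koopman_koopman (R := R) (fun _ => rfl) f).trans
    (koopman_koopman (R := R) (fun _ => rfl) f).symm

end MeasureAut

/-! ### Indicators of products of levels in `L²` of the square -/

namespace StackData

variable (S : StackData)

/-- The correlation of two levels. -/
noncomputable def corr (k : ℤ) (p q : ℕ × ℤ) : ℝ :=
  S.measure.real (S.level p.1 p.2 ∩ S.translate k ⁻¹' S.level q.1 q.2)

/-- The Hilbert space of the square of the phase space. -/
abbrev SquareL2 : Type := Lp ℂ 2 (S.measure.prod S.measure)

theorem measure_prod_level_ne_top (p q : ℕ × ℤ) :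
    (S.measure.prod S.measure) (S.level p.1 p.2 ×ˢ S.level q.1 q.2) ≠ ∞ := by
  rw [Measure.prod_prod]
  exact ENNReal.mul_ne_top (S.measure_level_ne_top _ _) (S.measure_level_ne_top _ _)

theorem measurableSet_prod_level (p q : ℕ × ℤ) :
    MeasurableSet (S.level p.1 p.2 ×ˢ S.level q.1 q.2) :=
  (S.measurableSet_level _ _).prod (S.measurableSet_level _ _)

/-- The indicator function of a product of two levels. -/
noncomputable def rect (p q : ℕ × ℤ) : S.SquareL2 :=
  indicatorConstLp 2 (S.measurableSet_prod_level p q) (S.measure_prod_level_ne_top p q) (1 : ℂ)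

/-- The operator `T ^ a ⊗ T ^ b`. -/
noncomputable abbrev op (a b : ℤ) : S.SquareL2 ≃ₗᵢ[ℂ] S.SquareL2 := S.aut.squareOp a b

theorem inner_rect_op_rect (p q p' q' : ℕ × ℤ) (a b : ℤ) :
    ⟪S.rect p q, S.op a b (S.rect p' q')⟫_ℂ = ((S.corr a p p' * S.corr b q q' : ℝ) : ℂ) := by
  have hfin : (S.measure.prod S.measure) (((S.aut.zpow a).prod (S.aut.zpow b)).toEquiv ⁻¹'
      (S.level p'.1 p'.2 ×ˢ S.level q'.1 q'.2)) ≠ ∞ := by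
    rw [((S.aut.zpow a).prod (S.aut.zpow b)).preserves.measure_preimage
      (S.measurableSet_prod_level p' q').nullMeasurableSet]
    exact S.measure_prod_level_ne_top p' q'
  refine (L2.inner_indicatorConstLp_one_indicatorConstLp_one (S.measurableSet_prod_level p q)
    ((S.measurableSet_prod_level p' q').preimage
      ((S.aut.zpow a).prod (S.aut.zpow b)).preserves.measurable)
    (S.measure_prod_level_ne_top p q) hfin).trans ?_
  have h2 : (S.level p.1 p.2 ×ˢ S.level q.1 q.2) ∩ (((S.aut.zpow a).prod (S.aut.zpow b)).toEquiv ⁻¹'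
      (S.level p'.1 p'.2 ×ˢ S.level q'.1 q'.2))
      = (S.level p.1 p.2 ∩ S.translate a ⁻¹' S.level p'.1 p'.2) ×ˢ
        (S.level q.1 q.2 ∩ S.translate b ⁻¹' S.level q'.1 q'.2) := by
    ext x
    have h3 : ((S.aut.zpow a).prod (S.aut.zpow b)).toEquiv x
        = (S.translate a x.1, S.translate b x.2) :=
      Prod.ext (S.aut_zpow_apply a x.1) (S.aut_zpow_apply b x.2)
    simp only [mem_inter_iff, mem_prod, mem_preimage, h3]
    tauto
  congr 1
  rw [h2, measureReal_prod_prod]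
  rfl

theorem inner_rect_eq_setIntegral (p q : ℕ × ℤ) (f : S.SquareL2) : ⟪S.rect p q, f⟫_ℂ
    = ∫ x in S.level p.1 p.2 ×ˢ S.level q.1 q.2, f x ∂(S.measure.prod S.measure) :=
  L2.inner_indicatorConstLp_one _ _ f

theorem rect_ne_zero : S.rect (0, 0) (0, 0) ≠ 0 := by
  intro h
  have h1 := S.inner_rect_op_rect (0, 0) (0, 0) (0, 0) (0, 0) 0 0
  have h2 : S.corr 0 (0, 0) (0, 0) = 1 := by
    have h3 : S.translate 0 ⁻¹' S.level 0 0 = S.level 0 0 := by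
      ext x
      rw [mem_preimage, translate_zero]
    rw [corr, h3, inter_self, measureReal_def, S.measure_level (by simp [S.m_zero])]
    simp
  rw [h, inner_zero_left, h2] at h1
  norm_num at h1

theorem integrableOn_rect (p q : ℕ × ℤ) (f : S.SquareL2) :
    IntegrableOn f (S.level p.1 p.2 ×ˢ S.level q.1 q.2) (S.measure.prod S.measure) :=
  integrableOn_Lp_of_measure_ne_top f fact_one_le_two_ennreal.elim
    (S.measure_prod_level_ne_top p q)

theorem rect_split_left {i : ℕ} {g : ℤ} (hg : |g| ≤ S.m i) (q : ℕ × ℤ) :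
    S.rect (i, g) q = ∑ a, S.rect (i + 1, g + S.P i a) q := by
  refine ext_inner_right ℂ fun f => ?_
  rw [sum_inner]
  simp only [inner_rect_eq_setIntegral]
  rw [S.level_eq_iUnion hg, iUnion_prod_const, integral_iUnion_fintype
    (fun a => S.measurableSet_prod_level (i + 1, g + S.P i a) q)
    (fun a b hab => Set.disjoint_prod.2 (Or.inl (S.sublevel_disjoint g hab)))
    (fun a => S.integrableOn_rect (i + 1, g + S.P i a) q f)]

theorem swap_rect (p q : ℕ × ℤ) :
    (MeasureAut.swap S.measure).koopman (S.rect p q) = S.rect q p := by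
  have h1 : (MeasureAut.swap S.measure).koopman (S.rect p q) = indicatorConstLp 2
      ((S.measurableSet_prod_level p q).preimage (MeasureAut.swap S.measure).preserves.measurable)
      (by
        rw [(MeasureAut.swap S.measure).preserves.measure_preimage
          (S.measurableSet_prod_level p q).nullMeasurableSet]
        exact S.measure_prod_level_ne_top p q) (1 : ℂ) := rfl
  rw [h1, rect]
  congr 1
  ext x
  exact and_comm

theorem rect_split_right {i : ℕ} {g : ℤ} (hg : |g| ≤ S.m i) (p : ℕ × ℤ) :
    S.rect p (i, g) = ∑ a, S.rect p (i + 1, g + S.P i a) := by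
  rw [← swap_rect, S.rect_split_left hg, map_sum]
  exact Finset.sum_congr rfl fun a _ => S.swap_rect _ _

theorem op_rect {i j : ℕ} {f g a b : ℤ} (hf : |f| ≤ S.m i) (hg : |g| ≤ S.m j)
    (ha : |f - a| ≤ S.m i) (hb : |g - b| ≤ S.m j) :
    S.op a b (S.rect (i, f) (j, g)) = S.rect (i, f - a) (j, g - b) := by
  have h1 : S.op a b (S.rect (i, f) (j, g)) = indicatorConstLp 2
      ((S.measurableSet_prod_level (i, f) (j, g)).preimage
        ((S.aut.zpow a).prod (S.aut.zpow b)).preserves.measurable)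
      (by
        rw [((S.aut.zpow a).prod (S.aut.zpow b)).preserves.measure_preimage
          (S.measurableSet_prod_level (i, f) (j, g)).nullMeasurableSet]
        exact S.measure_prod_level_ne_top (i, f) (j, g)) (1 : ℂ) := rfl
  rw [h1, rect]
  congr 1
  rw [← S.preimage_translate_level hf ha, ← S.preimage_translate_level hg hb]
  ext x
  have h3 : ((S.aut.zpow a).prod (S.aut.zpow b)).toEquiv x
      = (S.translate a x.1, S.translate b x.2) :=
    Prod.ext (S.aut_zpow_apply a x.1) (S.aut_zpow_apply b x.2)
  simp only [mem_prod, mem_preimage, h3]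

theorem exists_levelSeq : ∃ e : ℕ → ℕ × ℤ, Function.Surjective e :=
  exists_surjective_nat _

theorem isCountablySpanning_levels : IsCountablySpanning S.levels := by
  obtain ⟨e, he⟩ := exists_levelSeq
  refine ⟨fun n => S.level (e n).1 (e n).2, fun n => S.level_mem_levels _ _, ?_⟩
  refine eq_univ_of_forall fun x => ?_
  obtain ⟨_, ⟨p, rfl⟩, hx⟩ := mem_sUnion.1 (S.sUnion_levels.symm ▸ mem_univ x)
  obtain ⟨n, rfl⟩ := he p
  exact mem_iUnion.2 ⟨n, hx⟩

/-- The products of levels have dense span. -/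
theorem eq_zero_of_inner_rect_eq_zero {f : S.SquareL2} (hf : ∀ p q, ⟪S.rect p q, f⟫_ℂ = 0) :
    f = 0 := by
  simp only [inner_rect_eq_setIntegral] at hf
  have hgen : (inferInstance : MeasurableSpace (S.Space × S.Space))
      = MeasurableSpace.generateFrom (image2 (· ×ˢ ·) S.levels S.levels) :=
    (generateFrom_eq_prod S.measurableSpace_eq_generateFrom.symm
      S.measurableSpace_eq_generateFrom.symm S.isCountablySpanning_levels
      S.isCountablySpanning_levels).symm
  have hpi := S.isPiSystem_levels.prod S.isPiSystem_levels
  have hzero : ∀ p q : ℕ × ℤ, ∀ᵐ x ∂(S.measure.prod S.measure),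
      x ∈ S.level p.1 p.2 ×ˢ S.level q.1 q.2 → f x = 0 := by
    intro p q
    set R := S.level p.1 p.2 ×ˢ S.level q.1 q.2 with hR
    have hRm : MeasurableSet R := S.measurableSet_prod_level p q
    have hint : IntegrableOn f R (S.measure.prod S.measure) := S.integrableOn_rect p q f
    have hRmem : R ∈ image2 (· ×ˢ ·) S.levels S.levels :=
      ⟨_, S.level_mem_levels _ _, _, S.level_mem_levels _ _, rfl⟩
    rw [← ae_restrict_iff' hRm]
    refine Integrable.ae_eq_zero_of_forall_setIntegral_eq_zero hint fun s hs _ => ?_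
    induction s, hs using MeasurableSpace.induction_on_inter hgen hpi with
    | empty => simp
    | basic t ht =>
      have htm : MeasurableSet t := by
        have : MeasurableSet[MeasurableSpace.generateFrom
          (image2 (· ×ˢ ·) S.levels S.levels)] t := MeasurableSpace.measurableSet_generateFrom ht
        rwa [← hgen] at this
      rw [Measure.restrict_restrict htm]
      rcases (t ∩ R).eq_empty_or_nonempty with h | h
      · simp [h]
      · obtain ⟨_, ⟨p', rfl⟩, _, ⟨q', rfl⟩, h'⟩ := hpi _ ht _ hRmem h
        rw [← h']
        exact hf p' q'
    | compl t ht ih =>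
      have := integral_add_compl ht hint
      rwa [ih (lt_of_le_of_lt (measure_mono (subset_univ _)) (by
        rw [Measure.restrict_apply_univ]
        exact (S.measure_prod_level_ne_top p q).lt_top)), zero_add, hf p q] at this
    | iUnion t hd ht ih =>
      rw [integral_iUnion ht hd hint.integrableOn]
      refine (tsum_congr fun n => ih n (lt_of_le_of_lt (measure_mono (subset_univ _)) (by
        rw [Measure.restrict_apply_univ]
        exact (S.measure_prod_level_ne_top p q).lt_top))).trans tsum_zero
  refine (Lp.eq_zero_iff_ae_eq_zero).2 ?_
  filter_upwards [ae_all_iff.2 fun p => ae_all_iff.2 fun q => hzero p q] with x hx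
  obtain ⟨_, ⟨p, rfl⟩, hp⟩ := mem_sUnion.1 (S.sUnion_levels.symm ▸ mem_univ x.1)
  obtain ⟨_, ⟨q, rfl⟩, hq⟩ := mem_sUnion.1 (S.sUnion_levels.symm ▸ mem_univ x.2)
  exact hx p q ⟨hp, hq⟩

theorem closure_span_rect :
    (Submodule.span ℂ (range fun p : (ℕ × ℤ) × (ℕ × ℤ) => S.rect p.1 p.2)).topologicalClosure
      = ⊤ := by
  rw [Submodule.topologicalClosure_eq_top_iff, Submodule.eq_bot_iff]
  exact fun f hf => S.eq_zero_of_inner_rect_eq_zero fun p q =>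
    (Submodule.mem_orthogonal _ _).1 hf _ (Submodule.subset_span ⟨(p, q), rfl⟩)

end StackData

/-! ### Weak limits of unitary operators -/

section WeakLimit

open Filter Topology

variable {H : Type*} [NormedAddCommGroup H] [InnerProductSpace ℂ H]

/-- Weak operator convergence of unitary operators. -/
def WeakLimit {ι : Type*} (l : Filter ι) (V : ι → H ≃ₗᵢ[ℂ] H) (Q : H →L[ℂ] H) : Prop :=
  ∀ u v : H, Tendsto (fun i => ⟪u, V i v⟫_ℂ) l (𝓝 ⟪u, Q v⟫_ℂ)

variable {ι : Type*} {l : Filter ι} {V : ι → H ≃ₗᵢ[ℂ] H} {Q : H →L[ℂ] H}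

/-- Weak operator convergence may be checked on a set with dense span. -/
theorem weakLimit_of_closure_span_eq_top {s : Set H}
    (hs : (Submodule.span ℂ s).topologicalClosure = ⊤)
    (h : ∀ u ∈ s, ∀ v ∈ s, Tendsto (fun i => ⟪u, V i v⟫_ℂ) l (𝓝 ⟪u, Q v⟫_ℂ)) :
    WeakLimit l V Q := by
  have h1 : ∀ v ∈ s, ∀ u, Tendsto (fun i => ⟪u, V i v⟫_ℂ) l (𝓝 ⟪u, Q v⟫_ℂ) := by
    intro v hv u
    have hcl : IsClosed {u | Tendsto (fun i => ⟪u, V i v⟫_ℂ) l (𝓝 ⟪u, Q v⟫_ℂ)} := by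
      refine isClosed_setOf_tendsto_of_lipschitz (C := max ‖v‖ ‖Q v‖) (fun i x y => ?_)
        fun x y => ?_
      · rw [← inner_sub_left, mul_comm]
        refine (norm_inner_le_norm _ _).trans ?_
        rw [LinearIsometryEquiv.norm_map]
        gcongr
        exact le_max_left _ _
      · rw [← inner_sub_left, mul_comm]
        refine (norm_inner_le_norm _ _).trans ?_
        gcongr
        exact le_max_right _ _
    have hu : u ∈ (Submodule.span ℂ s).topologicalClosure := hs ▸ Submodule.mem_top
    refine hcl.closure_subset_iff.2 (fun u hu => ?_) hu
    induction hu using Submodule.span_induction with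
    | mem u hu => exact h u hu v hv
    | zero => simpa using tendsto_const_nhds
    | add x y _ _ hx hy =>
      rw [mem_ofPred_eq] at hx hy ⊢
      simpa only [inner_add_left] using hx.add hy
    | smul c x _ hx =>
      rw [mem_ofPred_eq] at hx ⊢
      simpa only [inner_smul_left] using hx.const_mul _
  intro u v
  have hcl : IsClosed {v | Tendsto (fun i => ⟪u, V i v⟫_ℂ) l (𝓝 ⟪u, Q v⟫_ℂ)} := by
    refine isClosed_setOf_tendsto_of_lipschitz (C := ‖u‖ * max 1 ‖Q‖) (fun i x y => ?_)
      fun x y => ?_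
    · rw [← inner_sub_right, ← map_sub, mul_assoc]
      refine (norm_inner_le_norm _ _).trans ?_
      rw [LinearIsometryEquiv.norm_map]
      gcongr
      exact le_mul_of_one_le_left (norm_nonneg _) (le_max_left _ _)
    · rw [← inner_sub_right, ← map_sub, mul_assoc]
      refine (norm_inner_le_norm _ _).trans ?_
      gcongr
      refine (Q.le_opNorm _).trans ?_
      gcongr
      exact le_max_right _ _
  have hv : v ∈ (Submodule.span ℂ s).topologicalClosure := hs ▸ Submodule.mem_top
  refine hcl.closure_subset_iff.2 (fun v hv => ?_) hv
  induction hv using Submodule.span_induction with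
  | mem v hv => exact h1 v hv u
  | zero => simpa using tendsto_const_nhds
  | add x y _ _ hx hy =>
    rw [mem_ofPred_eq] at hx hy ⊢
    simpa only [map_add, inner_add_right] using hx.add hy
  | smul c x _ hx =>
    rw [mem_ofPred_eq] at hx ⊢
    simpa only [map_smul, inner_smul_right] using hx.const_mul _

theorem WeakLimit.apply_mem [CompleteSpace H] [l.NeBot] (h : WeakLimit l V Q) {M : Submodule ℂ H}
    (hM : IsClosed (M : Set H)) (hV : ∀ i, ∀ x ∈ M, V i x ∈ M) {x : H} (hx : x ∈ M) : Q x ∈ M :=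
  mem_of_tendsto_inner hM (fun i => hV i x hx) fun u => h u x

theorem WeakLimit.adjoint [CompleteSpace H] (h : WeakLimit l V Q) :
    WeakLimit l (fun i => (V i)⁻¹) Q.adjoint := by
  intro u v
  rw [ContinuousLinearMap.adjoint_inner_right, ← inner_conj_symm]
  refine ((continuous_star.tendsto _).comp (h v u)).congr fun i => ?_
  change starRingEnd ℂ ⟪v, V i u⟫_ℂ = _
  rw [inner_conj_symm, ← LinearIsometryEquiv.inner_map_map (V i) u]
  congr 1
  exact ((V i).apply_symm_apply v).symm

end WeakLimit

/-! ### Weak limits obtained from correlations of levels -/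

namespace StackData

open Filter Topology

variable (S : StackData)

/-- `T ^ a ⊗ T ^ b` as a bounded operator. -/
noncomputable def opL (a b : ℤ) : S.SquareL2 →L[ℂ] S.SquareL2 :=
  ((S.op a b).toContinuousLinearEquiv : S.SquareL2 →L[ℂ] S.SquareL2)

theorem opL_apply (a b : ℤ) (x : S.SquareL2) : S.opL a b x = S.op a b x := rfl

theorem op_op (a b c d : ℤ) (x : S.SquareL2) : S.op a b (S.op c d x) = S.op (a + c) (b + d) x :=
  (S.aut.squareOp_add a b c d x).symm

theorem op_zero (x : S.SquareL2) : S.op 0 0 x = x := S.aut.squareOp_zero x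

theorem opL_mul (a b c d : ℤ) : S.opL a b * S.opL c d = S.opL (a + c) (b + d) :=
  ContinuousLinearMap.ext fun x => S.op_op a b c d x

theorem opL_adjoint (a b : ℤ) : (S.opL a b).adjoint = S.opL (-a) (-b) := by
  rw [eq_comm, ContinuousLinearMap.eq_adjoint_iff]
  intro x y
  rw [opL_apply, opL_apply, MeasureAut.inner_squareOp_left, neg_neg, neg_neg]

/-- Along `l`, the correlations of levels at the times `κ` agree eventually with `x` times the ones
at time `0` plus `y` times the ones at time `-1`. -/
def CorrLimit (l : Filter ℕ) (κ : ℕ → ℤ) (x y : ℝ) : Prop :=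
  ∀ p q : ℕ × ℤ, ∀ᶠ j in l, S.corr (κ j) p q = x * S.corr 0 p q + y * S.corr (-1) p q

variable {S} in
-- Inner products of rectangles factor into correlations, so the limit is `(x + y T⁻¹) ⊗ (x' + y'
-- T⁻¹)`, checked on rectangles, which have dense span.
theorem CorrLimit.weakLimit {l : Filter ℕ} {κ η : ℕ → ℤ} {x y x' y' : ℝ}
    (h : S.CorrLimit l κ x y) (h' : S.CorrLimit l η x' y') :
    WeakLimit l (fun j => S.op (κ j) (η j))
      (((x * x' : ℝ) : ℂ) • S.opL 0 0 + ((x * y' : ℝ) : ℂ) • S.opL 0 (-1)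
        + ((y * x' : ℝ) : ℂ) • S.opL (-1) 0 + ((y * y' : ℝ) : ℂ) • S.opL (-1) (-1)) := by
  refine weakLimit_of_closure_span_eq_top S.closure_span_rect ?_
  rintro _ ⟨⟨p, q⟩, rfl⟩ _ ⟨⟨p', q'⟩, rfl⟩
  refine tendsto_const_nhds.congr' ?_
  filter_upwards [h p p', h' q q'] with j h1 h2
  simp only [add_apply, smul_apply, inner_add_right, inner_smul_right, opL_apply,
    inner_rect_op_rect, h1, h2]
  push_cast
  ring

theorem corrLimit_zero (l : Filter ℕ) : S.CorrLimit l (fun _ => 0) 1 0 :=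
  fun p q => Eventually.of_forall fun _ => by simp

theorem corr_neg (k : ℤ) (p q : ℕ × ℤ) : S.corr (-k) p q = S.corr k q p := by
  rw [corr, corr, measureReal_def, measureReal_def]
  congr 1
  rw [← (S.measurePreserving_translate k).measure_preimage
    (((S.measurableSet_level p.1 p.2).inter ((S.measurableSet_level q.1 q.2).preimage
      (S.measurePreserving_translate (-k)).measurable)).nullMeasurableSet)]
  congr 1
  ext x
  simp only [mem_preimage, mem_inter_iff, ← S.translate_add, neg_add_cancel, S.translate_zero]
  exact and_comm

variable {S} in
theorem CorrLimit.neg {l : Filter ℕ} {κ : ℕ → ℤ} {x : ℝ} (h : S.CorrLimit l κ x 0) :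
    S.CorrLimit l (fun j => -κ j) x 0 := by
  intro p q
  filter_upwards [h q p] with j hj
  rw [corr_neg, hj, ← neg_zero (G := ℤ), corr_neg, neg_zero]
  simp

/-! ### Invariant subspaces -/

/-- Both coordinate shifts have no eigenvectors. -/
def NoEigenvector : Prop :=
  ∀ (a : ℂ) (x : S.SquareL2), (S.op (-1) 0 x = a • x → x = 0) ∧ (S.op 0 (-1) x = a • x → x = 0)

theorem op_iterate (a b : ℤ) (n : ℕ) (x : S.SquareL2) :
    (S.op a b)^[n] x = S.op (n * a) (n * b) x := by
  induction n with
  | zero => simp [op_zero]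
  | succ n ih =>
    rw [Function.iterate_succ_apply', ih, op_op]
    push_cast
    congr 2 <;> ring

theorem sum_op_injective {c d : ℤ}
    (hV : ∀ (a : ℂ) (x : S.SquareL2), S.op c d x = a • x → x = 0) (n : Fin 4 → ℕ) (x : S.SquareL2)
    (hx : ∑ a, S.op (n a * c) (n a * d) x = 0) : x = 0 := by
  let V : S.SquareL2 →ₗ[ℂ] S.SquareL2 := (S.op c d).toLinearEquiv
  refine aeval_injective_of_no_eigenvector (V := V) hV (∑ a, Polynomial.X ^ n a) ?_ x ?_
  · intro h
    -- A sum of four monomials has the value `4` at `1`, even if exponents coincide.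
    have := congrArg (Polynomial.eval 1) h
    simp [Polynomial.eval_finsetSum] at this
  · rw [map_sum, LinearMap.sum_apply]
    simp only [map_pow, Polynomial.aeval_X, Module.End.pow_apply]
    rw [← hx]
    exact Finset.sum_congr rfl fun a _ => S.op_iterate c d (n a) x

theorem op_mem_orthogonal {M : Submodule ℂ S.SquareL2} (hop : ∀ a b, ∀ x ∈ M, S.op a b x ∈ M)
    (a b : ℤ) {x : S.SquareL2} (hx : x ∈ Mᗮ) : S.op a b x ∈ Mᗮ := by
  rw [Submodule.mem_orthogonal'] at hx ⊢
  intro y hy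
  rw [MeasureAut.inner_squareOp_left]
  exact hx _ (hop _ _ y hy)

theorem mem_of_sum_op_mem {M : Submodule ℂ S.SquareL2} (hM : IsClosed (M : Set S.SquareL2))
    (hop : ∀ a b, ∀ x ∈ M, S.op a b x ∈ M) {c d : ℤ}
    (hV : ∀ (a : ℂ) (x : S.SquareL2), S.op c d x = a • x → x = 0) (n : Fin 4 → ℕ) {x : S.SquareL2}
    (hx : ∑ a, S.op (n a * c) (n a * d) x ∈ M) : x ∈ M := by
  let A : S.SquareL2 →ₗ[ℂ] S.SquareL2 := ∑ a, (S.opL (n a * c) (n a * d)).toLinearMap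
  have hA : ∀ x, A x = ∑ a, S.op (n a * c) (n a * d) x := fun x => by
    simp [A, LinearMap.sum_apply, opL_apply]
  refine mem_of_apply_mem hM (A := A) (fun x hx => ?_) (fun x hx => ?_) (fun x hx => ?_) ?_
  · exact S.sum_op_injective hV n x (by rwa [← hA])
  · rw [hA]
    exact M.sum_mem fun a _ => hop _ _ x hx
  · rw [hA]
    exact Submodule.sum_mem _ fun a _ => S.op_mem_orthogonal hop _ _ hx
  · rwa [hA]

/-- Shifts reach all rectangles with both levels in one tower. A rectangle with levels of different
towers is a sum of such ones after both levels are subdivided to a common tower. -/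
theorem rect_mem_of_diag {M : Submodule ℂ S.SquareL2} (hop : ∀ a b, ∀ x ∈ M, S.op a b x ∈ M)
    (hdiag : ∀ j, S.rect (j, 0) (j, 0) ∈ M) (p q : ℕ × ℤ) : S.rect p q ∈ M := by
  have hempty : ∀ p q : ℕ × ℤ, ¬ |p.2| ≤ S.m p.1 → S.rect p q = 0 := by
    intro p q h
    refine ext_inner_right ℂ fun f => ?_
    rw [inner_rect_eq_setIntegral, S.level_eq_empty h]
    simp
  have hsame : ∀ j f g, S.rect (j, f) (j, g) ∈ M := by
    intro j f g
    by_cases hf : |f| ≤ S.m j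
    · by_cases hg : |g| ≤ S.m j
      · have h0 : |(0 : ℤ)| ≤ S.m j := by simpa using S.m_nonneg j
        have := hop (-f) (-g) _ (hdiag j)
        rwa [S.op_rect h0 h0 (by simpa using hf) (by simpa using hg), zero_sub, zero_sub, neg_neg,
          neg_neg] at this
      · rw [← S.swap_rect, hempty _ _ hg, map_zero]
        exact M.zero_mem
    · rw [hempty _ _ hf]
      exact M.zero_mem
  have hleft : ∀ n i f q, (∀ g, S.rect (i + n, g) q ∈ M) → S.rect (i, f) q ∈ M := by
    intro n
    induction n with
    | zero => intro i f q h; exact h f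
    | succ n ih =>
      intro i f q h
      by_cases hf : |f| ≤ S.m i
      · rw [S.rect_split_left hf]
        refine M.sum_mem fun a _ => ih (i + 1) _ q fun g => ?_
        rw [add_right_comm]
        exact h g
      · rw [hempty _ _ hf]
        exact M.zero_mem
  have hright : ∀ n i f q, (∀ g, S.rect q (i + n, g) ∈ M) → S.rect q (i, f) ∈ M := by
    intro n
    induction n with
    | zero => intro i f q h; exact h f
    | succ n ih =>
      intro i f q h
      by_cases hf : |f| ≤ S.m i
      · rw [S.rect_split_right hf]
        refine M.sum_mem fun a _ => ih (i + 1) _ q fun g => ?_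
        rw [add_right_comm]
        exact h g
      · rw [← S.swap_rect, hempty _ _ hf, map_zero]
        exact M.zero_mem
  obtain ⟨i, f⟩ := p
  obtain ⟨j, g⟩ := q
  refine hleft j i f _ fun f' => hright i j g _ fun g' => ?_
  rw [add_comm j i]
  exact hsame _ _ _

/-- The indicator of the central level of a tower is `∑ a, T ^ (-P j a)` applied to that of the next
tower, a polynomial in `T⁻¹`. In either coordinate this polynomial is injective and preserves `M`
and `Mᗮ`, so membership in `M` climbs from one tower to the next, one coordinate at a time. -/
theorem eq_top_of_op_mem (hne : S.NoEigenvector) {M : Submodule ℂ S.SquareL2}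
    (hM : IsClosed (M : Set S.SquareL2)) (hop : ∀ a b, ∀ x ∈ M, S.op a b x ∈ M)
    (h0 : S.rect (0, 0) (0, 0) ∈ M) : M = ⊤ := by
  have hcast : ∀ j a, ((S.P j a).toNat : ℤ) = S.P j a := fun j a =>
    Int.toNat_of_nonneg (S.P_nonneg j a)
  have hz : ∀ j, |(0 : ℤ)| ≤ S.m j := fun j => by simpa using S.m_nonneg j
  have hP : ∀ j a, |0 + S.P j a| ≤ S.m (j + 1) := fun j a => S.abs_add_P_le (hz j) a
  have hdiag : ∀ j, S.rect (j, 0) (j, 0) ∈ M := by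
    intro j
    induction j with
    | zero => exact h0
    | succ j ih =>
      have h1 : S.rect (j + 1, 0) (j, 0) ∈ M := by
        refine S.mem_of_sum_op_mem hM hop (fun a x => (hne a x).1) (fun a => (S.P j a).toNat) ?_
        rw [S.rect_split_left (hz j)] at ih
        convert ih using 2 with a
        rw [S.op_rect (hz _) (hz _) (by simpa [hcast] using hP j a) (by simpa using S.m_nonneg j)]
        simp [hcast]
      refine S.mem_of_sum_op_mem hM hop (fun a x => (hne a x).2) (fun a => (S.P j a).toNat) ?_
      rw [S.rect_split_right (hz j)] at h1
      convert h1 using 2 with a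
      rw [S.op_rect (hz _) (hz _) (by simpa using S.m_nonneg (j + 1)) (by simpa [hcast] using hP j a)]
      simp [hcast]
  rw [eq_top_iff, ← S.closure_span_rect]
  refine Submodule.topologicalClosure_minimal _ (Submodule.span_le.2 ?_) hM
  rintro _ ⟨p, rfl⟩
  exact S.rect_mem_of_diag hop hdiag p.1 p.2

end StackData

/-! ### Spectral consequences of limits of correlations -/

namespace StackData

open Filter Topology

variable {S : StackData}

theorem CorrLimit.tendsto_inner {l : Filter ℕ} {κ : ℕ → ℤ} {a b : ℤ} {x x' : ℝ}
    (h : S.CorrLimit l (fun j => a * κ j) x 0) (h' : S.CorrLimit l (fun j => b * κ j) x' 0)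
    (u v : S.SquareL2) :
    Tendsto (fun j => ⟪u, (S.op a b ^ κ j) v⟫_ℂ) l (𝓝 (((x * x' : ℝ) : ℂ) * ⟪u, v⟫_ℂ)) := by
  have h1 := h.weakLimit h' u v
  simp only [mul_zero, zero_mul, Complex.ofReal_zero, zero_smul, add_zero, smul_apply,
    inner_smul_right, opL_apply, op_zero] at h1
  refine h1.congr fun j => ?_
  rw [MeasureAut.squareOp_zpow, mul_comm a, mul_comm b]

theorem no_eigenvector_op {l : Filter ℕ} [l.NeBot] {κ : ℕ → ℤ} {a b : ℤ} {x x' : ℝ}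
    (h : S.CorrLimit l (fun j => a * κ j) x 0) (h' : S.CorrLimit l (fun j => b * κ j) x' 0)
    (hx : |x * x'| < 1) (c : ℂ) (v : S.SquareL2) (hv : S.op a b v = c • v) : v = 0 :=
  no_eigenvector_of_tendsto (by rwa [Complex.norm_real]) (h.tendsto_inner h') c v hv

theorem noEigenvector_of_corrLimit {l : Filter ℕ} [l.NeBot] {κ : ℕ → ℤ} {x : ℝ}
    (h : S.CorrLimit l κ x 0) (hx : |x| < 1) : S.NoEigenvector := by
  have h1 : S.CorrLimit l (fun j => (-1) * κ j) x 0 := by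
    simpa only [neg_one_mul] using h.neg
  have h0 : S.CorrLimit l (fun j => 0 * κ j) 1 0 := by
    simpa only [zero_mul] using S.corrLimit_zero l
  exact fun c v => ⟨no_eigenvector_op h1 h0 (by rwa [mul_one]) c v,
    no_eigenvector_op h0 h1 (by rwa [one_mul]) c v⟩

theorem hasSingularSpectrum_op {l : Filter ℕ} [l.NeBot] {κ : ℕ → ℤ} {a b : ℤ} {x x' : ℝ}
    (hκ : Tendsto κ l cofinite)
    (h : S.CorrLimit l (fun j => a * κ j) x 0) (h' : S.CorrLimit l (fun j => b * κ j) x' 0)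
    (hx : x ≠ 0) (hx' : x' ≠ 0) : HasSingularSpectrum (S.op a b) :=
  hasSingularSpectrum_of_tendsto hκ (Complex.ofReal_ne_zero.2 (mul_ne_zero hx hx'))
    (h.tendsto_inner h')

/-- A closed subspace invariant under `U = T ^ a ⊗ T ^ b` and `U⁻¹` is invariant under the weak
limits of powers of `U`. -/
theorem weakLimit_apply_mem {l : Filter ℕ} [l.NeBot] {κ : ℕ → ℤ} {a b : ℤ}
    {Q : S.SquareL2 →L[ℂ] S.SquareL2} (h : WeakLimit l (fun j => S.op (a * κ j) (b * κ j)) Q)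
    (f : S.SquareL2) {x : S.SquareL2} (hx : x ∈ cyclicSubspace (S.op a b) f) :
    Q x ∈ cyclicSubspace (S.op a b) f ∧ Q.adjoint x ∈ cyclicSubspace (S.op a b) f := by
  refine ⟨h.apply_mem (isClosed_cyclicSubspace _ f) (fun j y hy => ?_) hx,
    h.adjoint.apply_mem (isClosed_cyclicSubspace _ f) (fun j y hy => ?_) hx⟩
  · have := zpow_apply_mem_cyclicSubspace (S.op a b) f (κ j) hy
    rwa [MeasureAut.squareOp_zpow, mul_comm _ a, mul_comm _ b] at this
  · have := zpow_apply_mem_cyclicSubspace (S.op a b) f (-κ j) hy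
    rwa [zpow_neg, MeasureAut.squareOp_zpow, mul_comm _ a, mul_comm _ b] at this

theorem op_zsmul_mem {M : Submodule ℂ S.SquareL2} {c d : ℤ}
    (h : ∀ x ∈ M, S.op c d x ∈ M) (h' : ∀ x ∈ M, S.op (-c) (-d) x ∈ M) (n : ℤ) :
    ∀ x ∈ M, S.op (n * c) (n * d) x ∈ M := by
  have key : ∀ {c d : ℤ}, (∀ x ∈ M, S.op c d x ∈ M) → ∀ (n : ℕ), ∀ x ∈ M,
      S.op (n * c) (n * d) x ∈ M := by
    intro c d h n x hx
    induction n with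
    | zero => simpa [op_zero] using hx
    | succ n ih =>
      have := h _ ih
      rw [op_op] at this
      convert this using 2
      push_cast
      congr 1 <;> ring
  intro x hx
  obtain ⟨k, rfl | rfl⟩ := n.eq_nat_or_neg
  · exact key h k x hx
  · have := key h' k x hx
    rwa [mul_neg, mul_neg, ← neg_mul, ← neg_mul] at this

theorem op_mem_of_generators {M : Submodule ℂ S.SquareL2}
    (h1 : ∀ x ∈ M, S.op 1 0 x ∈ M ∧ S.op (-1) 0 x ∈ M)
    (h2 : ∀ x ∈ M, S.op 0 1 x ∈ M ∧ S.op 0 (-1) x ∈ M) (a b : ℤ) :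
    ∀ x ∈ M, S.op a b x ∈ M := by
  intro x hx
  have h3 := op_zsmul_mem (S := S) (M := M) (c := 0) (d := 1) (fun x hx => (h2 x hx).1)
    (fun x hx => by simpa using (h2 x hx).2) b x hx
  have h4 := op_zsmul_mem (S := S) (M := M) (c := 1) (d := 0) (fun x hx => (h1 x hx).1)
    (fun x hx => by simpa using (h1 x hx).2) a _ h3
  simpa [op_op] using h4

/-- Along `l₁` the powers tend to a multiple of `1 ⊗ T⁻¹` and along `l₂` to one of `T⁻¹ ⊗ 1`.
Together with the adjoints these make the cyclic subspace of the base rectangle invariant under all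
`T ^ c ⊗ T ^ d`. -/
theorem hasSimpleSpectrum_op (hne : S.NoEigenvector) {l₁ l₂ : Filter ℕ} [l₁.NeBot] [l₂.NeBot]
    {κ : ℕ → ℤ} {a b : ℤ} {x₁ y₁ x₂ y₂ : ℝ} (hxy₁ : x₁ * y₁ ≠ 0) (hxy₂ : y₂ * x₂ ≠ 0)
    (h₁ : S.CorrLimit l₁ (fun j => a * κ j) x₁ 0) (h₁' : S.CorrLimit l₁ (fun j => b * κ j) 0 y₁)
    (h₂ : S.CorrLimit l₂ (fun j => a * κ j) 0 y₂) (h₂' : S.CorrLimit l₂ (fun j => b * κ j) x₂ 0) :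
    HasSimpleSpectrum (S.op a b) := by
  refine ⟨S.rect (0, 0) (0, 0), ?_⟩
  change cyclicSubspace (S.op a b) _ = ⊤
  have hc₁ : ((x₁ * y₁ : ℝ) : ℂ) ≠ 0 := Complex.ofReal_ne_zero.2 hxy₁
  have hc₂ : ((y₂ * x₂ : ℝ) : ℂ) ≠ 0 := Complex.ofReal_ne_zero.2 hxy₂
  refine S.eq_top_of_op_mem hne (isClosed_cyclicSubspace _ _)
    (op_mem_of_generators (fun x hx => ?_) fun x hx => ?_) (self_mem_cyclicSubspace _ _)
  · have := weakLimit_apply_mem (h₂.weakLimit h₂') _ hx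
    simp only [mul_zero, zero_mul, Complex.ofReal_zero, zero_smul, add_zero, zero_add,
      LinearIsometryEquiv.map_smulₛₗ, Complex.conj_ofReal, smul_apply, opL_adjoint, neg_neg,
      neg_zero, opL_apply] at this
    exact ⟨(Submodule.smul_mem_iff _ hc₂).1 this.2, (Submodule.smul_mem_iff _ hc₂).1 this.1⟩
  · have := weakLimit_apply_mem (h₁.weakLimit h₁') _ hx
    simp only [mul_zero, zero_mul, Complex.ofReal_zero, zero_smul, add_zero, zero_add,
      LinearIsometryEquiv.map_smulₛₗ, Complex.conj_ofReal, smul_apply, opL_adjoint, neg_neg,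
      neg_zero, opL_apply] at this
    exact ⟨(Submodule.smul_mem_iff _ hc₁).1 this.2, (Submodule.smul_mem_iff _ hc₁).1 this.1⟩

/-! ### The symmetric square -/

/-- A subspace invariant under the diagonal operators and `T ⊗ 1 + 1 ⊗ T` is invariant under all
symmetrized operators. -/
theorem op_add_op_mem {M : Submodule ℂ S.SquareL2}
    (hdiag : ∀ x ∈ M, S.op 1 1 x ∈ M ∧ S.op (-1) (-1) x ∈ M)
    (hsum : ∀ x ∈ M, S.op 1 0 x + S.op 0 1 x ∈ M) (a b : ℤ) {x : S.SquareL2} (hx : x ∈ M) :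
    S.op a b x + S.op b a x ∈ M := by
  have key : ∀ n : ℕ, (∀ x ∈ M, S.op n 0 x + S.op 0 n x ∈ M) ∧
      ∀ x ∈ M, S.op (n + 1 : ℕ) 0 x + S.op 0 (n + 1 : ℕ) x ∈ M := by
    intro n
    induction n with
    | zero =>
      refine ⟨fun x hx => ?_, fun x hx => by simpa using hsum x hx⟩
      simpa [op_zero] using M.add_mem hx hx
    | succ n ih =>
      refine ⟨ih.2, fun x hx => ?_⟩
      -- With `s n = T ^ n ⊗ 1 + 1 ⊗ T ^ n` this is the recursion `s (n + 2) = s 1 * s (n + 1) - (T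
      -- ⊗ T) * s n`.
      have h1 := M.sub_mem (hsum _ (ih.2 x hx)) (hdiag _ (ih.1 x hx)).1
      rw [map_add, map_add, map_add, op_op, op_op, op_op, op_op, op_op, op_op] at h1
      convert h1 using 1
      push_cast
      simp only [zero_add, add_comm (1 : ℤ)]
      abel
  have hd : ∀ (n : ℤ) (x : S.SquareL2), x ∈ M → S.op n n x ∈ M := fun n x hx => by
    simpa using op_zsmul_mem (fun x hx => (hdiag x hx).1) (fun x hx => (hdiag x hx).2) n x hx
  have key' : ∀ (n : ℕ) (b : ℤ), S.op (b + n) b x + S.op b (b + n) x ∈ M := fun n b => by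
    have := hd b _ ((key n).1 x hx)
    rwa [map_add, op_op, op_op, add_zero] at this
  rcases le_total b a with h | h
  · obtain ⟨n, hn⟩ := Int.le.dest h
    rw [← hn]
    exact key' n b
  · obtain ⟨n, hn⟩ := Int.le.dest h
    rw [← hn, add_comm]
    exact key' n a

theorem opL_comm (a b c d : ℤ) : S.opL a b * S.opL c d = S.opL c d * S.opL a b := by
  rw [opL_mul, opL_mul, add_comm a, add_comm b]

/-- The three limits have separate tasks: `h₁` excludes eigenvectors, `h₂` gives invariance under `T
⊗ T`, and `h₃` supplies `T ⊗ 1 + 1 ⊗ T`. The symmetric functions then form one cyclic subspace, and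
a unitary operator that commutes with `U` and anticommutes with the exchange `J` carries it onto the
antisymmetric ones. -/
theorem hasHomogeneousSpectrum_op {l₁ l₂ l₃ : Filter ℕ} [l₁.NeBot] [l₂.NeBot] [l₃.NeBot]
    {κ : ℕ → ℤ} {m : ℤ} {x₁ y₂ x₃ y₃ : ℝ} (hx₁ : |x₁| < 1) (hy₂ : y₂ ≠ 0)
    (hx₃ : x₃ ≠ 0) (hy₃ : y₃ ≠ 0) (h₁ : S.CorrLimit l₁ (fun j => m * κ j) x₁ 0)
    (h₂ : S.CorrLimit l₂ (fun j => m * κ j) 0 y₂)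
    (h₃ : S.CorrLimit l₃ (fun j => m * κ j) x₃ y₃) :
    HasHomogeneousSpectrum (S.op m m) 2 := by
  have hne : S.NoEigenvector := noEigenvector_of_corrLimit h₁ hx₁
  set F := S.rect (0, 0) (0, 0) with hF
  set U := S.op m m with hU
  let σswap : S.SquareL2 ≃ₗᵢ[ℂ] S.SquareL2 := (MeasureAut.swap S.measure).koopman
  let J : S.SquareL2 →L[ℂ] S.SquareL2 := (σswap.toContinuousLinearEquiv : _ →L[ℂ] _)
  have hJJ : ∀ x, J (J x) = x := MeasureAut.swap_swap
  have hJop : ∀ a b x, J (S.op a b x) = S.op b a (J x) := S.aut.swap_squareOp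
  have hJopL : ∀ a b, J * S.opL a b = S.opL b a * J := fun a b =>
    ContinuousLinearMap.ext fun x => hJop a b x
  have hJF : J F = F := S.swap_rect _ _
  -- the cyclic subspace of `F` contains all symmetric vectors
  have hdiag : ∀ x ∈ cyclicSubspace U F, S.op 1 1 x ∈ cyclicSubspace U F ∧
      S.op (-1) (-1) x ∈ cyclicSubspace U F := by
    intro x hx
    have := weakLimit_apply_mem (h₂.weakLimit h₂) _ hx
    have hc : ((y₂ * y₂ : ℝ) : ℂ) ≠ 0 := Complex.ofReal_ne_zero.2 (mul_ne_zero hy₂ hy₂)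
    simp only [mul_zero, zero_mul, Complex.ofReal_zero, zero_smul, add_zero, zero_add,
      LinearIsometryEquiv.map_smulₛₗ, Complex.conj_ofReal, smul_apply, opL_adjoint, neg_neg,
      opL_apply] at this
    exact ⟨(Submodule.smul_mem_iff _ hc).1 this.2, (Submodule.smul_mem_iff _ hc).1 this.1⟩
  have hsum : ∀ x ∈ cyclicSubspace U F, S.op 1 0 x + S.op 0 1 x ∈ cyclicSubspace U F := by
    intro x hx
    have := (weakLimit_apply_mem (h₃.weakLimit h₃) _ hx).2
    have hc : ((x₃ * y₃ : ℝ) : ℂ) ≠ 0 := Complex.ofReal_ne_zero.2 (mul_ne_zero hx₃ hy₃)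
    rw [mul_comm y₃ x₃] at this
    simp only [map_add, LinearIsometryEquiv.map_smulₛₗ, Complex.conj_ofReal, smul_apply,
      add_apply, opL_adjoint, neg_neg, neg_zero, opL_apply, op_zero] at this
    -- The adjoint limit is `(x₃ + y₃ T) ⊗ (x₃ + y₃ T)`; its identity and `T ⊗ T` terms are
    -- subtracted, and the mixed terms remain.
    have h4 := Submodule.sub_mem _ (Submodule.sub_mem _ this
      (Submodule.smul_mem _ ((x₃ * x₃ : ℝ) : ℂ) hx))
      (Submodule.smul_mem _ ((y₃ * y₃ : ℝ) : ℂ) (hdiag x hx).1)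
    refine (Submodule.smul_mem_iff _ hc).1 ?_
    convert h4 using 1
    rw [smul_add]
    abel
  have hsym : ∀ x, x + J x ∈ cyclicSubspace U F := by
    -- The vectors `T ^ a ⊗ T ^ b F` have dense span, and `1 + J` sends them to the symmetrized ones
    -- because `J F = F`.
    let L : Submodule ℂ S.SquareL2 :=
      (Submodule.span ℂ (range fun p : ℤ × ℤ => S.op p.1 p.2 F)).topologicalClosure
    have hL : L = ⊤ := by
      refine S.eq_top_of_op_mem hne (Submodule.isClosed_topologicalClosure _)
        (fun a b x hx => ?_)
        (Submodule.le_topologicalClosure _ (Submodule.subset_span ⟨(0, 0), S.op_zero F⟩))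
      refine map_mem_of_mem_closure_span (Submodule.isClosed_topologicalClosure _) (S.opL a b)
        ?_ hx
      rintro _ ⟨p, rfl⟩
      refine Submodule.le_topologicalClosure _ (Submodule.subset_span ⟨(a + p.1, b + p.2), ?_⟩)
      exact (S.op_op _ _ _ _ _).symm
    intro x
    have hx : x ∈ L := hL ▸ Submodule.mem_top
    refine map_mem_of_mem_closure_span (isClosed_cyclicSubspace U F)
      (ContinuousLinearMap.id ℂ _ + J) ?_ hx
    rintro _ ⟨p, rfl⟩
    have := op_add_op_mem hdiag hsum p.1 p.2 (self_mem_cyclicSubspace U F)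
    simpa only [add_apply, ContinuousLinearMap.id_apply, hJop, hJF] using this
  -- a unitary operator that interchanges symmetric and antisymmetric vectors
  let A : S.SquareL2 →L[ℂ] S.SquareL2 := S.opL 1 0 - S.opL 0 1
  have hAad : star A = S.opL (-1) 0 - S.opL 0 (-1) := by
    change A.adjoint = _
    simp only [A, map_sub, opL_adjoint, neg_zero]
  -- Such an `x` is fixed by `T ⊗ T⁻¹`, some powers of which tend weakly to the scalar `x₁ ^ 2 < 1`.
  -- This gives the injectivity of `A` and of its adjoint needed for the polar decomposition.
  have hfix : ∀ x, S.op 1 0 x = S.op 0 1 x → x = 0 := by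
    intro x hx
    have h5 : S.CorrLimit l₁ (fun j => 1 * (m * κ j)) x₁ 0 := by simpa only [one_mul] using h₁
    have h6 : S.CorrLimit l₁ (fun j => (-1) * (m * κ j)) x₁ 0 := by
      simpa only [neg_one_mul] using h₁.neg
    refine no_eigenvector_op h5 h6 ?_ 1 x ?_
    · rw [abs_mul]
      exact mul_lt_one_of_nonneg_of_lt_one_left (abs_nonneg _) hx₁ hx₁.le
    · have := congrArg (S.op 0 (-1)) hx
      rw [op_op, op_op] at this
      simpa [op_zero] using this
  obtain ⟨W, hW⟩ := exists_polar_unitary (A := A)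
    (fun x hx => hfix x (sub_eq_zero.1 hx))
    (fun x hx => by
      change star A x = 0 at hx
      rw [hAad] at hx
      have := congrArg (S.op 1 1) (sub_eq_zero.1 hx)
      change S.op 1 1 (S.op (-1) 0 x) = S.op 1 1 (S.op 0 (-1) x) at this
      rw [op_op, op_op] at this
      exact hfix x (by simpa using this.symm))
  have hAop : ∀ a b, A * S.opL a b = S.opL a b * A := fun a b => by
    simp only [A, sub_mul, mul_sub, S.opL_comm a b]
  have hAop' : ∀ a b, star A * S.opL a b = S.opL a b * star A := fun a b => by
    simp only [hAad, sub_mul, mul_sub, S.opL_comm a b]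
  have hAJ : J * A = -(A * J) := by
    simp only [A, sub_mul, mul_sub, hJopL, neg_sub]
  have hAJ' : J * star A = -(star A * J) := by
    simp only [hAad, sub_mul, mul_sub, hJopL, neg_sub]
  have hWop : ∀ a b x, S.op a b (W x) = W (S.op a b x) := fun a b x => by
    have := hW (S.opL a b) 1 (by rw [one_smul, hAop])
      (by rw [Commute, SemiconjBy, mul_assoc, hAop, ← mul_assoc, hAop', mul_assoc]) x
    simpa only [one_smul, opL_apply] using this
  have hWJ : ∀ x, J (W x) = -W (J x) := fun x => by
    have := hW J (-1) (by rw [hAJ, neg_one_smul])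
      (by
        rw [Commute, SemiconjBy, ← mul_assoc J, hAJ', neg_mul, mul_assoc _ J, hAJ, mul_neg,
          neg_neg, mul_assoc]) x
    simpa only [neg_one_smul] using this
  have hUW : ∀ (k : ℤ) x, (U ^ k) (W x) = W ((U ^ k) x) := fun k x => by
    rw [hU, MeasureAut.squareOp_zpow]
    exact hWop _ _ x
  have hUJ : ∀ (k : ℤ) x, J ((U ^ k) x) = (U ^ k) (J x) := fun k x => by
    rw [hU, MeasureAut.squareOp_zpow]
    exact hJop _ _ x
  have horth : ∀ x y, J x = x → J y = -y → ⟪x, y⟫_ℂ = 0 := by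
    intro x y hx hy
    have h7 : ⟪J x, J y⟫_ℂ = ⟪x, y⟫_ℂ := σswap.inner_map_map x y
    rw [hx, hy, inner_neg_right] at h7
    exact self_eq_neg.1 h7.symm
  obtain ⟨σ, hσfin, hσ⟩ := exists_isSpectralMeasure U F
  refine ⟨σ, hσfin, ?_, ![F, W F], ?_, ?_, ?_⟩
  · rintro rfl
    have := hσ 0
    rw [zpow_zero, integral_zero_measure] at this
    exact S.rect_ne_zero (inner_self_eq_zero.1 this)
  · intro i
    fin_cases i
    · exact hσ
    · intro k
      change ⟪W F, (U ^ k) (W F)⟫_ℂ = _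
      rw [hUW, W.inner_map_map]
      exact hσ k
  · have hJF1 : ∀ k : ℤ, J ((U ^ k) F) = (U ^ k) F := fun k => by rw [hUJ, hJF]
    have hJW1 : ∀ k : ℤ, J ((U ^ k) (W F)) = -(U ^ k) (W F) := fun k => by
      rw [hUJ, hWJ, hJF, map_neg]
    intro i i' hii k
    fin_cases i <;> fin_cases i'
    · exact absurd rfl hii
    · exact horth _ _ hJF (hJW1 k)
    · change ⟪W F, (U ^ k) F⟫_ℂ = 0
      rw [← inner_conj_symm, horth _ _ (hJF1 k) (by rw [hWJ, hJF]), map_zero]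
    · exact absurd rfl hii
  · set K := (Submodule.span ℂ (range fun p : Fin 2 × ℤ =>
      (U ^ p.2) ((![F, W F] : Fin 2 → S.SquareL2) p.1))).topologicalClosure with hK
    have hKcl : IsClosed (K : Set S.SquareL2) := Submodule.isClosed_topologicalClosure _
    have hmem : ∀ p : Fin 2 × ℤ, (U ^ p.2) ((![F, W F] : Fin 2 → S.SquareL2) p.1) ∈ K :=
      fun p => Submodule.le_topologicalClosure _ (Submodule.subset_span ⟨p, rfl⟩)
    have h8 : ∀ x ∈ cyclicSubspace U F, x ∈ K := by
      intro x hx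
      refine map_mem_of_mem_closure_span hKcl (ContinuousLinearMap.id ℂ _) ?_ hx
      rintro _ ⟨k, rfl⟩
      exact hmem (0, k)
    have h9 : ∀ x ∈ cyclicSubspace U F, W x ∈ K := by
      intro x hx
      refine map_mem_of_mem_closure_span hKcl (W.toContinuousLinearEquiv : _ →L[ℂ] _) ?_ hx
      rintro _ ⟨k, rfl⟩
      change W ((U ^ k) F) ∈ K
      rw [← hUW]
      exact hmem (1, k)
    rw [eq_top_iff]
    intro x _
    have h10 : x + J x ∈ K := h8 _ (hsym x)
    have h11 : x - J x ∈ K := by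
      -- The preimage of an antisymmetric vector under `W` is symmetric, since `W` anticommutes with
      -- `J`.
      obtain ⟨y, hy⟩ := W.surjective (x - J x)
      have h12 : J y = y := by
        refine W.injective (neg_injective ?_)
        rw [← hWJ, hy, map_sub, hJJ, neg_sub]
      have h13 := hsym y
      rw [h12, ← two_smul ℂ y, Submodule.smul_mem_iff _ two_ne_zero] at h13
      rw [← hy]
      exact h9 _ h13
    have h14 := K.add_mem h10 h11
    rw [add_add_sub_cancel, ← two_smul ℂ x, Submodule.smul_mem_iff _ two_ne_zero] at h14
    exact h14

end StackData

/-! ### Correlations of levels -/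

namespace StackData

open Filter Topology

section Corr

variable (S : StackData)

theorem corr_eq_zero_left {k : ℤ} {i : ℕ} {f : ℤ} (hf : ¬ |f| ≤ S.m i) (q : ℕ × ℤ) :
    S.corr k (i, f) q = 0 := by
  simp [corr, S.level_eq_empty hf]

theorem corr_eq_zero_right {k : ℤ} {i : ℕ} {f : ℤ} (hf : ¬ |f| ≤ S.m i) (p : ℕ × ℤ) :
    S.corr k p (i, f) = 0 := by
  simp [corr, S.level_eq_empty hf]

theorem corr_split_left {k : ℤ} {i : ℕ} {f : ℤ} (hf : |f| ≤ S.m i) (q : ℕ × ℤ) :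
    S.corr k (i, f) q = ∑ a, S.corr k (i + 1, f + S.P i a) q := by
  simp only [corr]
  rw [S.level_eq_iUnion hf, iUnion_inter, measureReal_iUnion_fintype
    (fun a b hab => (S.sublevel_disjoint f hab).mono inter_subset_left inter_subset_left)
    (fun a => (S.measurableSet_level _ _).inter
      ((S.measurableSet_level _ _).preimage (S.measurePreserving_translate k).measurable))
    (fun a => measure_ne_top_of_subset inter_subset_left (S.measure_level_ne_top _ _))]

theorem corr_split_right {k : ℤ} {i : ℕ} {f : ℤ} (hf : |f| ≤ S.m i) (p : ℕ × ℤ) :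
    S.corr k p (i, f) = ∑ a, S.corr k p (i + 1, f + S.P i a) := by
  rw [← neg_neg k, corr_neg, S.corr_split_left hf]
  exact Finset.sum_congr rfl fun a _ => (S.corr_neg _ _ _).symm

theorem corr_same {k : ℤ} {i : ℕ} {f g : ℤ} (hf : |f| ≤ S.m i) (hg : |g| ≤ S.m i)
    (hk : |g - k| ≤ S.m i) :
    S.corr k (i, f) (i, g) = (4⁻¹ : ℝ) ^ i * if f + k = g then 1 else 0 := by
  rw [corr, S.preimage_translate_level hg hk]
  split_ifs with h
  · rw [show g - k = f by linarith, inter_self, measureReal_def, S.measure_level hf]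
    simp
  · rw [(S.level_disjoint i (show f ≠ g - k by
      intro h'
      exact h (by rw [h']; ring))).inter_eq]
    simp

/-- The bound on `k` keeps every shifted copy inside the next tower. There the correlation is the
measure of a level times the number of pairs of sublevels that match. -/
theorem corr_eq_count {k : ℤ} {i : ℕ} {f g : ℤ} (hf : |f| ≤ S.m i) (hg : |g| ≤ S.m i)
    (hk : ∀ a, S.m i + S.P i a + |k| ≤ S.m (i + 1)) :
    S.corr k (i, f) (i, g)
      = (4⁻¹ : ℝ) ^ (i + 1) * ∑ a, ∑ b, if f + S.P i a + k = g + S.P i b then 1 else 0 := by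
  rw [S.corr_split_left hf, Finset.mul_sum]
  refine Finset.sum_congr rfl fun a _ => ?_
  rw [S.corr_split_right hg, Finset.mul_sum]
  refine Finset.sum_congr rfl fun b _ => ?_
  refine S.corr_same (S.abs_add_P_le hf a) (S.abs_add_P_le hg b) ?_
  have h1 := abs_sub (g + S.P i b) k
  have h2 := abs_add_le g (S.P i b)
  rw [abs_of_nonneg (S.P_nonneg i b)] at h2
  linarith [hk b]

/-- By `sep`, different columns are separated by at least one spacer, so a unit shift cannot lead
from one column into another, not even at the ends of the tower. -/
theorem corr_eq_of_abs_le_one {k : ℤ} {i : ℕ} {f g : ℤ} (hf : |f| ≤ S.m i) (hg : |g| ≤ S.m i)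
    (hk : |k| ≤ 1) : S.corr k (i, f) (i, g) = (4⁻¹ : ℝ) ^ i * if f + k = g then 1 else 0 := by
  rw [S.corr_eq_count hf hg fun a => by linarith [S.m_succ i a], pow_succ, mul_assoc]
  congr 1
  have h1 : ∀ a b, (if f + S.P i a + k = g + S.P i b then (1 : ℝ) else 0)
      = if a = b then (if f + k = g then 1 else 0) else 0 := by
    intro a b
    split_ifs with h2 h3 h4 h3 h4
    · rfl
    · subst h3
      exact absurd (by linarith) h4
    · have h5 := S.sep i a b h3
      have h6 : S.P i a - S.P i b = g - f - k := by linarith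
      rw [h6] at h5
      have := abs_sub (g - f) k
      have := abs_sub g f
      linarith
    · subst h3
      exact absurd (by linarith) h2
    · rfl
    · rfl
  simp only [h1, Finset.sum_ite_eq, Finset.mem_univ, if_true, Finset.sum_const, Finset.card_univ,
    Fintype.card_fin, nsmul_eq_mul]
  push_cast
  ring

/-- A linear relation between correlations passes from the levels of a tower to those of the
previous ones. -/
theorem corr_eq_of_le {k : ℤ} {x y : ℝ} {j : ℕ}
    (h : ∀ f g, S.corr k (j, f) (j, g)
      = x * S.corr 0 (j, f) (j, g) + y * S.corr (-1) (j, f) (j, g))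
    {i i' : ℕ} (hi : i ≤ j) (hi' : i' ≤ j) (f g : ℤ) :
    S.corr k (i, f) (i', g) = x * S.corr 0 (i, f) (i', g) + y * S.corr (-1) (i, f) (i', g) := by
  have h1 : ∀ f g, S.corr k (i, f) (j, g)
      = x * S.corr 0 (i, f) (j, g) + y * S.corr (-1) (i, f) (j, g) := by
    refine Nat.decreasingInduction' (P := fun i => ∀ f g, S.corr k (i, f) (j, g)
      = x * S.corr 0 (i, f) (j, g) + y * S.corr (-1) (i, f) (j, g)) ?_ hi h
    intro l _ _ ih f g
    by_cases hf : |f| ≤ S.m l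
    · simp only [S.corr_split_left hf, Finset.mul_sum, ← Finset.sum_add_distrib]
      exact Finset.sum_congr rfl fun a _ => ih _ _
    · simp only [S.corr_eq_zero_left hf, mul_zero, add_zero]
  refine Nat.decreasingInduction' (P := fun i' => ∀ f g, S.corr k (i, f) (i', g)
      = x * S.corr 0 (i, f) (i', g) + y * S.corr (-1) (i, f) (i', g)) ?_ hi' h1 f g
  intro l _ _ ih f g
  by_cases hg : |g| ≤ S.m l
  · simp only [S.corr_split_right hg, Finset.mul_sum, ← Finset.sum_add_distrib]
    exact Finset.sum_congr rfl fun a _ => ih _ _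
  · simp only [S.corr_eq_zero_right hg, mul_zero, add_zero]

end Corr

/-! ### The concrete construction -/

/-- A construction in which the first two and the last two columns of the `i`-th tower are placed
at the distances `a i r * k i + α i r`, `r = 0, 1`, and the two pairs at the large distance
`v i`. -/
structure PairScheme (N : ℕ) where
  S : StackData
  k : ℕ → ℤ
  v : ℕ → ℤ
  a : ℕ → Fin 2 → ℤ
  α : ℕ → Fin 2 → ℤ
  one_le_a : ∀ i r, 1 ≤ a i r
  a_le : ∀ i r, a i r ≤ N
  α_eq : ∀ i r, α i r = 0 ∨ α i r = 1
  P_eq : ∀ i, S.P i = ![0, a i 0 * k i + α i 0, v i, v i + (a i 1 * k i + α i 1)]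
  -- The factors growing with `i` eventually beat any fixed `n > N`, so one construction serves all
  -- `n`. Divisibility by factorials makes `k i / m` an integer at high stages for every `m ≠ 0`.
  k_ge : ∀ i : ℕ, 4 * ((i + 1 : ℕ) * (S.m i + 1)) ≤ k i
  v_ge : ∀ i : ℕ, 3 * ((i + 2 : ℕ) * ((N + 2) * k i)) ≤ v i
  m_ge : ∀ i, S.m i + 10 * v i ≤ S.m (i + 1)
  k_dvd : ∀ i, ((i + 1).factorial : ℤ) ∣ k i

namespace PairScheme

variable {N : ℕ} (D : PairScheme N)

theorem four_mul_le_k (i : ℕ) : 4 * (D.S.m i + 1) ≤ D.k i := by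
  refine le_trans ?_ (D.k_ge i)
  have := D.S.m_nonneg i
  push_cast
  nlinarith [Int.natCast_nonneg i]

theorem k_pos (i : ℕ) : 0 < D.k i := by
  linarith [D.four_mul_le_k i, D.S.m_nonneg i]

theorem le_k (i : ℕ) : (i : ℤ) ≤ D.k i := by
  linarith [D.four_mul_le_k i, D.S.le_m i, D.S.m_nonneg i]

/-- The distance within the `r`-th pair of columns. -/
def d (i : ℕ) (r : Fin 2) : ℤ := D.a i r * D.k i + D.α i r

theorem P_eq' (i : ℕ) : D.S.P i = ![0, D.d i 0, D.v i, D.v i + D.d i 1] := D.P_eq i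

theorem k_le_d (i : ℕ) (r : Fin 2) : D.k i ≤ D.d i r := by
  rw [d]
  have := D.k_pos i
  have := D.one_le_a i r
  rcases D.α_eq i r with h | h <;> rw [h] <;> nlinarith

theorem d_le (i : ℕ) (r : Fin 2) : D.d i r ≤ N * D.k i + 1 := by
  rw [d]
  have := D.k_pos i
  have := D.a_le i r
  rcases D.α_eq i r with h | h <;> rw [h] <;> nlinarith

theorem six_mul_le_v (i : ℕ) : 6 * (N * D.k i + 2 * D.k i) ≤ D.v i := by
  refine le_trans ?_ (D.v_ge i)
  have := D.k_pos i
  have h1 : (0 : ℤ) ≤ N * D.k i := by positivity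
  push_cast
  nlinarith [mul_nonneg (Int.natCast_nonneg i) (add_nonneg h1 (by linarith : 0 ≤ 2 * D.k i))]

theorem k_le_N_mul (i : ℕ) : D.k i ≤ N * D.k i := by
  have h1 := D.k_pos i
  have h2 := (D.one_le_a i 0).trans (D.a_le i 0)
  nlinarith

theorem eight_mul_m_le (i : ℕ) : 8 * D.S.m i ≤ D.S.m (i + 1) := by
  linarith [D.m_ge i, D.six_mul_le_v i, D.k_le_N_mul i, D.four_mul_le_k i, D.S.m_nonneg i]

theorem P_le (i : ℕ) (c : Fin 4) : D.S.P i c ≤ D.v i + N * D.k i + 1 := by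
  have h1 := D.d_le i 0
  have h2 := D.d_le i 1
  have h3 := D.six_mul_le_v i
  have h4 := D.k_le_N_mul i
  have h5 := D.k_pos i
  rw [P_eq']
  fin_cases c <;> simp <;> linarith

/-- A distance of columns that are paired. -/
theorem d_eq_iff (i : ℕ) (r : Fin 2) {n δ : ℤ} (hδ : |δ| ≤ 2 * D.S.m i) :
    D.d i r = n * D.k i - δ ↔ D.a i r = n ∧ D.α i r = -δ := by
  constructor
  · intro h
    have h1 : (D.a i r - n) * D.k i = -δ - D.α i r := by rw [d] at h; linarith
    -- A multiple of `k i` that is at most `2 * m i + 1` in modulus is zero.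
    have h2 : D.a i r - n = 0 := by
      refine Int.eq_zero_of_abs_lt_dvd (m := D.k i) (x := (D.a i r - n) * D.k i)
        (dvd_mul_left _ _) ?_ |> fun h => (mul_eq_zero.1 h).resolve_right (D.k_pos i).ne'
      rw [h1]
      have := abs_le.1 hδ
      have := D.four_mul_le_k i
      have := D.S.m_nonneg i
      rw [abs_lt]
      rcases D.α_eq i r with h | h <;> rw [h] <;> constructor <;> linarith
    rw [h2, zero_mul] at h1
    exact ⟨by linarith, by linarith⟩
  · rintro ⟨h1, h2⟩
    rw [d, h1, h2]
    ring

/-- Fourteen of the sixteen pairs of columns are excluded by size: the positive shift is too large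
to stay in one column and too small to connect different pairs. What remains is first to second
column within each pair. -/
theorem _root_.Fin.sum_pair_indicator {m k K L d0 d1 v f g : ℤ} {Q : Fin 4 → ℤ} (Q0 : Q 0 = 0)
    (Q1 : Q 1 = d0) (Q2 : Q 2 = v) (Q3 : Q 3 = v + d1) (h1 : d0 ≤ L + 1)
    (h3 : 6 * (L + 2 * k) ≤ v) (h4 : 4 * (m + 1) ≤ k) (h6 : k ≤ d0) (h7 : k ≤ d1)
    (h8 : k ≤ K) (h9 : K ≤ L) (h10 : -(2 * m) ≤ g - f) (h11 : g - f ≤ 2 * m) :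
    (∑ a, ∑ b, if f + Q a + K = g + Q b then (1 : ℝ) else 0)
      = (if d0 = K - (g - f) then 1 else 0) + if d1 = K - (g - f) then 1 else 0 := by
  have n00 : f + 0 + K ≠ g + 0 := by omega
  have n02 : f + 0 + K ≠ g + v := by omega
  have n03 : f + 0 + K ≠ g + (v + d1) := by omega
  have n10 : f + d0 + K ≠ g + 0 := by omega
  have n11 : f + d0 + K ≠ g + d0 := by omega
  have n12 : f + d0 + K ≠ g + v := by omega
  have n13 : f + d0 + K ≠ g + (v + d1) := by omega
  have n20 : f + v + K ≠ g + 0 := by omega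
  have n21 : f + v + K ≠ g + d0 := by omega
  have n22 : f + v + K ≠ g + v := by omega
  have n30 : f + (v + d1) + K ≠ g + 0 := by omega
  have n31 : f + (v + d1) + K ≠ g + d0 := by omega
  have n32 : f + (v + d1) + K ≠ g + v := by omega
  have n33 : f + (v + d1) + K ≠ g + (v + d1) := by omega
  have e1 : f + 0 + K = g + d0 ↔ d0 = K - (g - f) := by omega
  have e2 : f + v + K = g + (v + d1) ↔ d1 = K - (g - f) := by omega
  simp only [Fin.sum_univ_four, Q0, Q1, Q2, Q3, e1, e2, n00, n02, n03, n10, n11, n12, n13, n20, n21, n22, n30, n31, n32, n33, if_false]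
  ring

theorem count_eq (i : ℕ) {n f g : ℤ} (hf : |f| ≤ D.S.m i) (hg : |g| ≤ D.S.m i)
    (hn : 1 ≤ n) (hnN : n ≤ N) :
    (∑ a, ∑ b, if f + D.S.P i a + n * D.k i = g + D.S.P i b then (1 : ℝ) else 0)
      = ∑ r, if D.a i r = n ∧ D.α i r = f - g then 1 else 0 := by
  have hδ : |g - f| ≤ 2 * D.S.m i := by linarith [abs_sub g f]
  have e : ∀ r, (D.a i r = n ∧ D.α i r = f - g) ↔ D.d i r = n * D.k i - (g - f) := fun r => by
    rw [D.d_eq_iff i r hδ, neg_sub]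
  simp only [e, Fin.sum_univ_two]
  refine Fin.sum_pair_indicator (m := D.S.m i) (k := D.k i) (L := N * D.k i) (v := D.v i)
    ?_ ?_ ?_ ?_ (D.d_le i 0) (D.six_mul_le_v i) (D.four_mul_le_k i)
    (D.k_le_d i 0) (D.k_le_d i 1) ?_ ?_ (abs_le.1 hδ).1 (abs_le.1 hδ).2
  · rw [P_eq']; rfl
  · rw [P_eq']; rfl
  · rw [P_eq']; rfl
  · rw [P_eq']; rfl
  · nlinarith [D.k_pos i]
  · nlinarith [D.k_pos i]

/-- The frequency of the pairs of columns with the distance `n * k i + c`. -/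
noncomputable def freq (t : Fin 2 → ℤ × ℤ) (n c : ℤ) : ℝ :=
  4⁻¹ * ∑ r, if t r = (n, c) then 1 else 0

/-- The parameters of the pairs of columns of the `i`-th tower. -/
def type (i : ℕ) (r : Fin 2) : ℤ × ℤ := (D.a i r, D.α i r)

/-- A matching pair has `a i r = n` and displaces levels by `α i r`, and the displacements `0` and
`1` are the correlations at the times `0` and `-1`. One column is a quarter of the tower, whence the
factor in `freq`. -/
theorem corr_eq (i : ℕ) {n : ℤ} (hn : 1 ≤ n) (hnN : n ≤ N) (f g : ℤ) :
    D.S.corr (n * D.k i) (i, f) (i, g) = freq (D.type i) n 0 * D.S.corr 0 (i, f) (i, g)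
      + freq (D.type i) n 1 * D.S.corr (-1) (i, f) (i, g) := by
  by_cases hf : |f| ≤ D.S.m i
  swap
  · simp only [D.S.corr_eq_zero_left hf, mul_zero, add_zero]
  by_cases hg : |g| ≤ D.S.m i
  swap
  · simp only [D.S.corr_eq_zero_right hg, mul_zero, add_zero]
  rw [D.S.corr_eq_of_abs_le_one (k := 0) hf hg (by simp),
    D.S.corr_eq_of_abs_le_one (k := -1) hf hg (by simp),
    D.S.corr_eq_count hf hg, D.count_eq i hf hg hn hnN]
  · have h1 : ∀ r, (if D.a i r = n ∧ D.α i r = f - g then (1 : ℝ) else 0)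
        = (if D.type i r = (n, 0) then 1 else 0) * (if f + 0 = g then 1 else 0)
          + (if D.type i r = (n, 1) then 1 else 0) * (if f + -1 = g then 1 else 0) := by
      intro r
      simp only [type, Prod.mk.injEq]
      have e0 : f + 0 = g ↔ 0 = f - g := by omega
      have e1 : f + -1 = g ↔ 1 = f - g := by omega
      rw [if_congr e0 rfl rfl, if_congr e1 rfl rfl]
      by_cases ha : D.a i r = n
      · rcases D.α_eq i r with h | h <;> simp [ha, h]
      · simp [ha]
    simp only [h1, Finset.sum_add_distrib, ← Finset.sum_mul, freq]
    ring
  · intro c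
    have h1 := D.P_le i c
    have h2 : |n * D.k i| ≤ N * D.k i := by
      rw [abs_of_nonneg (mul_nonneg (by linarith) (D.k_pos i).le)]
      nlinarith [D.k_pos i]
    linarith [D.m_ge i, D.six_mul_le_v i, D.k_pos i, D.k_le_N_mul i, D.four_mul_le_k i, D.S.m_nonneg i]

/-- Along the stages of a given type the correlations at the times `n * k i` have a limit. -/
theorem corrLimit (t : Fin 2 → ℤ × ℤ) {n : ℤ} (hn : 1 ≤ n) (hnN : n ≤ N) :
    D.S.CorrLimit (atTop ⊓ 𝓟 {i | D.type i = t}) (fun i => n * D.k i) (freq t n 0)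
      (freq t n 1) := by
  rintro ⟨i, f⟩ ⟨i', g⟩
  rw [eventually_inf_principal]
  filter_upwards [eventually_ge_atTop (max i i')] with j hj ht
  subst ht
  exact D.S.corr_eq_of_le (D.corr_eq j hn hnN) (le_of_max_le_left hj) (le_of_max_le_right hj) f g

theorem tendsto_k : Tendsto D.k atTop cofinite := by
  have h1 : Tendsto D.k atTop atTop :=
    tendsto_atTop_mono D.le_k tendsto_natCast_atTop_atTop
  exact h1.mono_right (by rw [Int.cofinite_eq]; exact le_sup_right)

/-! ### Existence -/

/-- The distance `k` of a tower of height `2 * M + 1`. -/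
def kAux (i : ℕ) (M : ℤ) : ℤ := (i + 1).factorial * (4 * ((i + 1 : ℕ) * (M + 1)))

def vAux (N i : ℕ) (M : ℤ) : ℤ := 3 * ((i + 2 : ℕ) * ((N + 2) * kAux i M))

def mAux (N : ℕ) : ℕ → ℤ
  | 0 => 0
  | i + 1 => mAux N i + 10 * vAux N i (mAux N i)

theorem kAux_ge (i : ℕ) {M : ℤ} (hM : 0 ≤ M) : 4 * ((i + 1 : ℕ) * (M + 1)) ≤ kAux i M := by
  have h1 : (1 : ℤ) ≤ (i + 1).factorial := by exact_mod_cast (i + 1).factorial_pos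
  have h2 : 0 ≤ 4 * ((i + 1 : ℕ) * (M + 1)) := by positivity
  rw [kAux]
  nlinarith

theorem exists_type_eq {N : ℕ} (τ : ℕ → Fin 2 → ℤ × ℤ)
    (h1 : ∀ i r, 1 ≤ (τ i r).1 ∧ (τ i r).1 ≤ N) (h2 : ∀ i r, (τ i r).2 = 0 ∨ (τ i r).2 = 1) :
    ∃ D : PairScheme N, D.type = τ := by
  have hv : ∀ i M, 0 ≤ M → 6 * (N * kAux i M + 2 * kAux i M) ≤ vAux N i M ∧
      4 * (M + 1) ≤ kAux i M := by
    intro i M hM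
    have h3 := kAux_ge i hM
    have h4 : 4 * (M + 1) ≤ kAux i M := by
      refine le_trans ?_ h3
      push_cast
      nlinarith [Int.natCast_nonneg i]
    refine ⟨?_, h4⟩
    rw [vAux]
    push_cast
    have h5 : 0 ≤ (N + 2) * kAux i M := mul_nonneg (by positivity) (by linarith)
    nlinarith [mul_nonneg (Int.natCast_nonneg i) h5]
  have hm0 : ∀ i, 0 ≤ mAux N i := by
    intro i
    induction i with
    | zero => exact le_rfl
    | succ i ih =>
      obtain ⟨h3, h4⟩ := hv i _ ih
      have h5 : 0 ≤ N * kAux i (mAux N i) := mul_nonneg (by positivity) (by linarith)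
      rw [mAux]
      linarith
  let k : ℕ → ℤ := fun i => kAux i (mAux N i)
  let v : ℕ → ℤ := fun i => vAux N i (mAux N i)
  have hv' : ∀ i, 6 * (N * k i + 2 * k i) ≤ v i := fun i => (hv i _ (hm0 i)).1
  have hk' : ∀ i, 4 * (mAux N i + 1) ≤ k i := fun i => (hv i _ (hm0 i)).2
  have hmv : ∀ i, mAux N (i + 1) = mAux N i + 10 * v i := fun i => rfl
  have hd : ∀ i r, k i ≤ (τ i r).1 * k i + (τ i r).2 ∧
      (τ i r).1 * k i + (τ i r).2 ≤ N * k i + 1 := by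
    intro i r
    obtain ⟨h3, h4⟩ := h1 i r
    have h5 := hk' i
    have h6 := hm0 i
    rcases h2 i r with h | h <;> rw [h] <;> constructor <;> nlinarith
  let P : ℕ → Fin 4 → ℤ := fun i => ![0, (τ i 0).1 * k i + (τ i 0).2, v i,
    v i + ((τ i 1).1 * k i + (τ i 1).2)]
  refine ⟨⟨⟨mAux N, P, rfl, fun i => rfl, fun i c => ?_, fun i c => ?_, fun i c c' hc => ?_⟩, k, v,
    fun i r => (τ i r).1, fun i r => (τ i r).2, fun i r => (h1 i r).1, fun i r => (h1 i r).2,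
    h2, fun i => rfl, fun i => kAux_ge i (hm0 i), fun i => le_rfl, fun i => le_rfl,
    fun i => dvd_mul_right _ _⟩, rfl⟩
  · have h3 := hd i 0
    have h4 := hd i 1
    have h5 := hv' i
    have h6 := hk' i
    have h7 := hm0 i
    change 0 ≤ (![0, (τ i 0).1 * k i + (τ i 0).2, v i,
      v i + ((τ i 1).1 * k i + (τ i 1).2)] : Fin 4 → ℤ) c
    fin_cases c <;> simp <;> linarith
  · have h3 := hd i 0
    have h4 := hd i 1
    have h5 := hv' i
    have h6 := hk' i
    have h7 := hm0 i
    rw [hmv]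
    change mAux N i + (![0, (τ i 0).1 * k i + (τ i 0).2, v i,
      v i + ((τ i 1).1 * k i + (τ i 1).2)] : Fin 4 → ℤ) c + 1 ≤ _
    fin_cases c <;> simp <;> linarith
  · have h3 := hd i 0
    have h4 := hd i 1
    have h5 := hv' i
    have h6 := hk' i
    have h7 := hm0 i
    rw [lt_abs]
    change 2 * mAux N i + 1 < (![0, (τ i 0).1 * k i + (τ i 0).2, v i,
      v i + ((τ i 1).1 * k i + (τ i 1).2)] : Fin 4 → ℤ) c - (![0, (τ i 0).1 * k i + (τ i 0).2, v i,
      v i + ((τ i 1).1 * k i + (τ i 1).2)] : Fin 4 → ℤ) c' ∨ 2 * mAux N i + 1 < -(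
      (![0, (τ i 0).1 * k i + (τ i 0).2, v i,
      v i + ((τ i 1).1 * k i + (τ i 1).2)] : Fin 4 → ℤ) c - (![0, (τ i 0).1 * k i + (τ i 0).2, v i,
      v i + ((τ i 1).1 * k i + (τ i 1).2)] : Fin 4 → ℤ) c')
    generalize (τ i 0).1 * k i + (τ i 0).2 = d0 at *
    generalize (τ i 1).1 * k i + (τ i 1).2 = d1 at *
    generalize (N : ℤ) * k i = L at *
    fin_cases c <;> fin_cases c' <;> simp at hc ⊢ <;> omega

/-- Every type of pairs occurs infinitely often. -/
def IsRich : Prop :=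
  ∀ t : Fin 2 → ℤ × ℤ, (∀ r, 1 ≤ (t r).1 ∧ (t r).1 ≤ N ∧ ((t r).2 = 0 ∨ (t r).2 = 1)) →
    (atTop ⊓ 𝓟 {i | D.type i = t}).NeBot

theorem exists_isRich {N : ℕ} (hN : 1 ≤ N) : ∃ D : PairScheme N, D.IsRich := by
  let T := {t : Fin 2 → ℤ × ℤ //
    ∀ r, 1 ≤ (t r).1 ∧ (t r).1 ≤ N ∧ ((t r).2 = 0 ∨ (t r).2 = 1)}
  have : Nonempty T := ⟨fun _ => (1, 0), fun _ => ⟨le_rfl, Nat.one_le_cast.2 hN, Or.inl rfl⟩⟩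
  obtain ⟨e, he⟩ := exists_surjective_nat T
  -- The stages `Nat.pair s n`, for all `n`, receive the type number `s`, so each type recurs
  -- infinitely often.
  obtain ⟨D, hD⟩ := exists_type_eq (N := N) (fun i => (e (Nat.unpair i).1).1)
    (fun i r => ⟨((e (Nat.unpair i).1).2 r).1, ((e (Nat.unpair i).1).2 r).2.1⟩)
    (fun i r => ((e (Nat.unpair i).1).2 r).2.2)
  refine ⟨D, fun t ht => ?_⟩
  obtain ⟨s, hs⟩ := he ⟨t, ht⟩
  rw [← frequently_mem_iff_neBot, frequently_atTop]
  refine fun n => ⟨Nat.pair s n, Nat.right_le_pair s n, ?_⟩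
  rw [mem_ofPred_eq, hD]
  simp [hs]

end PairScheme

end StackData

/-! ### Return times and dissipativity -/

namespace MeasureAut

variable {X : Type*} [MeasurableSpace X] {μ : Measure X}

theorem prod_zpow_apply [SFinite μ] (S T : MeasureAut μ) (k : ℤ) (x : X × X) :
    ((S.prod T).zpow k).toEquiv x = ((S.zpow k).toEquiv x.1, (T.zpow k).toEquiv x.2) := by
  have h1 : ∀ x, (S.prod T).toEquiv x = (S.toEquiv x.1, T.toEquiv x.2) := fun _ => rfl
  have hpos : ∀ (n : ℕ) (x : X × X), ((S.prod T).zpow n).toEquiv x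
      = ((S.zpow n).toEquiv x.1, (T.zpow n).toEquiv x.2) := by
    intro n
    induction n with
    | zero => exact fun _ => rfl
    | succ n ih =>
      intro x
      push_cast
      rw [zpow_add_apply, zpow_add_apply, zpow_add_apply, zpow_one_apply, zpow_one_apply,
        zpow_one_apply, ih, h1]
  obtain ⟨n, rfl | rfl⟩ := k.eq_nat_or_neg
  · exact hpos n x
  · apply ((S.prod T).zpow n).toEquiv.injective
    rw [zpow_apply_neg_apply, hpos, zpow_apply_neg_apply, zpow_apply_neg_apply]

theorem zpow_zpow_apply (T : MeasureAut μ) (n k : ℤ) (x : X) :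
    ((T.zpow n).zpow k).toEquiv x = (T.zpow (n * k)).toEquiv x := by
  change ((T.toEquiv.toEquiv ^ n) ^ k) x = (T.toEquiv.toEquiv ^ (n * k)) x
  rw [zpow_mul]

end MeasureAut

namespace StackData

variable (S : StackData)

/-- `k` is close to the distance of two columns of the `J`-th tower. -/
def IsReturn (J : ℕ) (k : ℤ) : Prop :=
  ∃ a b, a ≠ b ∧ |k - (S.P J b - S.P J a)| ≤ 2 * S.m J

variable {S} in
theorem IsReturn.neg {J : ℕ} {k : ℤ} (h : S.IsReturn J k) : S.IsReturn J (-k) := by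
  obtain ⟨a, b, hab, h⟩ := h
  refine ⟨b, a, hab.symm, ?_⟩
  rw [← abs_neg] at h
  convert h using 2
  ring

/-- In the first tower from the `i`-th on where the positions of the two points differ by `k`, their
last digits must differ, as otherwise the difference would be `k` one tower earlier. Their earlier
positions differ by at most `2 * m J`. -/
theorem exists_isReturn {k : ℤ} (hk : k ≠ 0) {i : ℕ} {f : ℤ} {x : S.Space}
    (hx : x ∈ S.level i f) (hy : S.translate k x ∈ S.level i f) : ∃ J, S.IsReturn J k := by
  set y := S.translate k x with hy_def
  obtain ⟨j, hj⟩ := S.eventually_translate k x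
  have hex : ∃ n, S.pos (i + n) y.1 - S.pos (i + n) x.1 = k :=
    ⟨j, by rw [(hj (i + j) (by omega)).2.2]; ring⟩
  classical
  obtain ⟨n, hn⟩ : ∃ n, Nat.find hex = n + 1 := by
    refine Nat.exists_eq_succ_of_ne_zero fun h0 => hk ?_
    have h1 := Nat.find_spec hex
    rw [h0, add_zero, hx.2, hy.2, sub_self] at h1
    exact h1.symm
  have h1 := Nat.find_spec hex
  have h2 := Nat.find_min hex (m := n) (by omega)
  rw [hn, ← add_assoc, S.pos_succ, S.pos_succ] at h1
  have hle : i ≤ i + n := Nat.le_add_right i n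
  have hx1 := S.abs_pos_le (S.col_mono hle hx.1)
  have hy1 := S.abs_pos_le (S.col_mono hle hy.1)
  refine ⟨i + n, x.1.1 (i + n), y.1.1 (i + n), fun hab => h2 ?_, ?_⟩
  · rw [← h1, hab]
    ring
  · rw [show k - (S.P (i + n) (y.1.1 (i + n)) - S.P (i + n) (x.1.1 (i + n)))
      = S.pos (i + n) y.1 - S.pos (i + n) x.1 by rw [← h1]; ring]
    linarith [abs_sub (S.pos (i + n) y.1) (S.pos (i + n) x.1)]

end StackData

/-! ### Return times of the concrete construction -/

namespace StackData.PairScheme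

variable {N : ℕ} (D : PairScheme N)

/-- The positive distances of columns. -/
theorem sub_P_cases (i : ℕ) {c c' : Fin 4} (h : 0 < D.S.P i c' - D.S.P i c) :
    (∃ r, D.S.P i c' - D.S.P i c = D.d i r) ∨
      D.v i - (N * D.k i + 1) ≤ D.S.P i c' - D.S.P i c ∧
        D.S.P i c' - D.S.P i c ≤ D.v i + (N * D.k i + 1) := by
  have h1 := D.d_le i 0
  have h2 := D.d_le i 1
  have h3 := D.k_le_d i 0
  have h4 := D.k_le_d i 1
  have h5 := D.k_pos i
  have h6 := D.six_mul_le_v i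
  have h7 := D.k_le_N_mul i
  rw [P_eq'] at h ⊢
  by_cases e0 : c = 0 ∧ c' = 1
  · obtain ⟨rfl, rfl⟩ := e0
    exact Or.inl ⟨0, by simp⟩
  by_cases e1 : c = 2 ∧ c' = 3
  · obtain ⟨rfl, rfl⟩ := e1
    exact Or.inl ⟨1, by simp⟩
  right
  generalize (N : ℤ) * D.k i = L at *
  fin_cases c <;> fin_cases c' <;> simp at h e0 e1 ⊢ <;> omega

theorem abs_sub_P_bounds (i : ℕ) {c c' : Fin 4} (h : c ≠ c') :
    D.k i ≤ |D.S.P i c' - D.S.P i c| ∧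
      |D.S.P i c' - D.S.P i c| ≤ D.v i + (N * D.k i + 1) := by
  have h5 := D.k_pos i
  have h6 := D.six_mul_le_v i
  have h7 := D.k_le_N_mul i
  have key : ∀ {c c' : Fin 4}, 0 < D.S.P i c' - D.S.P i c → D.k i ≤ D.S.P i c' - D.S.P i c ∧
      D.S.P i c' - D.S.P i c ≤ D.v i + (N * D.k i + 1) := by
    intro c c' h
    rcases D.sub_P_cases i h with ⟨r, hr⟩ | ⟨h1, h2⟩
    · rw [hr]
      exact ⟨D.k_le_d i r, by linarith [D.d_le i r]⟩
    · exact ⟨by linarith, h2⟩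
  rcases lt_trichotomy 0 (D.S.P i c' - D.S.P i c) with h1 | h1 | h1
  · rw [abs_of_pos h1]
    exact key h1
  · have := D.S.sep i c' c h.symm
    rw [← h1, abs_zero] at this
    linarith [D.S.m_nonneg i]
  · rw [abs_of_neg h1, neg_sub]
    exact key (by linarith)

theorem isReturn_bounds {J : ℕ} {k : ℤ} (h : D.S.IsReturn J k) :
    D.k J - 2 * D.S.m J ≤ |k| ∧ |k| ≤ D.S.m (J + 1) := by
  obtain ⟨a, b, hab, h⟩ := h
  obtain ⟨h1, h2⟩ := D.abs_sub_P_bounds J hab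
  have h3 := abs_sub_abs_le_abs_sub k (D.S.P J b - D.S.P J a)
  have h4 := abs_sub_abs_le_abs_sub (D.S.P J b - D.S.P J a) k
  rw [abs_sub_comm (D.S.P J b - D.S.P J a) k] at h4
  have h5 := D.four_mul_le_k J
  have h6 := D.six_mul_le_v J
  have h7 := D.k_le_N_mul J
  have h8 := D.m_ge J
  have h9 := D.S.m_nonneg J
  exact ⟨by linarith, by linarith⟩

/-- For `n > N` and a high tower, `k` and `n * k` are not both close to distances of columns. -/
theorem not_isReturn_mul {n J : ℕ} (hn : N < n) (hJ : n ≤ J) {k : ℤ} (hk : 0 < k)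
    (h : D.S.IsReturn J k) (h' : D.S.IsReturn J (n * k)) : False := by
  have hN : (1 : ℤ) ≤ N := (D.one_le_a J 0).trans (D.a_le J 0)
  have hnN : (N : ℤ) + 1 ≤ n := by exact_mod_cast hn
  have hnJ : (n : ℤ) ≤ J := by exact_mod_cast hJ
  have hm := D.S.m_nonneg J
  have hkp := D.k_pos J
  have hk4 : 4 * ((n + 1) * (D.S.m J + 1)) ≤ D.k J := by
    refine le_trans ?_ (D.k_ge J)
    push_cast
    nlinarith
  have hkN := D.k_le_N_mul J
  have hv : (n + 2) * (N * D.k J + 2 * D.k J) * 3 ≤ D.v J := by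
    refine le_trans ?_ (D.v_ge J)
    push_cast
    nlinarith [mul_nonneg (sub_nonneg.2 hnJ) (by linarith : 0 ≤ N * D.k J + 2 * D.k J)]
  obtain ⟨hlow, -⟩ := D.isReturn_bounds h
  obtain ⟨hlow', -⟩ := D.isReturn_bounds h'
  have hnk : 0 < n * k := mul_pos (by linarith) hk
  rw [abs_of_pos hk] at hlow
  rw [abs_of_pos hnk] at hlow'
  obtain ⟨a, b, hab, h⟩ := h
  obtain ⟨a', b', hab', h'⟩ := h'
  have hD := (D.abs_sub_P_bounds J hab).1
  have hD' := (D.abs_sub_P_bounds J hab').1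
  have hfour := D.four_mul_le_k J
  obtain ⟨e1, e2⟩ := abs_le.1 h
  obtain ⟨e1', e2'⟩ := abs_le.1 h'
  have hpos : 0 < D.S.P J b - D.S.P J a := by linarith
  have hpos' : 0 < D.S.P J b' - D.S.P J a' := by linarith
  have hc := D.sub_P_cases J hpos
  have hc' := D.sub_P_cases J hpos'
  generalize D.S.P J b - D.S.P J a = Δ at *
  generalize D.S.P J b' - D.S.P J a' = Δ' at *
  -- Both `n * Δ` and `Δ'` approximate `n * k`, with errors `2 * n * m J` and `2 * m J`.
  have hu : n * Δ - Δ' ≤ 2 * (n + 1) * D.S.m J := by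
    nlinarith
  have hl : -(2 * (n + 1) * D.S.m J) ≤ n * Δ - Δ' := by
    nlinarith
  -- If both distances are within pairs, `n * a > N ≥ a'` separates them by about `k J` at least. If
  -- `Δ` is within a pair and `Δ'` is not, `n * Δ` is far below `v J`. If `Δ` is close to `v J`,
  -- then `n ≥ 2` puts `n * Δ` above every distance of columns.
  rcases hc with ⟨r, rfl⟩ | ⟨g1, g2⟩
  · rcases hc' with ⟨r', rfl⟩ | ⟨g1', g2'⟩
    · have h1 : 1 ≤ n * D.a J r - D.a J r' := by
        have := D.one_le_a J r
        have := D.a_le J r'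
        nlinarith
      have h2 : D.k J - 1 ≤ n * D.d J r - D.d J r' := by
        have h3 : 0 ≤ n * D.α J r := by
          rcases D.α_eq J r with h | h <;> rw [h] <;> positivity
        have h4 : D.α J r' ≤ 1 := by rcases D.α_eq J r' with h | h <;> simp [h]
        rw [StackData.PairScheme.d, StackData.PairScheme.d]
        nlinarith
      nlinarith
    · have h1 := D.d_le J r
      have h2 : n * D.d J r ≤ n * (N * D.k J + 1) := by gcongr
      nlinarith
  · have h2 : n * (D.v J - (N * D.k J + 1)) ≤ n * Δ := by gcongr
    have h3 : 2 * D.v J ≤ n * D.v J := by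
      have : 0 ≤ D.v J := by linarith [D.six_mul_le_v J]
      gcongr
      linarith
    have h4 : Δ' ≤ D.v J + (N * D.k J + 1) := by
      rcases hc' with ⟨r', rfl⟩ | ⟨g1', g2'⟩
      · linarith [D.d_le J r', D.six_mul_le_v J]
      · exact g2'
    nlinarith

/-- Suppose `J ≥ n + 2`. For `J' < J` the bound `n * |k| ≤ m J` contradicts the lower bound on `|k|`
at stage `J`. For `J' > J` the bound `n * |k| ≤ n * m J'` is below all return times of stage `J'`.
For `J' = J` the distances themselves conflict. So only finitely many stages contribute. -/
theorem isReturn_mul_le {n J J' : ℕ} (hn : N < n) {k : ℤ} (hk : k ≠ 0)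
    (h : D.S.IsReturn J k) (h' : D.S.IsReturn J' (n * k)) : |k| ≤ D.S.m (n + 2) := by
  have hn1 : (1 : ℤ) ≤ n := by exact_mod_cast Nat.one_le_of_lt hn
  obtain ⟨h1, h2⟩ := D.isReturn_bounds h
  obtain ⟨h1', h2'⟩ := D.isReturn_bounds h'
  rw [abs_mul, Nat.abs_cast] at h1' h2'
  have hJ : J ≤ n + 1 := by
    by_contra! hJ
    rcases lt_trichotomy J' J with hlt | rfl | hlt
    · have h3 : D.S.m (J' + 1) ≤ D.S.m J := D.S.m_mono hlt
      have h4 := D.four_mul_le_k J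
      have h5 : |k| ≤ n * |k| := le_mul_of_one_le_left (abs_nonneg k) hn1
      linarith [D.S.m_nonneg J]
    · rcases lt_or_gt_of_ne hk with hneg | hpos
      · refine D.not_isReturn_mul hn (by omega) (neg_pos.2 hneg) h.neg ?_
        rw [mul_neg]
        exact h'.neg
      · exact D.not_isReturn_mul hn (by omega) hpos h h'
    · have h3 : D.S.m (J + 1) ≤ D.S.m J' := D.S.m_mono hlt
      have h4 := D.k_ge J'
      have h5 : n * |k| ≤ n * D.S.m J' := by
        gcongr
        linarith
      have h6 := D.S.m_nonneg J'
      have h7 : (n : ℤ) ≤ J' := by omega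
      push_cast at h4
      nlinarith
  exact h2.trans (D.S.m_mono (by omega))

theorem finite_return {n : ℕ} (hn : N < n) (p q : ℕ × ℤ) :
    {k : ℤ | ∃ x ∈ D.S.level p.1 p.2 ×ˢ D.S.level q.1 q.2,
      ((D.S.aut.prod (D.S.aut.zpow n)).zpow k).toEquiv x
        ∈ D.S.level p.1 p.2 ×ˢ D.S.level q.1 q.2}.Finite := by
  refine (Set.finite_Icc (-D.S.m (n + 2)) (D.S.m (n + 2))).subset ?_
  rintro k ⟨x, ⟨hx1, hx2⟩, hy⟩
  rw [MeasureAut.prod_zpow_apply, MeasureAut.zpow_zpow_apply, D.S.aut_zpow_apply,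
    D.S.aut_zpow_apply] at hy
  rw [mem_Icc, ← abs_le]
  rcases eq_or_ne k 0 with rfl | hk
  · simpa using D.S.m_nonneg _
  obtain ⟨J, hJ⟩ := D.S.exists_isReturn hk hx1 hy.1
  obtain ⟨J', hJ'⟩ := D.S.exists_isReturn
    (mul_ne_zero (Nat.cast_ne_zero.2 (by omega)) hk) hx2 hy.2
  exact D.isReturn_mul_le hn hk hJ hJ'

theorem exists_wandering_prod {n : ℕ} (hn : N < n) : ∃ A : Set (D.S.Space × D.S.Space),
    MeasurableSet A ∧
    (∀ i i' : ℤ, i ≠ i' → Disjoint (((D.S.aut.prod (D.S.aut.zpow n)).zpow i).toEquiv '' A)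
      (((D.S.aut.prod (D.S.aut.zpow n)).zpow i').toEquiv '' A)) ∧
    ⋃ i : ℤ, ((D.S.aut.prod (D.S.aut.zpow n)).zpow i).toEquiv '' A = univ := by
  obtain ⟨e, he⟩ := exists_surjective_nat ((ℕ × ℤ) × (ℕ × ℤ))
  refine MeasureAut.exists_wandering _
    (fun i => D.S.level (e i).1.1 (e i).1.2 ×ˢ D.S.level (e i).2.1 (e i).2.2)
    (fun i => D.S.measurableSet_prod_level _ _) (eq_univ_of_forall fun x => ?_)
    fun i => D.finite_return hn _ _
  obtain ⟨_, ⟨p, rfl⟩, hp⟩ := mem_sUnion.1 (D.S.sUnion_levels.symm ▸ mem_univ x.1)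
  obtain ⟨_, ⟨q, rfl⟩, hq⟩ := mem_sUnion.1 (D.S.sUnion_levels.symm ▸ mem_univ x.2)
  obtain ⟨i, hi⟩ := he (p, q)
  refine mem_iUnion.2 ⟨i, ?_⟩
  rw [hi]
  exact ⟨hp, hq⟩

theorem measure_univ_eq_top : D.S.measure univ = ∞ :=
  D.S.measure_univ_eq_top D.eight_mul_m_le

theorem isDissipative {n : ℕ} (hn : N < n) :
    (D.S.aut.prod (D.S.aut.zpow n)).IsDissipative := by
  obtain ⟨A, hA, hdisj, hcover⟩ := D.exists_wandering_prod hn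
  exact ⟨A, hA, hdisj, by rw [hcover, compl_univ, measure_empty]⟩

theorem hasCountableLebesgueSpectrum {n : ℕ} (hn : N < n) :
    HasCountableLebesgueSpectrum (D.S.aut.prod (D.S.aut.zpow n)).koopman := by
  obtain ⟨A, hA, hdisj, hcover⟩ := D.exists_wandering_prod hn
  refine MeasureAut.hasCountableLebesgueSpectrum_of_wandering _ ?_ hA hdisj hcover
  rw [← univ_prod_univ, Measure.prod_prod, D.measure_univ_eq_top]
  simp

end StackData.PairScheme

/-! ### Spectra of the concrete construction -/

namespace StackData.PairScheme

open Filter Topology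

variable {N : ℕ} (D : PairScheme N)

theorem freq_pair (p q : ℤ × ℤ) (n c : ℤ) :
    freq ![p, q] n c = 4⁻¹ * ((if p = (n, c) then 1 else 0) + if q = (n, c) then 1 else 0) := by
  rw [freq, Fin.sum_univ_two]
  rfl

variable {D} in
theorem IsRich.neBot (h : D.IsRich) {a b α β : ℤ} (ha : 1 ≤ a) (haN : a ≤ N) (hb : 1 ≤ b)
    (hbN : b ≤ N) (hα : α = 0 ∨ α = 1) (hβ : β = 0 ∨ β = 1) :
    (atTop ⊓ 𝓟 {i | D.type i = ![(a, α), (b, β)]}).NeBot := by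
  refine h _ fun r => ?_
  fin_cases r
  · exact ⟨ha, haN, hα⟩
  · exact ⟨hb, hbN, hβ⟩

variable {D} in
-- The type `(m, 0), (n, 0)` excludes eigenvectors; `(m, 0), (n, 1)` and `(m, 1), (n, 0)` yield the
-- two coordinate shifts, each with the coefficient `1 / 16`.
theorem IsRich.hasSimpleSpectrum (h : D.IsRich) {m n : ℤ} (hm : 1 ≤ m) (hmn : m < n)
    (hn : n ≤ N) : HasSimpleSpectrum (D.S.op m n) := by
  have hmN : m ≤ N := hmn.le.trans hn
  have hn1 : 1 ≤ n := hm.trans hmn.le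
  have := h.neBot hm hmN hn1 hn (Or.inl rfl) (Or.inl rfl)
  have := h.neBot hm hmN hn1 hn (Or.inl rfl) (Or.inr rfl)
  have := h.neBot hm hmN hn1 hn (Or.inr rfl) (Or.inl rfl)
  have h0 := D.corrLimit ![(m, 0), (n, 0)] hm hmN
  have h1 := D.corrLimit ![(m, 0), (n, 1)] hm hmN
  have h1' := D.corrLimit ![(m, 0), (n, 1)] hn1 hn
  have h2 := D.corrLimit ![(m, 1), (n, 0)] hm hmN
  have h2' := D.corrLimit ![(m, 1), (n, 0)] hn1 hn
  simp [freq_pair, hmn.ne, hmn.ne'] at h0 h1 h1' h2 h2'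
  exact hasSimpleSpectrum_op (noEigenvector_of_corrLimit h0 (by norm_num [abs_of_pos]))
    (by norm_num) (by norm_num) h1 h1' h2 h2'

variable {D} in
theorem IsRich.hasSingularSpectrum (h : D.IsRich) {m n : ℤ} (hm : 1 ≤ m) (hmN : m ≤ N)
    (hn : 1 ≤ n) (hnN : n ≤ N) : HasSingularSpectrum (D.S.op m n) := by
  have := h.neBot hm hmN hn hnN (Or.inl rfl) (Or.inl rfl)
  have h1 := D.corrLimit ![(m, 0), (n, 0)] hm hmN
  have h1' := D.corrLimit ![(m, 0), (n, 0)] hn hnN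
  refine hasSingularSpectrum_op (l := atTop ⊓ 𝓟 {i | D.type i = ![(m, 0), (n, 0)]})
    (D.tendsto_k.mono_left inf_le_left) (x := freq ![(m, 0), (n, 0)] m 0)
    (x' := freq ![(m, 0), (n, 0)] n 0) ?_ ?_ ?_ ?_
  · simpa [freq_pair] using h1
  · simpa [freq_pair] using h1'
  -- For `m = n` both pairs count and the frequency is `1 / 2` instead of `1 / 4`; it is non-zero
  -- either way.
  · rw [freq_pair, if_pos rfl]
    split_ifs <;> norm_num
  · rw [freq_pair, if_pos rfl]
    split_ifs <;> norm_num

/-- The `m`-th part of `k i`. -/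
def quot (m : ℤ) (i : ℕ) : ℤ := D.k i / m

theorem eventually_mul_quot {m : ℤ} (hm : m ≠ 0) : ∀ᶠ i in atTop, m * D.quot m i = D.k i := by
  filter_upwards [eventually_ge_atTop m.natAbs] with i hi
  refine Int.mul_ediv_cancel' (dvd_trans ?_ (D.k_dvd i))
  rw [← Int.natAbs_dvd, Int.natCast_dvd_natCast]
  exact Nat.dvd_factorial (Int.natAbs_pos.2 hm) (by omega)

theorem tendsto_quot {m : ℤ} (hm : m ≠ 0) : Tendsto (D.quot m) atTop cofinite := by
  refine tendsto_def.2 fun s hs => ?_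
  have h1 : (((fun k => m * k) '' sᶜ)ᶜ) ∈ cofinite := by
    rw [mem_cofinite, compl_compl]
    exact (mem_cofinite.1 hs).image _
  filter_upwards [D.tendsto_k h1, D.eventually_mul_quot hm] with i hi hk
  by_contra hcon
  exact hi ⟨_, hcon, hk⟩

theorem corrLimit_quot {m : ℤ} (hm : m ≠ 0) (hN : 1 ≤ N) (t : Fin 2 → ℤ × ℤ) :
    D.S.CorrLimit (atTop ⊓ 𝓟 {i | D.type i = t}) (fun i => m * D.quot m i) (freq t 1 0)
      (freq t 1 1) := by
  intro p q
  filter_upwards [D.corrLimit t le_rfl (Nat.one_le_cast.2 hN) p q,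
    (D.eventually_mul_quot hm).filter_mono inf_le_left] with i h1 h2
  rw [h2, ← h1, one_mul]

variable {D} in
theorem IsRich.hasSingularSpectrum_diag (h : D.IsRich) (hN : 1 ≤ N) {m : ℤ} (hm : m ≠ 0) :
    HasSingularSpectrum (D.S.op m m) := by
  have hN' : (1 : ℤ) ≤ N := Nat.one_le_cast.2 hN
  have := h.neBot le_rfl hN' le_rfl hN' (Or.inl rfl) (Or.inl rfl)
  have h1 := D.corrLimit_quot hm hN ![(1, 0), (1, 0)]
  simp [freq_pair] at h1
  exact hasSingularSpectrum_op ((D.tendsto_quot hm).mono_left inf_le_left) h1 h1 (by norm_num)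
    (by norm_num)

variable {D} in
-- The three types make `T ^ (k i)` tend to `1 / 2`, `T⁻¹ / 2` and `(1 + T⁻¹) / 4`. These times are
-- reached by the powers `k i / m` of `T ^ m`.
theorem IsRich.hasHomogeneousSpectrum (h : D.IsRich) (hN : 1 ≤ N) {m : ℤ} (hm : m ≠ 0) :
    HasHomogeneousSpectrum (D.S.op m m) 2 := by
  have hN' : (1 : ℤ) ≤ N := Nat.one_le_cast.2 hN
  have := h.neBot le_rfl hN' le_rfl hN' (Or.inl rfl) (Or.inl rfl)
  have := h.neBot le_rfl hN' le_rfl hN' (Or.inr rfl) (Or.inr rfl)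
  have := h.neBot le_rfl hN' le_rfl hN' (Or.inl rfl) (Or.inr rfl)
  have h1 := D.corrLimit_quot hm hN ![(1, 0), (1, 0)]
  have h2 := D.corrLimit_quot hm hN ![(1, 1), (1, 1)]
  have h3 := D.corrLimit_quot hm hN ![(1, 0), (1, 1)]
  simp [freq_pair] at h1 h2 h3
  refine hasHomogeneousSpectrum_op ?_ ?_ ?_ ?_ h1 h2 h3
  · rw [abs_of_nonneg] <;> norm_num
  all_goals norm_num

end StackData.PairScheme

theorem mainTheorem6 (N : ℕ) (hN : 2 ≤ N) :
    ∃ (X : Type) (_ : MeasurableSpace X) (_ : StandardBorelSpace X)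
      (μ : Measure X) (_ : SigmaFinite μ) (_ : NullSingletonClass μ) (T : MeasureAut μ),
      μ univ = ∞ ∧ T.IsRankOne ∧
      (∀ m n : ℕ, 1 ≤ m → m < n → n ≤ N →
        HasSimpleSpectrum ((T.zpow m).prod (T.zpow n)).koopman ∧
        HasSingularSpectrum ((T.zpow m).prod (T.zpow n)).koopman) ∧
      (∀ m : ℤ, m ≠ 0 →
        HasHomogeneousSpectrum ((T.zpow m).prod (T.zpow m)).koopman 2 ∧
        HasSingularSpectrum ((T.zpow m).prod (T.zpow m)).koopman) ∧
      (∀ n : ℕ, N < n →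
        (T.prod (T.zpow n)).IsDissipative ∧
        HasCountableLebesgueSpectrum (T.prod (T.zpow n)).koopman) := by
  have hN1 : 1 ≤ N := one_le_two.trans hN
  obtain ⟨D, hrich⟩ := StackData.PairScheme.exists_isRich hN1
  refine ⟨D.S.Space, inferInstance, inferInstance, D.S.measure, inferInstance, inferInstance,
    D.S.aut, D.measure_univ_eq_top, D.S.aut_isRankOne D.measure_univ_eq_top, ?_, ?_, ?_⟩
  · intro m n hm hmn hn
    have hm' : (1 : ℤ) ≤ m := by exact_mod_cast hm
    have hmn' : (m : ℤ) < n := by exact_mod_cast hmn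
    have hn' : (n : ℤ) ≤ N := by exact_mod_cast hn
    exact ⟨hrich.hasSimpleSpectrum hm' hmn' hn', hrich.hasSingularSpectrum hm'
      (hmn'.le.trans hn') (hm'.trans hmn'.le) hn'⟩
  · exact fun m hm => ⟨hrich.hasHomogeneousSpectrum hN1 hm, hrich.hasSingularSpectrum_diag hN1 hm⟩
  · exact fun n hn => ⟨D.isDissipative hn, D.hasCountableLebesgueSpectrum hn⟩
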